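/- Fix an integer $k>0$. Draw a partition with row $1$ at the bottom; the cell in row $i$ and column $j$ has residue $j-i \bmod (k+1)$. A core is a partition with no cell of hook length $k+1$. For a core $\gamma$, $\mathfrak p(\gamma)$ is the partition whose $i$-th part is the number of cells of hook length at most $k$ in row $i$ of $\gamma$; $\mathfrak p$ is a bijection from the cores to the set $\mathcal P^k$ of partitions with all parts at most $k$, with inverse $\mathfrak c$. Let $\tilde S_{k+1}$ be the affine symmetric group, generated by $s_i$, $i\in\mathbb Z/(k+1)$, with $s_i^2=1$, $s_is_j=s_js_i$ for $j\ne i, i\pm1$, and $s_is_{i+1}s_i=s_{i+1}s_is_{i+1}$ (the last relation is omitted if $k=1$); let $\ell$ be its length function. Let $\mathfrak s_i$ add all addable corners of residue $i$ to a partition. An element is affine Grassmannian if it has minimal length in its coset $wS_{k+1}$, where $S_{k+1}=\langle s_1,\dots,s_k\rangle$. For $\lambda\in\mathcal P^k$, $w_\lambda$ is the affine Grassmannian element such that $\mathfrak s_{i_r}\cdots\mathfrak s_{i_1}\emptyset=\mathfrak c(\lambda)$ for a reduced word $s_{i_r}\cdots s_{i_1}$ of $w_\lambda$. The 0-Hecke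 (Demazure) product $*$ on $\tilde S_{k+1}$ is the associative product with unit $1$ and $s_i*u=s_iu$ if $\ell(s_iu)>\ell(u)$, $s_i*u=u$ otherwise; equivalently $A_vA_u=\pm A_{v*u}$ in the nil Hecke algebra with $A_i^2=-A_i$. An element is cyclically decreasing if it is a product $s_{i_1}\cdots s_{i_r}$ with distinct indices such that $j$ precedes $j-1$ (mod $k+1$) whenever both occur. For a finite sequence $\alpha=(\alpha_1,\dots,\alpha_m)$ of integers with $0\le\alpha_x\le k$, an $\alpha$-factorization of $w$ is a sequence $(w^1,\dots,w^m)$ of cyclically decreasing elements with $\ell(w^x)=\alpha_x$ and $w=w^m*\cdots*w^1$. A standard affine set-valued tableau of degree $n$ and shape $\gamma$ is a filling of the cells of $\gamma$ with nonempty subsets of $\{1,\dots,n\}$ such that, for every $1\le x\le n$, the cells containing a letter $\le x$ form a core $\mu$, and $x$ occurs, exactly in all removable corners of $\mu$ of some one residue. An affine set-valued tableau of weight $\alpha$ is a standard one of degree $\alpha_1+\cdots+\alpha_m$ such that, for each $x$, the letters of $\mathcal A_x=[1+\alpha_1+\cdots+\alpha_{x-1},\,\alpha_1+\cdots+\alpha_x]$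 satisfy: (1) reading the lowest occurrence of each of them, rows from top to bottom and each row from left to right, letters in the same cell in decreasing order, gives an increasing word; (2) they occupy exactly $\alpha_x$ distinct residues; (3) the cells containing them form a horizontal strip (a skew shape with at most one cell in each column). Theorem. For every $\lambda\in\mathcal P^k$ and every finite sequence $\alpha$ of integers in $[0,k]$ (in particular, every $k$-bounded composition), there is a bijection between the affine set-valued tableaux of shape $\mathfrak c(\lambda)$ and weight $\alpha$ and the $\alpha$-factorizations of $w_\lambda$. -/

import Mathlib

namespace AffineSV

/-! ### Partitions, cores, residues

Partitions are Young diagrams; rows and columns are indexed from `0`.  The cell `(i, j)` lies in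
row `i` (rows are counted from bottom to top) and column `j`, so "higher" means a larger first
coordinate and "lower" means a smaller one. -/

/-- The residue `j - i` mod `k + 1` of the cell `(i, j)`. -/
def residue (k : ℕ) (c : ℕ × ℕ) : ZMod (k + 1) :=
  (c.2 : ZMod (k + 1)) - (c.1 : ZMod (k + 1))

/-- The hook length of a cell `c` of `γ`: the cells weakly to the right of `c` in its row, plus the
cells strictly above `c` in its column. -/
def hookLength (γ : YoungDiagram) (c : ℕ × ℕ) : ℕ :=
  (γ.rowLen c.1 - c.2) + (γ.colLen c.2 - (c.1 + 1))

/-- A `p`-core: a partition without a cell of hook length `p`. -/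
def IsCore (p : ℕ) (γ : YoungDiagram) : Prop :=
  ∀ c ∈ γ, hookLength γ c ≠ p

/-- Removable corner of `γ`. -/
def IsRemovable (γ : YoungDiagram) (c : ℕ × ℕ) : Prop :=
  c ∈ γ ∧ (c.1, c.2 + 1) ∉ γ ∧ (c.1 + 1, c.2) ∉ γ

/-- Addable corner of `γ` (the left and lower neighbours are required only if they exist). -/
def IsAddable (γ : YoungDiagram) (c : ℕ × ℕ) : Prop :=
  c ∉ γ ∧ (∀ i, c.1 = i + 1 → (i, c.2) ∈ γ) ∧ (∀ j, c.2 = j + 1 → (c.1, j) ∈ γ)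

/-- Row lengths of what remains of `γ` after all cells of hook length `> k` are deleted:
the parts of `𝔭(γ)`. -/
def boundedRowLen (k : ℕ) (γ : YoungDiagram) (i : ℕ) : ℕ :=
  ((Finset.range (γ.rowLen i)).filter fun j => hookLength γ (i, j) ≤ k).card

/-- `𝔠(lam)`: the `k+1`-core `γ` with `𝔭(γ) = lam`, for a `k`-bounded partition `lam`. -/
noncomputable def coreOf (k : ℕ) (lam : YoungDiagram) : YoungDiagram :=
  Function.invFunOn (boundedRowLen k) {γ | IsCore (k + 1) γ} lam.rowLen

open Classical in
/-- `𝔰ᵢ(γ)`: the diagram `γ` together with all its addable corners of residue `i`. -/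
noncomputable def addCorners (k : ℕ) (i : ZMod (k + 1)) (γ : YoungDiagram) : YoungDiagram where
  cells := γ.cells ∪
    ((Finset.range (γ.colLen 0 + 1) ×ˢ Finset.range (γ.rowLen 0 + 1)).filter
      fun c => IsAddable γ c ∧ residue k c = i)
  isLowerSet := by
    rintro ⟨a, b⟩ ⟨a', b'⟩ hle hab
    have h1 : a' ≤ a := hle.1
    have h2 : b' ≤ b := hle.2
    simp only [Finset.coe_union, Set.mem_union, Finset.mem_coe, YoungDiagram.mem_cells] at hab ⊢
    rcases hab with hab | hab
    · exact Or.inl (γ.up_left_mem h1 h2 hab)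
    · by_cases heq : a' = a ∧ b' = b
      · right
        rw [heq.1, heq.2]
        exact hab
      · left
        obtain ⟨-, ⟨-, hl, hr⟩, -⟩ := Finset.mem_filter.1 hab
        rcases Nat.lt_or_ge a' a with h | h
        · obtain ⟨i', rfl⟩ : ∃ i', a = i' + 1 := ⟨a - 1, by omega⟩
          exact γ.up_left_mem (by omega) h2 (hl i' rfl)
        · obtain ⟨j', rfl⟩ : ∃ j', b = j' + 1 := ⟨b - 1, by omega⟩
          exact γ.up_left_mem h1 (by omega) (hr j' rfl)

theorem mem_addCorners (k : ℕ) (i : ZMod (k + 1)) (γ : YoungDiagram) (c : ℕ × ℕ) :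
    c ∈ addCorners k i γ ↔ c ∈ γ ∨ (IsAddable γ c ∧ residue k c = i) := by
  classical
  rw [← YoungDiagram.mem_cells]
  simp only [addCorners, Finset.mem_union, YoungDiagram.mem_cells, Finset.mem_filter,
    Finset.mem_product, Finset.mem_range]
  constructor
  · rintro (h | h)
    · exact Or.inl h
    · exact Or.inr h.2
  · rintro (h | h)
    · exact Or.inl h
    · refine Or.inr ⟨⟨?_, ?_⟩, h⟩
      · rcases c with ⟨_ | a, b⟩
        · simp
        · have : a < γ.colLen b := YoungDiagram.mem_iff_lt_colLen.1 (h.1.2.1 a rfl)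
          have := γ.colLen_anti 0 b (Nat.zero_le _)
          simp only
          omega
      · rcases c with ⟨a, _ | b⟩
        · simp
        · have : b < γ.rowLen a := YoungDiagram.mem_iff_lt_rowLen.1 (h.1.2.2 b rfl)
          have := γ.rowLen_anti 0 a (Nat.zero_le _)
          simp only
          omega

/-! ### Affine set-valued tableaux

A set-valued filling is a function `T : ℕ × ℕ → Finset ℕ`; the cells outside the shape are those
with `T c = ∅`. -/

/-- `T` is a standard affine set-valued tableau of shape `γ` and degree `n`. The set
`{c | ∃ a ∈ T c, a ≤ x}` is the shape of `T_{≤ x}`. -/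
def IsStandard (k : ℕ) (γ : YoungDiagram) (n : ℕ) (T : ℕ × ℕ → Finset ℕ) : Prop :=
  (∀ c, (T c).Nonempty ↔ c ∈ γ) ∧
  (∀ c, ∀ a ∈ T c, 1 ≤ a ∧ a ≤ n) ∧
  ∀ x, 1 ≤ x → x ≤ n → ∃ μ : YoungDiagram,
    (∀ c, c ∈ μ ↔ ∃ a ∈ T c, a ≤ x) ∧ IsCore (k + 1) μ ∧
    ∃ i : ZMod (k + 1), (∃ c, x ∈ T c) ∧ ∀ c, x ∈ T c ↔ IsRemovable μ c ∧ residue k c = i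

/-- The alphabet `[1 + α₁ + ⋯ + α_{x-1}, α₁ + ⋯ + α_x]` (with `x` counted from `0` here). -/
def alphabet {m : ℕ} (α : Fin m → ℕ) (x : Fin m) : Finset ℕ :=
  Finset.Icc (1 + ∑ y ∈ Finset.Iio x, α y) (∑ y ∈ Finset.Iic x, α y)

/-- `c` is the lowest cell of `T` that contains the letter `a`. -/
def IsLowestOccurrence (T : ℕ × ℕ → Finset ℕ) (a : ℕ) (c : ℕ × ℕ) : Prop :=
  a ∈ T c ∧ ∀ d, a ∈ T d → c.1 ≤ d.1

/-- The letter `a` in cell `c` is read before the letter `b` in cell `d`: rows are read from top to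
bottom, each row from left to right, and letters of the same cell in decreasing order. -/
def ReadBefore (a : ℕ) (c : ℕ × ℕ) (b : ℕ) (d : ℕ × ℕ) : Prop :=
  d.1 < c.1 ∨ (c.1 = d.1 ∧ (c.2 < d.2 ∨ (c.2 = d.2 ∧ b < a)))

/-- The lowest reading word of `T` in the alphabet `A` is increasing. -/
def LowestReadingWordIncreasing (T : ℕ × ℕ → Finset ℕ) (A : Finset ℕ) : Prop :=
  ∀ a ∈ A, ∀ b ∈ A, a < b → ∀ c d, IsLowestOccurrence T a c → IsLowestOccurrence T b d →
    ReadBefore a c b d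

/-- The cells of `T` that contain a letter of `A`. -/
def occupied (T : ℕ × ℕ → Finset ℕ) (A : Finset ℕ) : Set (ℕ × ℕ) :=
  {c | ∃ a ∈ A, a ∈ T c}

/-- A horizontal strip: a skew shape with at most one cell in each column. -/
def IsHorizontalStrip (S : Set (ℕ × ℕ)) : Prop :=
  (∃ γ ρ : YoungDiagram, ρ ≤ γ ∧ ∀ c, c ∈ S ↔ c ∈ γ ∧ c ∉ ρ) ∧
  ∀ c ∈ S, ∀ d ∈ S, c.2 = d.2 → c = d

/-- The set of affine set-valued tableaux of shape `γ` and weight `α`. -/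
def affineSVTableaux (k : ℕ) (γ : YoungDiagram) {m : ℕ} (α : Fin m → ℕ) :
    Set (ℕ × ℕ → Finset ℕ) :=
  {T | IsStandard k γ (∑ x, α x) T ∧ ∀ x : Fin m,
    LowestReadingWordIncreasing T (alphabet α x) ∧
    (residue k '' occupied T (alphabet α x)).ncard = α x ∧
    IsHorizontalStrip (occupied T (alphabet α x))}

/-! ### The affine symmetric group and its 0-Hecke product -/

/-- The Coxeter matrix of type `Ã_k`, with nodes `ZMod (k + 1)`.  For `k = 1` the two generators
satisfy no braid relation (the entry `0` stands for `∞`). -/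
def affineMatrix (k : ℕ) : CoxeterMatrix (ZMod (k + 1)) where
  M := Matrix.of fun i j =>
    if i = j then 1 else if j = i + 1 ∨ i = j + 1 then (if k = 1 then 0 else 3) else 2
  isSymm := by
    ext i j
    simp only [Matrix.transpose_apply, Matrix.of_apply]
    have h1 : (j = i) = (i = j) := propext eq_comm
    have h2 : (i = j + 1 ∨ j = i + 1) = (j = i + 1 ∨ i = j + 1) := propext or_comm
    simp only [h1, h2]
  diagonal := by
    intro i
    simp
  off_diagonal := by
    intro i j h
    simp only [Matrix.of_apply, if_neg h]
    split_ifs <;> simp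

/-- The affine symmetric group `S̃_{k+1}`, generated by `s_i`, `i ∈ ZMod (k + 1)`. -/
abbrev AffinePerm (k : ℕ) : Type := (affineMatrix k).Group

/-- The Coxeter system of the affine symmetric group. -/
abbrev cox (k : ℕ) : CoxeterSystem (affineMatrix k) (AffinePerm k) :=
  (affineMatrix k).toCoxeterSystem

/-- A reduced word of `w`. -/
noncomputable def reducedWord (k : ℕ) (w : AffinePerm k) : List (ZMod (k + 1)) :=
  ((cox k).exists_isReduced w).choose

/-- The 0-Hecke action of a generator: `s_i * u = s_i u` if this is longer than `u`, and
`s_i * u = u` otherwise. Up to sign this is the product `A_i A_u` in the nil Hecke algebra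
with `A_i ^ 2 = - A_i`. -/
noncomputable def heckeSimple (k : ℕ) (i : ZMod (k + 1)) (u : AffinePerm k) : AffinePerm k :=
  if (cox k).length u < (cox k).length ((cox k).simple i * u) then (cox k).simple i * u else u

/-- The 0-Hecke (Demazure) product `v * u`: if `v = s_{i_1} ⋯ s_{i_r}` is reduced, it is
`s_{i_1} * (⋯ * (s_{i_r} * u))`.  Equivalently, `A_v A_u = ± A_{v * u}`. -/
noncomputable def heckeMul (k : ℕ) (v u : AffinePerm k) : AffinePerm k :=
  (reducedWord k v).foldr (heckeSimple k) u

/-- A word is cyclically decreasing if no letter is repeated and `j` precedes `j - 1` (mod `k+1`)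
whenever both occur. -/
def IsCyclicallyDecreasingWord (k : ℕ) (ω : List (ZMod (k + 1))) : Prop :=
  ω.Nodup ∧ ∀ j, j ∈ ω → j - 1 ∈ ω → ω.idxOf j < ω.idxOf (j - 1)

/-- Cyclically decreasing elements of the affine symmetric group. -/
def IsCyclicallyDecreasing (k : ℕ) (w : AffinePerm k) : Prop :=
  ∃ ω, IsCyclicallyDecreasingWord k ω ∧ (cox k).wordProd ω = w

/-- The `α`-factorizations `w = w^m * ⋯ * w^1` (0-Hecke product) of `w` into cyclically decreasing
elements with `ℓ(w^x) = α_x`; here `f x` is `w^{x+1}`. -/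
def alphaFactorizations (k : ℕ) {m : ℕ} (α : Fin m → ℕ) (w : AffinePerm k) :
    Set (Fin m → AffinePerm k) :=
  {f | (∀ x, IsCyclicallyDecreasing k (f x) ∧ (cox k).length (f x) = α x) ∧
    (List.ofFn f).foldl (fun u v => heckeMul k v u) 1 = w}

/-- Affine Grassmannian elements: minimal length representatives of the cosets `w S_{k+1}`, where
`S_{k+1}` is the finite symmetric group generated by the `s_i` with `i ≠ 0`. -/
def IsGrassmannian (k : ℕ) (w : AffinePerm k) : Prop :=
  ∀ v ∈ Subgroup.closure ((cox k).simple '' {i | i ≠ 0}),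
    (cox k).length w ≤ (cox k).length (w * v)

/-- The map `𝔱 : w ↦ 𝔰_{i_ℓ} ⋯ 𝔰_{i_1} ∅` for a reduced word `i_ℓ ⋯ i_1` of `w`. -/
noncomputable def toCore (k : ℕ) (w : AffinePerm k) : YoungDiagram :=
  (reducedWord k w).foldr (addCorners k) ⊥

/-- The affine Grassmannian element `w_lam = 𝔱⁻¹(𝔠(lam))`. -/
noncomputable def grassmannianOf (k : ℕ) (lam : YoungDiagram) : AffinePerm k :=
  Function.invFunOn (toCore k) {w | IsGrassmannian k w} (coreOf k lam)

end AffineSV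

/-! Both sides are encoded by words of residues, one block of letters for each entry of `α`
(`codes`); the argument works for an arbitrary core in place of `coreOf k lam`.

Cores. The boundary of a partition is a two-sided sequence of vertical and horizontal steps. A core
is one whose vertical steps form, on each runner modulo `k + 1`, a downward closed set, so it is
described by its levels `lev`. Adding all corners of residue `i` sorts the levels of the runners `i
- 1` and `i`. The sign of their difference `jump` says whether there are removable corners
(positive), addable corners (negative) or neither (zero).

Group. Undoing corner additions attaches to each core an element of the affine symmetric group. It
is well defined because two ways of removing corners are joined by commutation and braid relations
(`IsRep.unique`). If the jump at `i` is zero then `s_i w = w s_t` with `t ≠ 0`, so these elements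
are exactly the affine Grassmannian ones. A Demazure step at a zero jump leaves this set and no
later step on the left can return to it. Hence a 0-Hecke product equals `w_lam` exactly when its
word, read as a path of cores from the empty one, has a nonzero jump at every step and ends at the
given core (`heckePath_eq_iff`).

Tableaux. Such valid paths are the same thing as standard affine set-valued tableaux: the letter `p
+ 1` fills the removable corners of the residue of step `p` (`tabOf`, `exists_word_of_isStandard`).
The three weight conditions on a block say that its word is the reverse of a cyclically decreasing
word and that the contents of the lowest cells of its letters increase (`blockCondition_iff`).

Matching. A cyclically decreasing element determines its word up to commutations of non-adjacent
letters. Commutations change neither the path's endpoint, nor its validity, nor the lowest cell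
attached to each letter (`path_eq_of_perm`). So each commutation class contains exactly one word
with increasing contents (`exists_sortedPath`, `eq_of_sortedPath`), and the codes match the
factorizations. -/

namespace AffineSV

/-! ### Maya diagrams -/

/-- The position of the vertical boundary step at the end of row `r`. -/
def rowPos (γ : YoungDiagram) (r : ℕ) : ℤ := (γ.rowLen r : ℤ) - r - 1

/-- The set of positions of the vertical boundary steps of `γ`. -/
def maya (γ : YoungDiagram) : Set ℤ := Set.range (rowPos γ)

theorem rowPos_strictAnti (γ : YoungDiagram) : StrictAnti (rowPos γ) := by
  intro a b h
  have := γ.rowLen_anti a b h.le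
  simp only [rowPos]
  omega

theorem rowPos_mem_maya (γ : YoungDiagram) (r : ℕ) : rowPos γ r ∈ maya γ := ⟨r, rfl⟩

theorem eq_of_rowLen_eq {γ δ : YoungDiagram} (h : ∀ r, γ.rowLen r = δ.rowLen r) : γ = δ := by
  ext ⟨r, j⟩
  rw [YoungDiagram.mem_cells, YoungDiagram.mem_cells, YoungDiagram.mem_iff_lt_rowLen,
    YoungDiagram.mem_iff_lt_rowLen, h]

/-- A strictly monotone sequence is determined by its range; the negation makes the strictly
decreasing row positions increasing. -/
theorem maya_injective : Function.Injective maya := by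
  intro γ δ h
  have h1 : StrictMono (fun r => -rowPos γ r) := fun a b hab => neg_lt_neg (rowPos_strictAnti γ hab)
  have h2 : StrictMono (fun r => -rowPos δ r) := fun a b hab => neg_lt_neg (rowPos_strictAnti δ hab)
  have h3 : Set.range (fun r => -rowPos γ r) = Set.range (fun r => -rowPos δ r) := by
    have : ∀ ε : YoungDiagram, Set.range (fun r => -rowPos ε r) = (fun x => -x) '' maya ε := by
      intro ε
      rw [maya, ← Set.range_comp]
      rfl
    rw [this, this, h]
  have h4 := (h1.range_inj h2).1 h3
  refine eq_of_rowLen_eq fun r => ?_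
  have := congrFun h4 r
  simp only [rowPos] at this
  omega

theorem exists_rowLen_eq_zero (γ : YoungDiagram) : ∃ L, ∀ r, L ≤ r → γ.rowLen r = 0 := by
  refine ⟨γ.colLen 0, fun r hr => ?_⟩
  by_contra h
  have : (r, 0) ∈ γ := YoungDiagram.mem_iff_lt_rowLen.2 (Nat.pos_of_ne_zero h)
  have := YoungDiagram.mem_iff_lt_colLen.1 this
  omega

theorem exists_forall_lt_mem_maya (γ : YoungDiagram) : ∃ b : ℤ, ∀ x < b, x ∈ maya γ := by
  obtain ⟨L, hL⟩ := exists_rowLen_eq_zero γ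
  refine ⟨-L, fun x hx => ⟨(-x - 1).toNat, ?_⟩⟩
  have := hL (-x - 1).toNat (by omega)
  simp only [rowPos, this]
  omega

theorem le_rowPos_zero {γ : YoungDiagram} {x : ℤ} (hx : x ∈ maya γ) : x ≤ rowPos γ 0 := by
  obtain ⟨r, rfl⟩ := hx
  exact (rowPos_strictAnti γ).antitone (Nat.zero_le r)

/-- The horizontal boundary step that closes column `j` sits at position `j - colLen j`. With the
next theorem, the horizontal steps are exactly the complement of the vertical ones. -/
theorem col_notMem_maya (γ : YoungDiagram) (j : ℕ) : (j : ℤ) - γ.colLen j ∉ maya γ := by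
  rintro ⟨r, hr⟩
  simp only [rowPos] at hr
  by_cases h : (r, j) ∈ γ
  · have h1 := YoungDiagram.mem_iff_lt_rowLen.1 h
    have h2 := YoungDiagram.mem_iff_lt_colLen.1 h
    omega
  · have h1 := mt YoungDiagram.mem_iff_lt_rowLen.2 h
    have h2 := mt YoungDiagram.mem_iff_lt_colLen.2 h
    omega

theorem exists_col_of_notMem_maya {γ : YoungDiagram} {x : ℤ} (hx : x ∉ maya γ) :
    ∃ j : ℕ, x = (j : ℤ) - γ.colLen j := by
  have hex : ∃ r, rowPos γ r < x := by
    obtain ⟨L, hL⟩ := exists_rowLen_eq_zero γ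
    refine ⟨max L (-x).toNat, ?_⟩
    have := hL (max L (-x).toNat) (le_max_left _ _)
    have := le_max_right L (-x).toNat
    simp only [rowPos]
    omega
  classical
  have h1 := Nat.find_spec hex
  have h2 : ∀ r < Nat.find hex, x < rowPos γ r := by
    intro r hr
    have h3 := Nat.find_min hex hr
    have : rowPos γ r ≠ x := fun h => hx ⟨r, h⟩
    omega
  set r := Nat.find hex
  have h3 : (γ.rowLen r : ℤ) ≤ x + r := by simp only [rowPos] at h1; omega
  -- `x` lies strictly between the positions of rows `r` and `r - 1` (above the former only, if `r =
  -- 0`), so it is a horizontal step at height `r`, hence over column `x + r`.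
  obtain ⟨j, hj⟩ : ∃ j : ℕ, (j : ℤ) = x + r := ⟨(x + r).toNat, by omega⟩
  refine ⟨j, ?_⟩
  have h4 : ¬ r < γ.colLen j := by
    rw [← YoungDiagram.mem_iff_lt_colLen, YoungDiagram.mem_iff_lt_rowLen]
    omega
  have h5 : r ≤ γ.colLen j := by
    by_contra h
    have h6 := h2 (r - 1) (by omega)
    have h7 : ¬ (r - 1, j) ∈ γ := by rw [YoungDiagram.mem_iff_lt_colLen]; omega
    rw [YoungDiagram.mem_iff_lt_rowLen] at h7
    simp only [rowPos] at h6
    omega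
  omega

/-- The hook of a cell is the stretch of boundary between the horizontal step of its column and the
vertical step of its row. -/
theorem hookLength_eq {γ : YoungDiagram} {r j : ℕ} (h : (r, j) ∈ γ) :
    (hookLength γ (r, j) : ℤ) = rowPos γ r - ((j : ℤ) - γ.colLen j) := by
  have h1 := YoungDiagram.mem_iff_lt_rowLen.1 h
  have h2 := YoungDiagram.mem_iff_lt_colLen.1 h
  simp only [hookLength, rowPos]
  omega

theorem mem_iff_col_lt_rowPos {γ : YoungDiagram} {r j : ℕ} :
    (r, j) ∈ γ ↔ (j : ℤ) - γ.colLen j < rowPos γ r := by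
  constructor
  · intro h
    have h1 := YoungDiagram.mem_iff_lt_rowLen.1 h
    have h2 := YoungDiagram.mem_iff_lt_colLen.1 h
    simp only [rowPos]
    omega
  · intro h
    by_contra h'
    have h1 := mt YoungDiagram.mem_iff_lt_rowLen.2 h'
    have h2 := mt YoungDiagram.mem_iff_lt_colLen.2 h'
    simp only [rowPos] at h
    omega

/-- A hook of length `k + 1` is a vertical step preceded, at distance `k + 1`, by a horizontal one.
-/
theorem isCore_iff {k : ℕ} {γ : YoungDiagram} :
    IsCore (k + 1) γ ↔ ∀ x ∈ maya γ, x - (k + 1) ∈ maya γ := by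
  constructor
  · rintro h _ ⟨r, rfl⟩
    by_contra hx
    obtain ⟨j, hj⟩ := exists_col_of_notMem_maya hx
    have hm : (r, j) ∈ γ := mem_iff_col_lt_rowPos.2 (by omega)
    have := hookLength_eq hm
    exact h _ hm (by omega)
  · rintro h ⟨r, j⟩ hm hh
    have := hookLength_eq hm
    have h1 := h _ (rowPos_mem_maya γ r)
    have h2 : rowPos γ r - (k + 1) = (j : ℤ) - γ.colLen j := by rw [hh] at this; push_cast at this; omega
    rw [h2] at h1
    exact col_notMem_maya γ j h1

theorem rowPos_add_one_notMem_iff {γ : YoungDiagram} {r : ℕ} :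
    rowPos γ r + 1 ∉ maya γ ↔ ∀ s, r = s + 1 → γ.rowLen r < γ.rowLen s := by
  constructor
  · rintro h s rfl
    have := γ.rowLen_anti s (s + 1) (by omega)
    by_contra h'
    exact h ⟨s, by simp only [rowPos]; push_cast; omega⟩
  · rintro h ⟨s, hs⟩
    have h1 : s < r := by
      by_contra h'
      have := (rowPos_strictAnti γ).antitone (not_lt.1 h')
      omega
    obtain ⟨r', rfl⟩ : ∃ r', r = r' + 1 := ⟨r - 1, by omega⟩
    have h2 := h r' rfl
    have h3 := γ.rowLen_anti s r' (by omega)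
    simp only [rowPos] at hs
    omega

theorem rowPos_sub_one_notMem_iff {γ : YoungDiagram} {r : ℕ} :
    rowPos γ r - 1 ∉ maya γ ↔ γ.rowLen (r + 1) < γ.rowLen r := by
  have := γ.rowLen_anti r (r + 1) (by omega)
  constructor
  · intro h
    by_contra h'
    exact h ⟨r + 1, by simp only [rowPos]; push_cast; omega⟩
  · rintro h ⟨s, hs⟩
    have h1 : r < s := by
      by_contra h'
      have := (rowPos_strictAnti γ).antitone (not_lt.1 h')
      omega
    have h3 := γ.rowLen_anti (r + 1) s (by omega)
    simp only [rowPos] at hs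
    omega

theorem isAddable_iff {γ : YoungDiagram} {r j : ℕ} :
    IsAddable γ (r, j) ↔ j = γ.rowLen r ∧ rowPos γ r + 1 ∉ maya γ := by
  rw [rowPos_add_one_notMem_iff]
  simp only [IsAddable, YoungDiagram.mem_iff_lt_rowLen]
  constructor
  · rintro ⟨h1, h2, h3⟩
    have h4 : j = γ.rowLen r := by
      rcases j with _ | j
      · omega
      · have := h3 j rfl
        omega
    exact ⟨h4, fun s hs => h4 ▸ h2 s hs⟩
  · rintro ⟨rfl, h⟩
    exact ⟨by omega, h, fun j hj => by omega⟩

theorem isRemovable_iff {γ : YoungDiagram} {r j : ℕ} :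
    IsRemovable γ (r, j) ↔ j + 1 = γ.rowLen r ∧ rowPos γ r - 1 ∉ maya γ := by
  rw [rowPos_sub_one_notMem_iff]
  simp only [IsRemovable, YoungDiagram.mem_iff_lt_rowLen]
  omega

theorem residue_eq (k r j : ℕ) : residue k (r, j) = (((j : ℤ) - r : ℤ) : ZMod (k + 1)) := by
  simp [residue]

theorem exists_isRemovable_of_mem_maya {γ : YoungDiagram} {x : ℤ} (h : x ∈ maya γ)
    (h' : x - 1 ∉ maya γ) : ∃ c : ℕ × ℕ, IsRemovable γ c ∧ (c.2 : ℤ) - c.1 = x := by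
  obtain ⟨r, rfl⟩ := h
  have := rowPos_sub_one_notMem_iff.1 h'
  refine ⟨(r, γ.rowLen r - 1), isRemovable_iff.2 ⟨by omega, h'⟩, ?_⟩
  simp only [rowPos]
  omega

theorem IsRemovable.mem_maya {γ : YoungDiagram} {c : ℕ × ℕ} (h : IsRemovable γ c) :
    (c.2 : ℤ) - c.1 ∈ maya γ ∧ (c.2 : ℤ) - c.1 - 1 ∉ maya γ := by
  obtain ⟨r, j⟩ := c
  obtain ⟨h1, h2⟩ := isRemovable_iff.1 h
  have : rowPos γ r = (j : ℤ) - r := by simp only [rowPos]; omega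
  rw [this] at h2
  exact ⟨⟨r, this⟩, h2⟩

theorem IsAddable.mem_maya {γ : YoungDiagram} {c : ℕ × ℕ} (h : IsAddable γ c) :
    (c.2 : ℤ) - c.1 ∉ maya γ ∧ (c.2 : ℤ) - c.1 - 1 ∈ maya γ := by
  obtain ⟨r, j⟩ := c
  obtain ⟨h1, h2⟩ := isAddable_iff.1 h
  have : rowPos γ r = (j : ℤ) - r - 1 := by simp only [rowPos]; omega
  rw [this] at h2
  exact ⟨by simpa using h2, ⟨r, this⟩⟩

/-! ### Levels of a core -/

/-- For a core `γ`, the number `m` such that `a + m' (k + 1)` is a vertical step iff `m' < m`. -/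
noncomputable def lev (k : ℕ) (γ : YoungDiagram) (a : ℤ) : ℤ :=
  sInf {m : ℤ | a + m * (k + 1) ∉ maya γ}

/-- On a runner `a + ℤ (k + 1)` the vertical steps of a core are closed downwards, absent far up and
present far down, so the infimum defining `lev` is attained and separates the two kinds. -/
theorem lt_lev_iff {k : ℕ} {γ : YoungDiagram} (hγ : IsCore (k + 1) γ) (a m : ℤ) :
    m < lev k γ a ↔ a + m * (k + 1) ∈ maya γ := by
  rw [isCore_iff] at hγ
  have hdown : ∀ (d : ℕ) (x : ℤ), x ∈ maya γ → x - d * (k + 1) ∈ maya γ := by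
    intro d
    induction d with
    | zero => simp
    | succ d ih =>
      intro x hx
      have := hγ _ (ih x hx)
      convert this using 1
      push_cast
      ring
  have hmono : ∀ m m' : ℤ, m ≤ m' → a + m' * (k + 1) ∈ maya γ → a + m * (k + 1) ∈ maya γ := by
    intro m m' h hm
    have := hdown (m' - m).toNat _ hm
    rw [Int.toNat_of_nonneg (by omega)] at this
    convert this using 1
    ring
  have hne : {m : ℤ | a + m * (k + 1) ∉ maya γ}.Nonempty := by
    -- A crude bound: one turn of the runner is at least `1`, so this many turns pass the last
    -- vertical step.
    refine ⟨|rowPos γ 0| + |a| + 1, fun h => ?_⟩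
    have h1 := le_rowPos_zero h
    have h2 := le_abs_self (rowPos γ 0)
    have h3 := neg_abs_le a
    have h4 := abs_nonneg a
    have h5 := abs_nonneg (rowPos γ 0)
    nlinarith [mul_nonneg (by positivity : (0 : ℤ) ≤ |rowPos γ 0| + |a| + 1) (Int.natCast_nonneg k)]
  have hbdd : BddBelow {m : ℤ | a + m * (k + 1) ∉ maya γ} := by
    obtain ⟨b, hb⟩ := exists_forall_lt_mem_maya γ
    refine ⟨-|b| - |a| - 1, fun m hm => ?_⟩
    by_contra h
    refine hm (hb _ ?_)
    have h3 := neg_abs_le b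
    have h2 := le_abs_self a
    have h4 := abs_nonneg a
    have h5 := abs_nonneg b
    nlinarith [mul_nonneg (by omega : (0 : ℤ) ≤ -m) (Int.natCast_nonneg k)]
  constructor
  · intro h
    by_contra h'
    exact absurd (csInf_le hbdd h') (not_le.2 h)
  · intro h
    by_contra h'
    exact Int.csInf_mem hne hbdd (hmono _ _ (not_lt.1 h') h)

section
variable {k : ℕ} {γ δ : YoungDiagram}

theorem mem_maya_iff (hγ : IsCore (k + 1) γ) (a : ℤ) : a ∈ maya γ ↔ 0 < lev k γ a := by
  rw [lt_lev_iff hγ]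
  simp

/-- Quasi-periodicity and positivity on vertical steps characterise the levels; this computes them
after corner moves. -/
theorem lev_eq_of (hγ : IsCore (k + 1) γ) {h : ℤ → ℤ}
    (hh : ∀ a, h (a + (k + 1)) = h a - 1) (hm : ∀ a, a ∈ maya γ ↔ 0 < h a) : lev k γ = h := by
  have hper : ∀ (d : ℕ) (a : ℤ), h (a + d * (k + 1)) = h a - d := by
    intro d
    induction d with
    | zero => simp
    | succ d ih =>
      intro a
      have := hh (a + d * (k + 1))
      rw [ih] at this
      push_cast
      rw [show a + ((d : ℤ) + 1) * (k + 1) = a + d * (k + 1) + (k + 1) by ring, this]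
      ring
  have hper' : ∀ (m a : ℤ), h (a + m * (k + 1)) = h a - m := by
    intro m a
    rcases Int.le_total 0 m with h0 | h0
    · have := hper m.toNat a
      rwa [Int.toNat_of_nonneg h0] at this
    · have := hper (-m).toNat (a + m * (k + 1))
      rw [Int.toNat_of_nonneg (by omega), show a + m * (k + 1) + -m * (k + 1) = a by ring] at this
      omega
  ext a
  refine eq_of_forall_lt_iff fun m => ?_
  rw [lt_lev_iff hγ, hm, hper']
  omega

theorem lev_add_mul (hγ : IsCore (k + 1) γ) (a m : ℤ) :
    lev k γ (a + m * (k + 1)) = lev k γ a - m := by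
  refine eq_of_forall_lt_iff fun m' => ?_
  rw [lt_lev_iff hγ, show a + m * (k + 1) + m' * (k + 1) = a + (m + m') * (k + 1) by ring,
    ← lt_lev_iff hγ]
  omega

theorem lev_add (hγ : IsCore (k + 1) γ) (a : ℤ) : lev k γ (a + (k + 1)) = lev k γ a - 1 := by
  simpa using lev_add_mul hγ a 1

theorem lev_injective (hγ : IsCore (k + 1) γ) (hδ : IsCore (k + 1) δ) (h : lev k γ = lev k δ) :
    γ = δ := by
  apply maya_injective
  ext a
  rw [mem_maya_iff hγ, mem_maya_iff hδ, h]

theorem isCore_of {h : ℤ → ℤ} (hh : ∀ a, h (a + (k + 1)) = h a - 1)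
    (hm : ∀ a, a ∈ maya γ ↔ 0 < h a) : IsCore (k + 1) γ := by
  rw [isCore_iff]
  intro x hx
  rw [hm] at hx ⊢
  have := hh (x - (k + 1))
  rw [sub_add_cancel] at this
  omega

end

theorem exists_mul_of_intCast_eq {k : ℕ} {a b : ℤ} (h : (a : ZMod (k + 1)) = b) :
    ∃ m : ℤ, b = a + m * (k + 1) := by
  have := (ZMod.intCast_eq_intCast_iff_dvd_sub a b (k + 1)).1 h
  obtain ⟨m, hm⟩ := this
  refine ⟨m, ?_⟩
  push_cast at hm
  linarith

/-! ### Adding and removing corners -/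

open Classical in
/-- The diagram `γ` without its removable corners of residue `i`. -/
noncomputable def removeCorners (k : ℕ) (i : ZMod (k + 1)) (γ : YoungDiagram) : YoungDiagram where
  cells := γ.cells.filter fun c => ¬ (IsRemovable γ c ∧ residue k c = i)
  isLowerSet := by
    rintro ⟨a, b⟩ ⟨a', b'⟩ hle hab
    have h1 : a' ≤ a := hle.1
    have h2 : b' ≤ b := hle.2
    simp only [Finset.coe_filter, Set.mem_ofPred_eq, YoungDiagram.mem_cells] at hab ⊢
    refine ⟨γ.up_left_mem h1 h2 hab.1, fun h => ?_⟩
    by_cases heq : a' = a ∧ b' = b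
    · rw [heq.1, heq.2] at h
      exact hab.2 h
    · obtain ⟨-, hr, hu⟩ := h.1
      rcases Nat.lt_or_ge a' a with h3 | h3
      · exact hu (γ.up_left_mem h3 h2 hab.1)
      · exact hr (γ.up_left_mem h1 (by simp only; omega) hab.1)

theorem mem_removeCorners {k : ℕ} {i : ZMod (k + 1)} {γ : YoungDiagram} {c : ℕ × ℕ} :
    c ∈ removeCorners k i γ ↔ c ∈ γ ∧ ¬ (IsRemovable γ c ∧ residue k c = i) := by
  classical
  rw [← YoungDiagram.mem_cells, ← YoungDiagram.mem_cells]
  simp only [removeCorners, Finset.mem_filter]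

/-- The effect on levels of adding all corners of residue `i`. -/
def raise (k : ℕ) (i : ZMod (k + 1)) (h : ℤ → ℤ) (c : ℤ) : ℤ :=
  if (c : ZMod (k + 1)) = i then max (h c) (h (c - 1))
  else if (c : ZMod (k + 1)) + 1 = i then min (h c) (h (c + 1)) else h c

/-- The effect on levels of removing all corners of residue `i`. -/
def lower (k : ℕ) (i : ZMod (k + 1)) (h : ℤ → ℤ) (c : ℤ) : ℤ :=
  if (c : ZMod (k + 1)) = i then min (h c) (h (c - 1))
  else if (c : ZMod (k + 1)) + 1 = i then max (h c) (h (c + 1)) else h c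

section
variable {k : ℕ} {γ : YoungDiagram}

/-! ### Arithmetic of residues, and corner moves as sorting of levels. -/

theorem zmod_one_ne_zero (hk : 0 < k) : (1 : ZMod (k + 1)) ≠ 0 := by
  have : Fact (1 < k + 1) := ⟨by omega⟩
  exact one_ne_zero

theorem zmod_add_one_ne (hk : 0 < k) (i : ZMod (k + 1)) : i + 1 ≠ i := by
  simpa using zmod_one_ne_zero hk

theorem zmod_two_ne_zero (hk : 1 < k) : (1 + 1 : ZMod (k + 1)) ≠ 0 := by
  intro h
  have h1 : ((2 : ℕ) : ZMod (k + 1)) = 0 := by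
    push_cast
    rw [← h]
    norm_num
  have := Nat.le_of_dvd (by norm_num) ((ZMod.natCast_eq_zero_iff 2 (k + 1)).1 h1)
  omega

theorem intCast_add_period (a : ℤ) : ((a + (k + 1) : ℤ) : ZMod (k + 1)) = a := by
  have := ZMod.natCast_self (k + 1)
  push_cast at this ⊢
  rw [this, add_zero]

theorem rowPos_addCorners (i : ZMod (k + 1)) (r : ℕ) [Decidable (rowPos γ r + 1 ∉ maya γ ∧
    ((rowPos γ r + 1 : ℤ) : ZMod (k + 1)) = i)] :
    rowPos (addCorners k i γ) r =
      if rowPos γ r + 1 ∉ maya γ ∧ ((rowPos γ r + 1 : ℤ) : ZMod (k + 1)) = i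
      then rowPos γ r + 1 else rowPos γ r := by
  have hmem : ∀ j, j < (addCorners k i γ).rowLen r ↔ j < γ.rowLen r ∨ (j = γ.rowLen r ∧
      (rowPos γ r + 1 ∉ maya γ ∧ ((rowPos γ r + 1 : ℤ) : ZMod (k + 1)) = i)) := by
    intro j
    rw [← YoungDiagram.mem_iff_lt_rowLen, mem_addCorners, YoungDiagram.mem_iff_lt_rowLen,
      isAddable_iff, residue_eq]
    refine or_congr Iff.rfl ⟨?_, ?_⟩
    · rintro ⟨⟨rfl, h1⟩, h2⟩
      refine ⟨rfl, h1, ?_⟩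
      rw [← h2]
      congr 1
      simp only [rowPos]
      omega
    · rintro ⟨rfl, h1, h2⟩
      refine ⟨⟨rfl, h1⟩, ?_⟩
      rw [← h2]
      congr 1
      simp only [rowPos]
      omega
  split_ifs with h
  · have : (addCorners k i γ).rowLen r = γ.rowLen r + 1 := by
      apply eq_of_forall_lt_iff
      intro j
      rw [hmem]
      simp only [h]
      simp only [not_false_eq_true, and_self, and_true]
      omega
    simp only [rowPos, this]
    push_cast
    ring
  · have : (addCorners k i γ).rowLen r = γ.rowLen r := by
      apply eq_of_forall_lt_iff
      intro j
      rw [hmem]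
      simp only [h]
      simp
    simp only [rowPos, this]

theorem rowPos_removeCorners (i : ZMod (k + 1)) (r : ℕ) [Decidable (rowPos γ r - 1 ∉ maya γ ∧
    (rowPos γ r : ZMod (k + 1)) = i)] :
    rowPos (removeCorners k i γ) r =
      if rowPos γ r - 1 ∉ maya γ ∧ (rowPos γ r : ZMod (k + 1)) = i
      then rowPos γ r - 1 else rowPos γ r := by
  have hmem : ∀ j, j < (removeCorners k i γ).rowLen r ↔ j < γ.rowLen r ∧ ¬ (j + 1 = γ.rowLen r ∧
      (rowPos γ r - 1 ∉ maya γ ∧ (rowPos γ r : ZMod (k + 1)) = i)) := by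
    intro j
    rw [← YoungDiagram.mem_iff_lt_rowLen, mem_removeCorners, YoungDiagram.mem_iff_lt_rowLen,
      isRemovable_iff, residue_eq]
    refine and_congr Iff.rfl (not_congr ⟨?_, ?_⟩)
    · rintro ⟨⟨h0, h1⟩, h2⟩
      refine ⟨h0, h1, ?_⟩
      rw [← h2]
      congr 1
      simp only [rowPos]
      omega
    · rintro ⟨h0, h1, h2⟩
      refine ⟨⟨h0, h1⟩, ?_⟩
      rw [← h2]
      congr 1
      simp only [rowPos]
      omega
  split_ifs with h
  · have h1 := rowPos_sub_one_notMem_iff.1 h.1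
    have : (removeCorners k i γ).rowLen r = γ.rowLen r - 1 := by
      apply eq_of_forall_lt_iff
      intro j
      rw [hmem]
      simp only [h]
      simp only [not_false_eq_true, and_self, and_true]
      omega
    simp only [rowPos, this]
    omega
  · have : (removeCorners k i γ).rowLen r = γ.rowLen r := by
      apply eq_of_forall_lt_iff
      intro j
      rw [hmem]
      simp only [h]
      simp
    simp only [rowPos, this]

theorem raise_add_period {h : ℤ → ℤ} (hh : ∀ a, h (a + (k + 1)) = h a - 1) (i : ZMod (k + 1))
    (a : ℤ) : raise k i h (a + (k + 1)) = raise k i h a - 1 := by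
  simp only [raise, intCast_add_period, hh, show a + ((k : ℤ) + 1) - 1 = a - 1 + (k + 1) by ring,
    show a + ((k : ℤ) + 1) + 1 = a + 1 + (k + 1) by ring]
  split_ifs <;> omega

theorem lower_add_period {h : ℤ → ℤ} (hh : ∀ a, h (a + (k + 1)) = h a - 1) (i : ZMod (k + 1))
    (a : ℤ) : lower k i h (a + (k + 1)) = lower k i h a - 1 := by
  simp only [lower, intCast_add_period, hh, show a + ((k : ℤ) + 1) - 1 = a - 1 + (k + 1) by ring,
    show a + ((k : ℤ) + 1) + 1 = a + 1 + (k + 1) by ring]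
  split_ifs <;> omega

/-- An added corner pushes a vertical step from `c - 1` to the free position `c`, with `c` of
residue `i`. Done for all such `c`, this leaves the larger of the two levels on runner `i` and the
smaller on runner `i - 1`. For `0 < k` these runners are distinct. -/
theorem mem_maya_addCorners (hk : 0 < k) (hγ : IsCore (k + 1) γ) (i : ZMod (k + 1)) (a : ℤ) :
    a ∈ maya (addCorners k i γ) ↔ 0 < raise k i (lev k γ) a := by
  classical
  have h0 : a ∈ maya (addCorners k i γ) ↔
      (a ∈ maya γ ∧ ¬ (a + 1 ∉ maya γ ∧ (a : ZMod (k + 1)) + 1 = i)) ∨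
      (a - 1 ∈ maya γ ∧ a ∉ maya γ ∧ (a : ZMod (k + 1)) = i) := by
    constructor
    · rintro ⟨r, rfl⟩
      rw [rowPos_addCorners]
      split_ifs with h
      · right
        rw [add_sub_cancel_right]
        exact ⟨⟨r, rfl⟩, h⟩
      · left
        push_cast at h
        exact ⟨⟨r, rfl⟩, h⟩
    · rintro (⟨⟨r, rfl⟩, h⟩ | ⟨⟨r, hr⟩, h⟩)
      · refine ⟨r, ?_⟩
        rw [rowPos_addCorners, if_neg]
        push_cast
        exact h
      · refine ⟨r, ?_⟩
        have : rowPos γ r + 1 = a := by omega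
        rw [rowPos_addCorners, this, if_pos h]
  rw [h0, raise]
  simp only [mem_maya_iff hγ]
  split_ifs with h1 h2
  · simp only [h1, and_true, lt_max_iff]
    simp only [zmod_add_one_ne hk i, and_false, not_false_eq_true, and_true]
    tauto
  · simp only [h1, h2, and_true, and_false, lt_min_iff]
    tauto
  · simp only [h1, h2]
    simp

theorem mem_maya_removeCorners (hk : 0 < k) (hγ : IsCore (k + 1) γ) (i : ZMod (k + 1)) (a : ℤ) :
    a ∈ maya (removeCorners k i γ) ↔ 0 < lower k i (lev k γ) a := by
  classical
  have h0 : a ∈ maya (removeCorners k i γ) ↔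
      (a ∈ maya γ ∧ ¬ (a - 1 ∉ maya γ ∧ (a : ZMod (k + 1)) = i)) ∨
      (a + 1 ∈ maya γ ∧ a ∉ maya γ ∧ (a : ZMod (k + 1)) + 1 = i) := by
    constructor
    · rintro ⟨r, rfl⟩
      rw [rowPos_removeCorners]
      split_ifs with h
      · right
        rw [sub_add_cancel]
        push_cast
        rw [sub_add_cancel]
        exact ⟨⟨r, rfl⟩, h⟩
      · left
        exact ⟨⟨r, rfl⟩, h⟩
    · rintro (⟨⟨r, rfl⟩, h⟩ | ⟨⟨r, hr⟩, h⟩)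
      · refine ⟨r, ?_⟩
        rw [rowPos_removeCorners, if_neg h]
      · refine ⟨r, ?_⟩
        rw [rowPos_removeCorners, hr, add_sub_cancel_right, if_pos]
        push_cast
        exact h
  rw [h0, lower]
  simp only [mem_maya_iff hγ]
  split_ifs with h1 h2
  · simp only [h1, and_true, lt_min_iff]
    simp only [zmod_add_one_ne hk i, and_false, or_false]
    tauto
  · simp only [h1, h2, and_true, and_false, lt_max_iff]
    tauto
  · simp only [h1, h2]
    simp

theorem isCore_addCorners (hk : 0 < k) (hγ : IsCore (k + 1) γ) (i : ZMod (k + 1)) :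
    IsCore (k + 1) (addCorners k i γ) :=
  isCore_of (raise_add_period (lev_add hγ) i) (mem_maya_addCorners hk hγ i)

theorem isCore_removeCorners (hk : 0 < k) (hγ : IsCore (k + 1) γ) (i : ZMod (k + 1)) :
    IsCore (k + 1) (removeCorners k i γ) :=
  isCore_of (lower_add_period (lev_add hγ) i) (mem_maya_removeCorners hk hγ i)

theorem lev_addCorners (hk : 0 < k) (hγ : IsCore (k + 1) γ) (i : ZMod (k + 1)) :
    lev k (addCorners k i γ) = raise k i (lev k γ) :=
  lev_eq_of (isCore_addCorners hk hγ i) (raise_add_period (lev_add hγ) i)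
    (mem_maya_addCorners hk hγ i)

theorem lev_removeCorners (hk : 0 < k) (hγ : IsCore (k + 1) γ) (i : ZMod (k + 1)) :
    lev k (removeCorners k i γ) = lower k i (lev k γ) :=
  lev_eq_of (isCore_removeCorners hk hγ i) (lower_add_period (lev_add hγ) i)
    (mem_maya_removeCorners hk hγ i)

/-! ### Jumps, and how corner moves change them. -/

/-- The jump of the levels of `γ` at the residue `i`. -/
noncomputable def jump (k : ℕ) (γ : YoungDiagram) (i : ZMod (k + 1)) : ℤ :=
  lev k γ i.val - lev k γ (i.val - 1)

theorem jump_eq (hγ : IsCore (k + 1) γ) {i : ZMod (k + 1)} {c : ℤ} (hc : (c : ZMod (k + 1)) = i) :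
    jump k γ i = lev k γ c - lev k γ (c - 1) := by
  obtain ⟨m, rfl⟩ := exists_mul_of_intCast_eq (k := k) (a := (i.val : ℤ)) (b := c) (by
    rw [hc]; simp)
  rw [show (i.val : ℤ) + m * (k + 1) - 1 = (i.val - 1) + m * (k + 1) by ring, lev_add_mul hγ,
    lev_add_mul hγ, jump]
  ring

theorem exists_intCast (i : ZMod (k + 1)) : ∃ c : ℤ, (c : ZMod (k + 1)) = i :=
  ⟨i.val, by simp⟩

/-- The content of the lowest removable corner of residue `i`. -/
noncomputable def key (k : ℕ) (γ : YoungDiagram) (i : ZMod (k + 1)) : ℤ :=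
  i.val + (lev k γ i.val - 1) * (k + 1)

theorem intCast_key (i : ZMod (k + 1)) : (key k γ i : ZMod (k + 1)) = i := by
  have := ZMod.natCast_self (k + 1)
  push_cast at this
  simp [key, this]

theorem lev_key (hγ : IsCore (k + 1) γ) (i : ZMod (k + 1)) : lev k γ (key k γ i) = 1 := by
  rw [key, lev_add_mul hγ]
  ring

theorem key_eq (hγ : IsCore (k + 1) γ) {i : ZMod (k + 1)} {c : ℤ} (hc : (c : ZMod (k + 1)) = i) :
    key k γ i = c + (lev k γ c - 1) * (k + 1) := by
  obtain ⟨m, rfl⟩ := exists_mul_of_intCast_eq (k := k) (a := (i.val : ℤ)) (b := c) (by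
    rw [hc]; simp)
  rw [lev_add_mul hγ, key]
  ring

/-- A removable corner of content `c` is a vertical step at `c` after a horizontal one at `c - 1`,
which forces a positive jump. Conversely `key` is the last vertical step of its runner; a positive
jump leaves the position just before it free. -/
theorem exists_isRemovable_iff (hγ : IsCore (k + 1) γ) (i : ZMod (k + 1)) :
    (∃ c, IsRemovable γ c ∧ residue k c = i) ↔ 0 < jump k γ i := by
  constructor
  · rintro ⟨⟨r, j⟩, h, hr⟩
    have := h.mem_maya
    rw [mem_maya_iff hγ, mem_maya_iff hγ] at this
    rw [residue_eq] at hr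
    rw [jump_eq hγ hr]
    simp only at this
    omega
  · intro h
    have h1 := lev_key hγ i
    rw [jump_eq hγ (intCast_key (γ := γ) i)] at h
    obtain ⟨⟨r, j⟩, h2, h3⟩ := exists_isRemovable_of_mem_maya (γ := γ) (x := key k γ i)
      ((mem_maya_iff hγ _).2 (by omega)) (fun h' => by
        have := (mem_maya_iff hγ _).1 h'
        omega)
    refine ⟨_, h2, ?_⟩
    rw [residue_eq, h3, intCast_key]

theorem IsAddable.jump_neg (hγ : IsCore (k + 1) γ) {c : ℕ × ℕ} (h : IsAddable γ c) :
    jump k γ (residue k c) < 0 := by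
  obtain ⟨r, j⟩ := c
  have := h.mem_maya
  rw [mem_maya_iff hγ, mem_maya_iff hγ] at this
  rw [residue_eq, jump_eq hγ rfl]
  simp only at this
  omega

theorem IsRemovable.jump_pos (hγ : IsCore (k + 1) γ) {c : ℕ × ℕ} (h : IsRemovable γ c) :
    0 < jump k γ (residue k c) :=
  (exists_isRemovable_iff hγ _).1 ⟨c, h, rfl⟩

theorem addCorners_eq_self (hγ : IsCore (k + 1) γ) {i : ZMod (k + 1)} (h : 0 ≤ jump k γ i) :
    addCorners k i γ = γ := by
  ext c
  rw [YoungDiagram.mem_cells, YoungDiagram.mem_cells, mem_addCorners]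
  refine ⟨?_, Or.inl⟩
  rintro (h' | ⟨h', rfl⟩)
  · exact h'
  · exact absurd (h'.jump_neg hγ) (not_lt.2 h)

theorem jump_addCorners_self (hk : 0 < k) (hγ : IsCore (k + 1) γ) (i : ZMod (k + 1)) :
    jump k (addCorners k i γ) i = |jump k γ i| := by
  obtain ⟨c, hc⟩ := exists_intCast i
  rw [jump_eq (isCore_addCorners hk hγ i) hc, jump_eq hγ hc, lev_addCorners hk hγ, raise, raise,
    if_pos hc, if_neg, if_pos, sub_add_cancel]
  · rcases le_total (lev k γ c) (lev k γ (c - 1)) with h | h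
    · rw [max_eq_right h, min_eq_right h, abs_of_nonpos (by omega)]
      ring
    · rw [max_eq_left h, min_eq_left h, abs_of_nonneg (by omega)]
  · push_cast
    rw [hc]
    ring
  · push_cast
    rw [hc]
    intro h
    exact zmod_one_ne_zero hk (by linear_combination -h)

theorem jump_removeCorners_self (hk : 0 < k) (hγ : IsCore (k + 1) γ) (i : ZMod (k + 1)) :
    jump k (removeCorners k i γ) i = -|jump k γ i| := by
  obtain ⟨c, hc⟩ := exists_intCast i
  rw [jump_eq (isCore_removeCorners hk hγ i) hc, jump_eq hγ hc, lev_removeCorners hk hγ, lower, lower,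
    if_pos hc, if_neg, if_pos, sub_add_cancel]
  · rcases le_total (lev k γ c) (lev k γ (c - 1)) with h | h
    · rw [max_eq_left h, min_eq_left h, abs_of_nonpos (by omega)]
      ring
    · rw [max_eq_right h, min_eq_right h, abs_of_nonneg (by omega)]
      ring
  · push_cast
    rw [hc]
    ring
  · push_cast
    rw [hc]
    intro h
    exact zmod_one_ne_zero hk (by linear_combination -h)

/-- Removal swaps the levels of runners `j - 1` and `j`, which acts on jumps as a simple reflection
acts on root coordinates. For `k = 1` the residue `j` would neighbour `i` on both sides and the
formula would change. -/
theorem jump_removeCorners_of_adjacent (hk : 1 < k) (hγ : IsCore (k + 1) γ) {i j : ZMod (k + 1)}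
    (hij : i = j + 1 ∨ j = i + 1) (hj : 0 ≤ jump k γ j) :
    jump k (removeCorners k j γ) i = jump k γ i + jump k γ j := by
  have h1 := zmod_one_ne_zero (by omega : 0 < k)
  have h2 := zmod_two_ne_zero hk
  obtain ⟨c, hc⟩ := exists_intCast i
  have hcore := isCore_removeCorners (by omega) hγ j
  rw [jump_eq hcore hc, jump_eq hγ hc, lev_removeCorners (by omega) hγ]
  rcases hij with rfl | rfl
  · have hc' : ((c - 1 : ℤ) : ZMod (k + 1)) = j := by
      push_cast
      rw [hc]
      ring
    rw [jump_eq hγ hc'] at hj ⊢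
    rw [lower, lower, if_neg, if_neg, if_pos hc', min_eq_right (by omega)]
    · omega
    · rw [hc]
      intro h
      exact h2 (by linear_combination h)
    · rw [hc]
      intro h
      exact h1 (by linear_combination h)
  · have hc' : ((c + 1 : ℤ) : ZMod (k + 1)) = i + 1 := by
      push_cast
      rw [hc]
    rw [jump_eq hγ hc', add_sub_cancel_right] at hj ⊢
    rw [lower, lower, if_neg, if_pos (by rw [hc]), if_neg, if_neg, max_eq_right (by omega)]
    · omega
    · push_cast
      rw [hc]
      intro h
      exact h1 (by linear_combination -h)
    · push_cast
      rw [hc]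
      intro h
      exact h2 (by linear_combination -h)
    · rw [hc]
      intro h
      exact h1 (by linear_combination -h)

/-- Away from the residue `i` and its successor, adding corners of residue `i` does not change
the levels. -/
theorem raise_of_ne {h : ℤ → ℤ} {i : ZMod (k + 1)} {c : ℤ} (h1 : (c : ZMod (k + 1)) ≠ i)
    (h2 : (c : ZMod (k + 1)) + 1 ≠ i) : raise k i h c = h c := by
  rw [raise, if_neg h1, if_neg h2]

theorem lower_of_ne {h : ℤ → ℤ} {i : ZMod (k + 1)} {c : ℤ} (h1 : (c : ZMod (k + 1)) ≠ i)
    (h2 : (c : ZMod (k + 1)) + 1 ≠ i) : lower k i h c = h c := by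
  rw [lower, if_neg h1, if_neg h2]

theorem jump_removeCorners_of_ne (hk : 0 < k) (hγ : IsCore (k + 1) γ) {i j : ZMod (k + 1)}
    (h0 : i ≠ j) (h1 : i ≠ j + 1) (h2 : j ≠ i + 1) :
    jump k (removeCorners k j γ) i = jump k γ i := by
  obtain ⟨c, hc⟩ := exists_intCast i
  rw [jump_eq (isCore_removeCorners hk hγ j) hc, jump_eq hγ hc, lev_removeCorners hk hγ,
    lower_of_ne (by rwa [hc]) (by rw [hc]; exact h2.symm),
    lower_of_ne (by push_cast; rw [hc]; intro h; exact h1 (by linear_combination h))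
      (by push_cast; rw [hc]; simpa using h0)]

theorem jump_addCorners_of_ne (hk : 0 < k) (hγ : IsCore (k + 1) γ) {i j : ZMod (k + 1)}
    (h0 : i ≠ j) (h1 : i ≠ j + 1) (h2 : j ≠ i + 1) :
    jump k (addCorners k j γ) i = jump k γ i := by
  obtain ⟨c, hc⟩ := exists_intCast i
  rw [jump_eq (isCore_addCorners hk hγ j) hc, jump_eq hγ hc, lev_addCorners hk hγ,
    raise_of_ne (by rwa [hc]) (by rw [hc]; exact h2.symm),
    raise_of_ne (by push_cast; rw [hc]; intro h; exact h1 (by linear_combination h))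
      (by push_cast; rw [hc]; simpa using h0)]

theorem raise_lower {h : ℤ → ℤ} {i : ZMod (k + 1)} (hk : 0 < k)
    (hi : ∀ c : ℤ, (c : ZMod (k + 1)) = i → h (c - 1) ≤ h c) : raise k i (lower k i h) = h := by
  have h1 := zmod_one_ne_zero hk
  funext c
  by_cases hc : (c : ZMod (k + 1)) = i
  · have := hi c hc
    rw [raise, if_pos hc, lower, if_pos hc, lower, if_neg, if_pos, sub_add_cancel]
    · rw [min_eq_right this, max_eq_right this, max_eq_right this]
    · push_cast
      rw [hc]
      ring
    · push_cast
      rw [hc]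
      intro h
      exact h1 (by linear_combination -h)
  · by_cases hc' : (c : ZMod (k + 1)) + 1 = i
    · have := hi (c + 1) (by push_cast; exact hc')
      rw [add_sub_cancel_right] at this
      rw [raise, if_neg hc, if_pos hc', lower, if_neg hc, if_pos hc', lower, if_pos,
        add_sub_cancel_right]
      · rw [min_eq_right this, max_eq_right this, min_eq_right this]
      · push_cast
        exact hc'
    · rw [raise_of_ne hc hc', lower_of_ne hc hc']

theorem lower_raise {h : ℤ → ℤ} {i : ZMod (k + 1)} (hk : 0 < k)
    (hi : ∀ c : ℤ, (c : ZMod (k + 1)) = i → h c ≤ h (c - 1)) : lower k i (raise k i h) = h := by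
  have h1 := zmod_one_ne_zero hk
  funext c
  by_cases hc : (c : ZMod (k + 1)) = i
  · have := hi c hc
    rw [lower, if_pos hc, raise, if_pos hc, raise, if_neg, if_pos, sub_add_cancel]
    · rw [max_eq_right this, min_eq_right this, min_eq_right this]
    · push_cast
      rw [hc]
      ring
    · push_cast
      rw [hc]
      intro h
      exact h1 (by linear_combination -h)
  · by_cases hc' : (c : ZMod (k + 1)) + 1 = i
    · have := hi (c + 1) (by push_cast; exact hc')
      rw [add_sub_cancel_right] at this
      rw [lower, if_neg hc, if_pos hc', raise, if_neg hc, if_pos hc', raise, if_pos,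
        add_sub_cancel_right]
      · rw [max_eq_right this, min_eq_right this, max_eq_right this]
      · push_cast
        exact hc'
    · rw [lower_of_ne hc hc', raise_of_ne hc hc']

theorem addCorners_removeCorners (hk : 0 < k) (hγ : IsCore (k + 1) γ) {i : ZMod (k + 1)}
    (h : 0 ≤ jump k γ i) : addCorners k i (removeCorners k i γ) = γ := by
  have h1 := isCore_removeCorners hk hγ i
  refine lev_injective (isCore_addCorners hk h1 i) hγ ?_
  rw [lev_addCorners hk h1, lev_removeCorners hk hγ, raise_lower hk]
  intro c hc
  rw [jump_eq hγ hc] at h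
  omega

theorem removeCorners_addCorners (hk : 0 < k) (hγ : IsCore (k + 1) γ) {i : ZMod (k + 1)}
    (h : jump k γ i ≤ 0) : removeCorners k i (addCorners k i γ) = γ := by
  have h1 := isCore_addCorners hk hγ i
  refine lev_injective (isCore_removeCorners hk h1 i) hγ ?_
  rw [lev_removeCorners hk h1, lev_addCorners hk hγ, lower_raise hk]
  intro c hc
  rw [jump_eq hγ hc] at h
  omega

theorem card_removeCorners_lt (hγ : IsCore (k + 1) γ) {i : ZMod (k + 1)}
    (h : 0 < jump k γ i) : (removeCorners k i γ).card < γ.card := by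
  classical
  obtain ⟨c, hc, hr⟩ := (exists_isRemovable_iff hγ i).2 h
  refine Finset.card_lt_card (Finset.filter_ssubset.2 ⟨c, hc.1, ?_⟩)
  simp [hc, hr]

theorem exists_jump_pos (hγ : IsCore (k + 1) γ) (h : γ ≠ ⊥) : ∃ i, 0 < jump k γ i := by
  obtain ⟨c, hc⟩ : ∃ c, c ∈ γ := by
    by_contra h'
    push Not at h'
    refine h (eq_bot_iff.2 fun c hc => absurd hc (h' c))
  have h0 : (0, 0) ∈ γ := γ.up_left_mem (Nat.zero_le c.1) (Nat.zero_le c.2) hc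
  have h1 := YoungDiagram.mem_iff_lt_colLen.1 h0
  -- Row `r` is the topmost nonempty row, whose last cell is a removable corner.
  obtain ⟨r, hr⟩ : ∃ r, γ.colLen 0 = r + 1 := ⟨γ.colLen 0 - 1, by omega⟩
  have h2 : (r, 0) ∈ γ := YoungDiagram.mem_iff_lt_colLen.2 (by omega)
  have h3 := YoungDiagram.mem_iff_lt_rowLen.1 h2
  have h4 : (r + 1, 0) ∉ γ := by rw [YoungDiagram.mem_iff_lt_colLen]; omega
  rw [YoungDiagram.mem_iff_lt_rowLen] at h4
  have h5 : IsRemovable γ (r, γ.rowLen r - 1) := by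
    rw [isRemovable_iff, rowPos_sub_one_notMem_iff]
    omega
  exact ⟨_, h5.jump_pos hγ⟩

theorem isCore_bot (p : ℕ) : IsCore p ⊥ := fun c hc => absurd hc (YoungDiagram.notMem_bot c)

theorem rowLen_bot (r : ℕ) : (⊥ : YoungDiagram).rowLen r = 0 := by
  by_contra h
  exact YoungDiagram.notMem_bot (r, 0) (YoungDiagram.mem_iff_lt_rowLen.2 (Nat.pos_of_ne_zero h))

theorem lev_bot : lev k ⊥ = fun a => -(a / ((k : ℤ) + 1)) := by
  refine lev_eq_of (isCore_bot _) (fun a => ?_) (fun a => ?_)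
  · rw [Int.add_ediv_of_dvd_right dvd_rfl, Int.ediv_self (by omega)]
    ring
  · have : a ∈ maya ⊥ ↔ a < 0 := by
      simp only [maya, rowPos, rowLen_bot, Set.mem_range]
      constructor
      · rintro ⟨r, rfl⟩
        push_cast
        omega
      · intro h
        exact ⟨(-a - 1).toNat, by push_cast; omega⟩
    rw [this]
    rw [neg_pos]
    refine ⟨fun h => Int.ediv_neg_of_neg_of_pos h (by omega), fun h => ?_⟩
    by_contra h'
    exact absurd (Int.ediv_nonneg (not_lt.1 h') (by omega : (0 : ℤ) ≤ k + 1)) (not_le.2 h)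

/-- The only addable corner of the empty core has residue `0`. The second half is where the finite
parabolic subgroup enters: it starts the induction in `IsRep.simple_mul_of_jump_eq_zero`. -/
theorem jump_bot {i : ZMod (k + 1)} : jump k ⊥ i ≤ 0 ∧ (jump k ⊥ i = 0 → i ≠ 0) := by
  constructor
  · by_contra h
    obtain ⟨c, hc, -⟩ := (exists_isRemovable_iff (isCore_bot _) i).2 (not_le.1 h)
    exact YoungDiagram.notMem_bot c hc.1
  · rintro h rfl
    rw [jump_eq (isCore_bot _) (c := 0) (by simp), lev_bot] at h
    simp only [zero_sub, Int.zero_ediv] at h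
    rw [Int.ediv_eq_neg_one_of_neg_of_le (by norm_num) (by omega)] at h
    norm_num at h

/-- For `k = 1` two positions make a full period, so the two jumps cannot both be positive, nor one
zero and the other positive. This is why the braid relation, absent for `k = 1`, is never needed
there. -/
theorem jump_add_jump_of_eq_one (hk : k = 1) (hγ : IsCore (k + 1) γ) {i j : ZMod (k + 1)}
    (hij : i = j + 1 ∨ j = i + 1) : jump k γ i + jump k γ j = -1 := by
  subst hk
  wlog h : i = j + 1 generalizing i j
  · rw [add_comm]
    exact this hij.symm (hij.resolve_left h)
  obtain ⟨c, hc⟩ := exists_intCast i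
  have hc' : ((c - 1 : ℤ) : ZMod (1 + 1)) = j := by
    push_cast
    rw [hc, h]
    ring
  rw [jump_eq hγ hc, jump_eq hγ hc']
  have := lev_add hγ (c - 1 - 1)
  push_cast at this
  rw [show c - 1 - 1 + 2 = c by ring] at this
  omega

end

/-! ### The permutation representation -/

/-- The affine transposition that exchanges `c - 1` and `c` for all `c` of residue `i`. -/
def refl (k : ℕ) (i : ZMod (k + 1)) (x : ℤ) : ℤ :=
  if (x : ZMod (k + 1)) = i then x - 1 else if (x : ZMod (k + 1)) + 1 = i then x + 1 else x

section
variable {k : ℕ}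

theorem refl_of_eq {i : ZMod (k + 1)} {x : ℤ} (h : (x : ZMod (k + 1)) = i) :
    refl k i x = x - 1 := if_pos h

theorem refl_of_succ (hk : 0 < k) {i : ZMod (k + 1)} {x : ℤ} (h : (x : ZMod (k + 1)) + 1 = i) :
    refl k i x = x + 1 := by
  rw [refl, if_neg, if_pos h]
  rw [← h]
  exact (zmod_add_one_ne hk _).symm

theorem refl_of_ne {i : ZMod (k + 1)} {x : ℤ} (h : (x : ZMod (k + 1)) ≠ i)
    (h' : (x : ZMod (k + 1)) + 1 ≠ i) : refl k i x = x := by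
  rw [refl, if_neg h, if_neg h']

theorem refl_refl (hk : 0 < k) (i : ZMod (k + 1)) (x : ℤ) : refl k i (refl k i x) = x := by
  by_cases h : (x : ZMod (k + 1)) = i
  · rw [refl_of_eq h, refl_of_succ hk (by push_cast; rw [h]; ring), sub_add_cancel]
  · by_cases h' : (x : ZMod (k + 1)) + 1 = i
    · rw [refl_of_succ hk h', refl_of_eq (by push_cast; exact h'), add_sub_cancel_right]
    · rw [refl_of_ne h h', refl_of_ne h h']

theorem refl_comm (hk : 0 < k) {i j : ZMod (k + 1)} (h0 : i ≠ j) (h1 : i ≠ j + 1)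
    (h2 : j ≠ i + 1) (x : ℤ) : refl k i (refl k j x) = refl k j (refl k i x) := by
  have key : ∀ {i j : ZMod (k + 1)}, i ≠ j → i ≠ j + 1 → j ≠ i + 1 → ∀ x : ℤ,
      ((x : ZMod (k + 1)) = i ∨ (x : ZMod (k + 1)) + 1 = i) →
      refl k i (refl k j x) = refl k j (refl k i x) := by
    rintro i j h0 h1 h2 x (h | h)
    · rw [refl_of_ne (i := j) (x := x) (by rwa [h]) (by rw [h]; exact h2.symm), refl_of_eq h,
        refl_of_ne]
      · push_cast
        rw [h]
        intro h'
        exact h1 (by linear_combination h')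
      · push_cast
        rw [h]
        simpa using h0
    · subst h
      rw [refl_of_ne (i := j) (x := x) (fun h => h1 (by rw [h])) h0, refl_of_succ hk rfl,
        refl_of_ne]
      · push_cast
        exact h0
      · push_cast
        exact h2.symm
  by_cases h : (x : ZMod (k + 1)) = i ∨ (x : ZMod (k + 1)) + 1 = i
  · exact key h0 h1 h2 x h
  · by_cases h' : (x : ZMod (k + 1)) = j ∨ (x : ZMod (k + 1)) + 1 = j
    · exact (key h0.symm h2 h1 x h').symm
    · push Not at h h'
      rw [refl_of_ne h.1 h.2, refl_of_ne h'.1 h'.2, refl_of_ne h.1 h.2]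

theorem refl_braid (hk : 1 < k) (j : ZMod (k + 1)) (x : ℤ) :
    refl k (j + 1) (refl k j (refl k (j + 1) x)) = refl k j (refl k (j + 1) (refl k j x)) := by
  have hk0 : 0 < k := by omega
  have h1 := zmod_one_ne_zero hk0
  have h2 := zmod_two_ne_zero hk
  by_cases ha : (x : ZMod (k + 1)) = j + 1
  · rw [refl_of_eq ha, refl_of_eq (i := j) (by push_cast; rw [ha]; ring),
      refl_of_ne (i := j + 1), refl_of_ne (i := j) (x := x), refl_of_eq ha,
      refl_of_eq (by push_cast; rw [ha]; ring)]
    · rw [ha]; intro h; exact h1 (by linear_combination h)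
    · rw [ha]; intro h; exact h2 (by linear_combination h)
    · push_cast; rw [ha]; intro h; exact h2 (by linear_combination -h)
    · push_cast; rw [ha]; intro h; exact h1 (by linear_combination -h)
  by_cases hb : (x : ZMod (k + 1)) = j
  · rw [refl_of_succ hk0 (i := j + 1) (x := x) (by rw [hb]), refl_of_ne (i := j),
      refl_of_eq (i := j + 1), refl_of_eq hb, refl_of_ne (i := j + 1),
      refl_of_succ hk0 (i := j), add_sub_cancel_right, sub_add_cancel]
    · push_cast; rw [hb]; ring
    · push_cast; rw [hb]; intro h; exact h2 (by linear_combination -h)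
    · push_cast; rw [hb]; intro h; exact h1 (by linear_combination -h)
    · push_cast; rw [hb]
    · push_cast; rw [hb]; intro h; exact h1 (by linear_combination h)
    · push_cast; rw [hb]; intro h; exact h2 (by linear_combination h)
  by_cases hc : (x : ZMod (k + 1)) + 1 = j
  · rw [refl_of_ne ha, refl_of_succ hk0 hc, refl_of_succ hk0 (i := j + 1), refl_of_ne (i := j)]
    · push_cast; rw [hc]; intro h; exact h1 (by linear_combination h)
    · push_cast; rw [hc]; intro h; exact h2 (by linear_combination h)
    · push_cast; rw [hc]
    · intro h; exact hb (by linear_combination h)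
  · have hd : (x : ZMod (k + 1)) + 1 ≠ j + 1 := by
      intro h; exact hb (by linear_combination h)
    rw [refl_of_ne ha hd, refl_of_ne hb hc, refl_of_ne ha hd, refl_of_ne hb hc]

/-! ### Coxeter relations and the lift to permutations of the integers. -/

theorem affineMatrix_apply (i j : ZMod (k + 1)) : affineMatrix k i j =
    if i = j then 1 else if j = i + 1 ∨ i = j + 1 then (if k = 1 then 0 else 3) else 2 := rfl

theorem simple_mul_comm {i j : ZMod (k + 1)} (h0 : i ≠ j) (h1 : i ≠ j + 1) (h2 : j ≠ i + 1) :
    (cox k).simple i * (cox k).simple j = (cox k).simple j * (cox k).simple i := by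
  have h := (cox k).simple_mul_simple_pow i j
  rw [affineMatrix_apply, if_neg h0, if_neg (by tauto), pow_two] at h
  have := eq_inv_of_mul_eq_one_left h
  rwa [mul_inv_rev, (cox k).inv_simple, (cox k).inv_simple] at this

theorem simple_braid (hk : 1 < k) {i j : ZMod (k + 1)} (h : i = j + 1 ∨ j = i + 1) :
    (cox k).simple i * ((cox k).simple j * (cox k).simple i) =
      (cox k).simple j * ((cox k).simple i * (cox k).simple j) := by
  have h0 : i ≠ j := by
    rcases h with rfl | rfl
    · exact zmod_add_one_ne (by omega) j
    · exact (zmod_add_one_ne (by omega) i).symm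
  have h3 := (cox k).simple_mul_simple_pow i j
  rw [affineMatrix_apply, if_neg h0, if_pos (by tauto), if_neg (by omega), pow_succ, pow_two] at h3
  have : ((cox k).simple i * ((cox k).simple j * (cox k).simple i)) *
      ((cox k).simple j * ((cox k).simple i * (cox k).simple j)) = 1 := by
    rw [← h3]
    group
  have := eq_inv_of_mul_eq_one_left this
  rw [this]
  simp only [mul_inv_rev, (cox k).inv_simple, mul_assoc]

/-- The affine transposition `refl` as a permutation. -/
def reflPerm (hk : 0 < k) (i : ZMod (k + 1)) : Equiv.Perm ℤ :=
  Function.Involutive.toPerm (refl k i) (refl_refl hk i)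

theorem reflPerm_apply (hk : 0 < k) (i : ZMod (k + 1)) (x : ℤ) : reflPerm hk i x = refl k i x := rfl

theorem isLiftable_reflPerm (hk : 0 < k) : (affineMatrix k).IsLiftable (reflPerm hk) := by
  have hsq : ∀ i, reflPerm hk i * reflPerm hk i = 1 := fun i =>
    Equiv.ext fun x => refl_refl hk i x
  have hbraid : 1 < k → ∀ i j : ZMod (k + 1), j = i + 1 ∨ i = j + 1 →
      reflPerm hk i * reflPerm hk j * reflPerm hk i =
        reflPerm hk j * reflPerm hk i * reflPerm hk j := by
    rintro hk1 i j (rfl | rfl)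
    · exact Equiv.ext fun x => (refl_braid hk1 i x).symm
    · exact Equiv.ext fun x => refl_braid hk1 j x
  intro i j
  rw [affineMatrix_apply]
  split_ifs with h0 h1 h2
  · rw [h0, pow_one, hsq]
  · rw [pow_zero]
  · have hb := hbraid (by omega) i j h1
    calc (reflPerm hk i * reflPerm hk j) ^ 3
        = (reflPerm hk i * reflPerm hk j * reflPerm hk i) *
            (reflPerm hk j * reflPerm hk i * reflPerm hk j) := by
          simp only [pow_succ, pow_zero, one_mul, mul_assoc]
      _ = (reflPerm hk i * reflPerm hk j * reflPerm hk i) *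
            (reflPerm hk i * reflPerm hk j * reflPerm hk i) := by rw [hb]
      _ = reflPerm hk i * (reflPerm hk j * ((reflPerm hk i * reflPerm hk i) * reflPerm hk j)) *
            reflPerm hk i := by
          simp only [mul_assoc]
      _ = 1 := by rw [hsq, one_mul, hsq, mul_one, hsq]
  · have hc : reflPerm hk i * reflPerm hk j = reflPerm hk j * reflPerm hk i :=
      Equiv.ext fun x => refl_comm hk h0 (fun h => h1 (Or.inr h)) (fun h => h1 (Or.inl h)) x
    calc (reflPerm hk i * reflPerm hk j) ^ 2
        = (reflPerm hk i * reflPerm hk j) * (reflPerm hk j * reflPerm hk i) := by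
          rw [pow_two]; nth_rw 2 [hc]
      _ = reflPerm hk i * ((reflPerm hk j * reflPerm hk j) * reflPerm hk i) := by
          simp only [mul_assoc]
      _ = 1 := by rw [hsq, one_mul, hsq]

/-- The action of the affine symmetric group on the integers. -/
noncomputable def permRep (hk : 0 < k) : AffinePerm k →* Equiv.Perm ℤ :=
  (cox k).lift ⟨reflPerm hk, isLiftable_reflPerm hk⟩

theorem permRep_simple (hk : 0 < k) (i : ZMod (k + 1)) (x : ℤ) :
    permRep hk ((cox k).simple i) x = refl k i x := by
  rw [permRep, (cox k).lift_apply_simple (isLiftable_reflPerm hk) i, reflPerm_apply]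

theorem permRep_mul (hk : 0 < k) (v w : AffinePerm k) (x : ℤ) :
    permRep hk (v * w) x = permRep hk v (permRep hk w x) := by
  rw [map_mul]
  rfl

theorem permRep_simple_mul (hk : 0 < k) (i : ZMod (k + 1)) (w : AffinePerm k) (x : ℤ) :
    permRep hk ((cox k).simple i * w) x = refl k i (permRep hk w x) := by
  rw [permRep_mul, permRep_simple]

/-- When the jump is nonnegative, sorting downwards is a plain swap, so corner removal becomes part
of a genuine group action on level functions. -/
theorem lower_eq_comp (hk : 0 < k) {γ : YoungDiagram} (hγ : IsCore (k + 1) γ) {i : ZMod (k + 1)}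
    (h : 0 ≤ jump k γ i) (x : ℤ) : lower k i (lev k γ) x = lev k γ (refl k i x) := by
  by_cases hx : (x : ZMod (k + 1)) = i
  · rw [jump_eq hγ hx] at h
    rw [lower, if_pos hx, refl_of_eq hx, min_eq_right (by omega)]
  · by_cases hx' : (x : ZMod (k + 1)) + 1 = i
    · rw [jump_eq hγ (c := x + 1) (by push_cast; exact hx'), add_sub_cancel_right] at h
      rw [lower, if_neg hx, if_pos hx', refl_of_succ hk hx', max_eq_right (by omega)]
    · rw [lower_of_ne hx hx', refl_of_ne hx hx']

/-! ### The affine Grassmannian element of a core -/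

/-- `w` is obtained from the empty core by adding corners up to `γ`, in `m` steps. -/
inductive IsRep (k : ℕ) : YoungDiagram → AffinePerm k → ℕ → Prop
  | bot : IsRep k ⊥ 1 0
  | step (i : ZMod (k + 1)) (γ : YoungDiagram) (w : AffinePerm k) (m : ℕ) :
      0 < jump k γ i → IsRep k (removeCorners k i γ) w m →
      IsRep k γ ((cox k).simple i * w) (m + 1)

theorem exists_isRep (hk : 0 < k) (γ : YoungDiagram) (hγ : IsCore (k + 1) γ) :
    ∃ w m, IsRep k γ w m := by
  induction hc : γ.card using Nat.strong_induction_on generalizing γ with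
  | _ c ih =>
    by_cases h : γ = ⊥
    · subst h
      exact ⟨1, 0, .bot⟩
    · obtain ⟨i, hi⟩ := exists_jump_pos hγ h
      obtain ⟨w, m, hw⟩ := ih _ (hc ▸ card_removeCorners_lt hγ hi) _
        (isCore_removeCorners hk hγ i) rfl
      exact ⟨_, _, .step i γ w m hi hw⟩

theorem removeCorners_comm (hk : 0 < k) {γ : YoungDiagram} (hγ : IsCore (k + 1) γ)
    {i j : ZMod (k + 1)} (h0 : i ≠ j) (h1 : i ≠ j + 1) (h2 : j ≠ i + 1)
    (hi : 0 ≤ jump k γ i) (hj : 0 ≤ jump k γ j) :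
    removeCorners k i (removeCorners k j γ) = removeCorners k j (removeCorners k i γ) := by
  have ci := isCore_removeCorners hk hγ i
  have cj := isCore_removeCorners hk hγ j
  refine lev_injective (isCore_removeCorners hk cj i) (isCore_removeCorners hk ci j) ?_
  funext x
  rw [lev_removeCorners hk cj, lev_removeCorners hk ci, lower_eq_comp hk cj, lower_eq_comp hk ci,
    lev_removeCorners hk hγ, lev_removeCorners hk hγ, lower_eq_comp hk hγ hj,
    lower_eq_comp hk hγ hi, refl_comm hk h0.symm h2 h1]
  · rwa [jump_removeCorners_of_ne hk hγ h0.symm h2 h1]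
  · rwa [jump_removeCorners_of_ne hk hγ h0 h1 h2]

/-- The jumps met along one side are `jump i`, `jump i + jump j`, `jump j`, all nonnegative; hence
each removal is a composition with `refl`, and `refl_braid` applies. -/
theorem removeCorners_braid (hk : 1 < k) {γ : YoungDiagram} (hγ : IsCore (k + 1) γ)
    {i j : ZMod (k + 1)} (hij : i = j + 1 ∨ j = i + 1)
    (hi : 0 ≤ jump k γ i) (hj : 0 ≤ jump k γ j) :
    removeCorners k i (removeCorners k j (removeCorners k i γ)) =
      removeCorners k j (removeCorners k i (removeCorners k j γ)) := by
  have hk0 : 0 < k := by omega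
  have step : ∀ {i j : ZMod (k + 1)}, i = j + 1 ∨ j = i + 1 → 0 ≤ jump k γ i → 0 ≤ jump k γ j →
      ∀ x, lev k (removeCorners k i (removeCorners k j (removeCorners k i γ))) x =
        lev k γ (refl k i (refl k j (refl k i x))) := by
    intro i j hij hi hj x
    have ci := isCore_removeCorners hk0 hγ i
    have cj := isCore_removeCorners hk0 ci j
    have hj' : jump k (removeCorners k i γ) j = jump k γ i + jump k γ j := by
      rw [jump_removeCorners_of_adjacent hk hγ hij.symm hi, add_comm]
    have hi' : jump k (removeCorners k j (removeCorners k i γ)) i = jump k γ j := by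
      rw [jump_removeCorners_of_adjacent hk ci hij (by omega), hj', jump_removeCorners_self hk0 hγ,
        abs_of_nonneg hi]
      ring
    rw [lev_removeCorners hk0 cj, lower_eq_comp hk0 cj (by omega), lev_removeCorners hk0 ci,
      lower_eq_comp hk0 ci (by omega), lev_removeCorners hk0 hγ, lower_eq_comp hk0 hγ hi]
  refine lev_injective (isCore_removeCorners hk0 (isCore_removeCorners hk0
    (isCore_removeCorners hk0 hγ i) j) i) (isCore_removeCorners hk0 (isCore_removeCorners hk0
    (isCore_removeCorners hk0 hγ j) i) j) ?_
  funext x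
  rw [step hij hi hj, step hij.symm hj hi]
  rcases hij with rfl | rfl
  · rw [refl_braid hk]
  · rw [refl_braid hk]

theorem IsRep.bot_cases {w : AffinePerm k} {m : ℕ} (h : IsRep k ⊥ w m) : w = 1 ∧ m = 0 := by
  cases h with
  | bot => exact ⟨rfl, rfl⟩
  | step i _ w m hi _ => exact absurd hi (not_lt.2 jump_bot.1)

/-- A diamond argument by induction on size. Two different last residues are both removable, so
removal continues along both sides of a commutation square or a braid hexagon down to a common core.
The induction hypothesis identifies each given element with the word along its side. -/
theorem IsRep.unique (hk : 0 < k) {γ : YoungDiagram} (hγ : IsCore (k + 1) γ) {w w' : AffinePerm k}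
    {m m' : ℕ} (h : IsRep k γ w m) (h' : IsRep k γ w' m') : w = w' ∧ m = m' := by
  induction hc : γ.card using Nat.strong_induction_on generalizing γ w w' m m' with
  | _ c ih =>
    subst hc
    cases h with
    | bot =>
      obtain ⟨rfl, rfl⟩ := h'.bot_cases
      exact ⟨rfl, rfl⟩
    | step i _ w1 m1 hi h1 =>
    cases h' with
    | bot => exact absurd hi (not_lt.2 jump_bot.1)
    | step j _ w2 m2 hj h2 =>
    have ci := isCore_removeCorners hk hγ i
    have cj := isCore_removeCorners hk hγ j
    have ki := card_removeCorners_lt hγ hi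
    have kj := card_removeCorners_lt hγ hj
    by_cases hij : i = j
    · subst hij
      obtain ⟨rfl, rfl⟩ := ih _ ki ci h1 h2 rfl
      exact ⟨rfl, rfl⟩
    by_cases hadj : i = j + 1 ∨ j = i + 1
    · have hk1 : 1 < k := by
        by_contra hk1
        have := jump_add_jump_of_eq_one (by omega) hγ hadj
        omega
      have ej : jump k (removeCorners k i γ) j = jump k γ i + jump k γ j := by
        rw [jump_removeCorners_of_adjacent hk1 hγ hadj.symm hi.le, add_comm]
      have ei : jump k (removeCorners k j γ) i = jump k γ i + jump k γ j :=
        jump_removeCorners_of_adjacent hk1 hγ hadj hj.le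
      have cji := isCore_removeCorners hk ci j
      have cij := isCore_removeCorners hk cj i
      have ei' : jump k (removeCorners k j (removeCorners k i γ)) i = jump k γ j := by
        rw [jump_removeCorners_of_adjacent hk1 ci hadj (by omega), ej,
          jump_removeCorners_self hk hγ, abs_of_pos hi]
        ring
      have ej' : jump k (removeCorners k i (removeCorners k j γ)) j = jump k γ i := by
        rw [jump_removeCorners_of_adjacent hk1 cj hadj.symm (by omega), ei,
          jump_removeCorners_self hk hγ, abs_of_pos hj]
        ring
      obtain ⟨w3, m3, h3⟩ := exists_isRep hk _ (isCore_removeCorners hk cji i)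
      have h3' := h3
      rw [removeCorners_braid hk1 hγ hadj hi.le hj.le] at h3'
      obtain ⟨rfl, rfl⟩ := ih _ ki ci h1
        (.step j _ _ _ (by omega) (.step i _ _ _ (by omega) h3)) rfl
      obtain ⟨rfl, rfl⟩ := ih _ kj cj h2
        (.step i _ _ _ (by omega) (.step j _ _ _ (by omega) h3')) rfl
      refine ⟨?_, rfl⟩
      have := congrArg (· * w3) (simple_braid hk1 hadj)
      simpa only [mul_assoc] using this
    · push Not at hadj
      obtain ⟨w3, m3, h3⟩ := exists_isRep hk _ (isCore_removeCorners hk cj i)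
      have h3' := h3
      rw [removeCorners_comm hk hγ hij hadj.1 hadj.2 hi.le hj.le] at h3'
      obtain ⟨rfl, rfl⟩ := ih _ ki ci h1
        (.step j _ _ _ (by rwa [jump_removeCorners_of_ne hk hγ (Ne.symm hij) hadj.2 hadj.1]) h3') rfl
      obtain ⟨rfl, rfl⟩ := ih _ kj cj h2
        (.step i _ _ _ (by rwa [jump_removeCorners_of_ne hk hγ hij hadj.1 hadj.2]) h3) rfl
      refine ⟨?_, rfl⟩
      rw [← mul_assoc, simple_mul_comm hij hadj.1 hadj.2, mul_assoc]

/-- Induction on the last residue `j`. If `i` and `j` commute, `s_i` moves past `s_j`. If they are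
adjacent, then `w = s_j s_i w3`, because removing the `j`-corners makes the jump at `i` positive.
The braid relation turns `s_i w` into `s_j s_i s_j w3`, and `j` has jump zero on the core of `w3`.
-/
theorem IsRep.simple_mul_of_jump_eq_zero (hk : 0 < k) {γ : YoungDiagram} (hγ : IsCore (k + 1) γ)
    {w : AffinePerm k} {m : ℕ} (h : IsRep k γ w m) {i : ZMod (k + 1)} (hi : jump k γ i = 0) :
    ∃ t ≠ 0, (cox k).simple i * w = w * (cox k).simple t := by
  induction hc : γ.card using Nat.strong_induction_on generalizing γ w m i with
  | _ c ih =>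
    subst hc
    cases h with
    | bot => exact ⟨i, jump_bot.2 hi, by simp⟩
    | step j _ w1 m1 hj h1 =>
    have cj := isCore_removeCorners hk hγ j
    have kj := card_removeCorners_lt hγ hj
    have hij : i ≠ j := by
      rintro rfl
      omega
    by_cases hadj : i = j + 1 ∨ j = i + 1
    · have hk1 : 1 < k := by
        by_contra hk1
        have := jump_add_jump_of_eq_one (by omega) hγ hadj
        omega
      have ei : jump k (removeCorners k j γ) i = jump k γ j := by
        rw [jump_removeCorners_of_adjacent hk1 hγ hadj hj.le, hi, zero_add]
      have cij := isCore_removeCorners hk cj i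
      have ej' : jump k (removeCorners k i (removeCorners k j γ)) j = 0 := by
        rw [jump_removeCorners_of_adjacent hk1 cj hadj.symm (by omega), ei,
          jump_removeCorners_self hk hγ, abs_of_pos hj]
        ring
      obtain ⟨w3, m3, h3⟩ := exists_isRep hk _ cij
      obtain ⟨rfl, -⟩ := h1.unique hk cj (.step i _ _ _ (by omega) h3)
      obtain ⟨t, ht, h4⟩ := ih _ ((card_removeCorners_lt cj (by omega)).trans kj) cij h3 ej' rfl
      refine ⟨t, ht, ?_⟩
      have := congrArg (· * w3) (simple_braid hk1 hadj)
      simp only [mul_assoc] at this ⊢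
      rw [this, h4]
    · push Not at hadj
      obtain ⟨t, ht, h4⟩ := ih _ kj cj h1
        (by rwa [jump_removeCorners_of_ne hk hγ hij hadj.1 hadj.2]) rfl
      refine ⟨t, ht, ?_⟩
      rw [← mul_assoc, simple_mul_comm hij hadj.1 hadj.2, mul_assoc, h4, mul_assoc]

theorem IsRep.addCorners (hk : 0 < k) {γ : YoungDiagram} (hγ : IsCore (k + 1) γ)
    {w : AffinePerm k} {m : ℕ} (h : IsRep k γ w m) {i : ZMod (k + 1)} (hi : jump k γ i < 0) :
    IsRep k (addCorners k i γ) ((cox k).simple i * w) (m + 1) := by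
  refine .step i _ _ _ ?_ ?_
  · rw [jump_addCorners_self hk hγ]
    exact abs_pos.2 hi.ne
  · rwa [removeCorners_addCorners hk hγ hi.le]

theorem IsRep.exists_of_jump_pos (hk : 0 < k) {γ : YoungDiagram} (hγ : IsCore (k + 1) γ)
    {w : AffinePerm k} {m : ℕ} (h : IsRep k γ w m) {i : ZMod (k + 1)} (hi : 0 < jump k γ i) :
    ∃ m', m = m' + 1 ∧ IsRep k (removeCorners k i γ) ((cox k).simple i * w) m' := by
  obtain ⟨w1, m1, h1⟩ := exists_isRep hk _ (isCore_removeCorners hk hγ i)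
  obtain ⟨rfl, rfl⟩ := h.unique hk hγ (.step i _ _ _ hi h1)
  refine ⟨m1, rfl, ?_⟩
  rwa [(cox k).simple_mul_simple_cancel_left]

theorem IsRep.length_le {γ : YoungDiagram} {w : AffinePerm k} {m : ℕ} (h : IsRep k γ w m) :
    (cox k).length w ≤ m := by
  induction h with
  | bot => simp
  | step i γ w m hi h ih =>
    have := (cox k).length_mul_le ((cox k).simple i) w
    rw [(cox k).length_simple] at this
    omega

/-- Parabolic factorization with control of length: a new letter adds corners, removes corners, or
passes through `w` to become a finite letter, according to the sign of the jump. -/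
theorem exists_isRep_wordProd (hk : 0 < k) (ω : List (ZMod (k + 1))) :
    ∃ γ w m x, IsCore (k + 1) γ ∧ IsRep k γ w m ∧ (∀ t ∈ x, t ≠ 0) ∧
      (cox k).wordProd ω = w * (cox k).wordProd x ∧ m + x.length ≤ ω.length := by
  induction ω with
  | nil => exact ⟨⊥, 1, 0, [], isCore_bot _, .bot, by simp, by simp, by simp⟩
  | cons i ω ih =>
    obtain ⟨γ, w, m, x, hγ, hw, hx, hp, hl⟩ := ih
    rw [(cox k).wordProd_cons, hp, ← mul_assoc, List.length_cons]
    rcases lt_trichotomy (jump k γ i) 0 with h | h | h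
    · exact ⟨_, _, _, x, isCore_addCorners hk hγ i, hw.addCorners hk hγ h, hx, rfl, by omega⟩
    · obtain ⟨t, ht, h1⟩ := hw.simple_mul_of_jump_eq_zero hk hγ h
      refine ⟨γ, w, m, t :: x, hγ, hw, by simpa [ht] using hx, ?_, by simp only [List.length_cons]; omega⟩
      rw [h1, (cox k).wordProd_cons, mul_assoc]
    · obtain ⟨m', rfl, h1⟩ := hw.exists_of_jump_pos hk hγ h
      exact ⟨_, _, _, x, isCore_removeCorners hk hγ i, h1, hx, rfl, by omega⟩

/-- Together with `lev_bot_permRep` this shows that the core depends only on the coset of `w` modulo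
the finite subgroup. -/
theorem IsRep.lev_eq (hk : 0 < k) {γ : YoungDiagram} (hγ : IsCore (k + 1) γ)
    {w : AffinePerm k} {m : ℕ} (h : IsRep k γ w m) (x : ℤ) :
    lev k γ x = lev k ⊥ (permRep hk w⁻¹ x) := by
  induction h generalizing x with
  | bot => simp
  | step i γ w m hi h ih =>
    have ci := isCore_removeCorners hk hγ i
    rw [mul_inv_rev, (cox k).inv_simple, permRep_mul, permRep_simple, ← ih ci,
      lev_removeCorners hk hγ, lower_eq_comp hk hγ hi.le, refl_refl hk]

/-- The levels of the empty core are constant on the blocks of `k + 1` consecutive integers that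
start at a multiple of `k + 1`; the `s_i` with `i ≠ 0` permute within these blocks. -/
theorem lev_bot_permRep (hk : 0 < k) {v : AffinePerm k}
    (hv : v ∈ Subgroup.closure ((cox k).simple '' {i | i ≠ 0})) (x : ℤ) :
    lev k ⊥ (permRep hk v x) = lev k ⊥ x := by
  have hs : ∀ i : ZMod (k + 1), i ≠ 0 → ∀ x, lev k ⊥ (refl k i x) = lev k ⊥ x := by
    intro i hi x
    have h : jump k ⊥ i = 0 := by
      have h1 := ZMod.val_lt i
      have h2 : i.val ≠ 0 := fun h => hi ((ZMod.val_eq_zero i).1 h)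
      rw [jump, lev_bot]
      simp only
      rw [Int.ediv_eq_zero_of_lt (by omega) (by omega), Int.ediv_eq_zero_of_lt (by omega) (by omega)]
      rfl
    rw [← lower_eq_comp hk (isCore_bot _) h.ge, ← lev_removeCorners hk (isCore_bot _)]
    congr 1
  induction hv using Subgroup.closure_induction generalizing x with
  | mem v hv =>
    obtain ⟨i, hi, rfl⟩ := hv
    rw [permRep_simple]
    exact hs i hi x
  | one => simp
  | mul v w _ _ ihv ihw => rw [permRep_mul, ihv, ihw]
  | inv v _ ih =>
    rw [← ih, ← permRep_mul, mul_inv_cancel]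
    simp

theorem wordProd_mem_closure {x : List (ZMod (k + 1))} (hx : ∀ t ∈ x, t ≠ 0) :
    (cox k).wordProd x ∈ Subgroup.closure ((cox k).simple '' {i | i ≠ 0}) := by
  induction x with
  | nil => simp
  | cons t x ih =>
    rw [(cox k).wordProd_cons]
    exact mul_mem (Subgroup.subset_closure ⟨t, hx t (by simp), rfl⟩)
      (ih fun s hs => hx s (by simp [hs]))

/-- Factoring a reduced word of `w * v` produces a core in the same coset, hence the same core, and
so the same number of steps `m`, which is at most the length of that word. -/
theorem IsRep.le_length_mul (hk : 0 < k) {γ : YoungDiagram} (hγ : IsCore (k + 1) γ)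
    {w : AffinePerm k} {m : ℕ} (h : IsRep k γ w m) {v : AffinePerm k}
    (hv : v ∈ Subgroup.closure ((cox k).simple '' {i | i ≠ 0})) :
    m ≤ (cox k).length (w * v) := by
  obtain ⟨ω, hω, hp⟩ := (cox k).exists_isReduced (w * v)
  obtain ⟨γ', w', m', x, hγ', hw', hx, hp', hl⟩ := exists_isRep_wordProd hk ω
  have hx' := wordProd_mem_closure hx
  have : γ = γ' := by
    refine lev_injective hγ hγ' (funext fun a => ?_)
    have h1 : w'⁻¹ = (cox k).wordProd x * (v⁻¹ * w⁻¹) := by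
      rw [← mul_inv_rev, hp, hp']
      group
    rw [h.lev_eq hk hγ, hw'.lev_eq hk hγ', h1, permRep_mul, permRep_mul, lev_bot_permRep hk hx',
      lev_bot_permRep hk (inv_mem hv)]
  subst this
  obtain ⟨-, rfl⟩ := h.unique hk hγ hw'
  rw [hp, hω.eq]
  omega

theorem IsRep.length_eq (hk : 0 < k) {γ : YoungDiagram} (hγ : IsCore (k + 1) γ)
    {w : AffinePerm k} {m : ℕ} (h : IsRep k γ w m) : (cox k).length w = m := by
  refine le_antisymm h.length_le ?_
  simpa using h.le_length_mul hk hγ (one_mem _)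

theorem IsRep.isGrassmannian (hk : 0 < k) {γ : YoungDiagram} (hγ : IsCore (k + 1) γ)
    {w : AffinePerm k} {m : ℕ} (h : IsRep k γ w m) : IsGrassmannian k w := by
  intro v hv
  rw [h.length_eq hk hγ]
  exact h.le_length_mul hk hγ hv

theorem IsGrassmannian.exists_isRep (hk : 0 < k) {w : AffinePerm k} (hw : IsGrassmannian k w) :
    ∃ γ m, IsCore (k + 1) γ ∧ IsRep k γ w m := by
  obtain ⟨ω, hω, rfl⟩ := (cox k).exists_isReduced w
  obtain ⟨γ, w', m, x, hγ, hw', hx, hp, hl⟩ := exists_isRep_wordProd hk ω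
  -- Minimality against the inverse of the finite factor bounds the length of `w` by `m`; the length
  -- control then leaves no room for `x`.
  have h1 := hw _ (inv_mem (wordProd_mem_closure hx))
  rw [hω.eq, hp, mul_inv_cancel_right, hw'.length_eq hk hγ] at h1
  have h2 : x = [] := List.eq_nil_of_length_eq_zero (by omega)
  subst h2
  refine ⟨γ, m, hγ, ?_⟩
  rw [hp]
  simpa using hw'

/-- Left descents of `w` are the residues of removable corners. At jump zero, `s_i w = w s_t` cannot
be shorter since `w` is minimal in its coset. -/
theorem IsRep.length_simple_mul_lt_iff (hk : 0 < k) {γ : YoungDiagram} (hγ : IsCore (k + 1) γ)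
    {w : AffinePerm k} {m : ℕ} (h : IsRep k γ w m) (i : ZMod (k + 1)) :
    (cox k).length ((cox k).simple i * w) < (cox k).length w ↔ 0 < jump k γ i := by
  constructor
  · intro hlt
    by_contra h'
    rcases (not_lt.1 h').lt_or_eq with h1 | h1
    · have := (h.addCorners hk hγ h1).length_eq hk (isCore_addCorners hk hγ i)
      have := h.length_eq hk hγ
      omega
    · obtain ⟨t, ht, h2⟩ := h.simple_mul_of_jump_eq_zero hk hγ h1
      have := h.isGrassmannian hk hγ ((cox k).simple t) (Subgroup.subset_closure ⟨t, ht, rfl⟩)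
      rw [h2] at hlt
      omega
  · intro h1
    obtain ⟨m', rfl, h2⟩ := h.exists_of_jump_pos hk hγ h1
    rw [h2.length_eq hk (isCore_removeCorners hk hγ i), h.length_eq hk hγ]
    omega

theorem IsRep.core_eq_bot {γ : YoungDiagram} {w : AffinePerm k} (h : IsRep k γ w 0) : γ = ⊥ := by
  generalize hm : 0 = m at h
  cases h with
  | bot => rfl
  | step => omega

/-- Any reduced word rebuilds the core: its first letter is a left descent, so it removes corners
and can be undone. This makes `toCore` independent of the word chosen by `reducedWord`. -/
theorem IsRep.foldr_addCorners (hk : 0 < k) {γ : YoungDiagram} (hγ : IsCore (k + 1) γ)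
    {ω : List (ZMod (k + 1))} (hω : (cox k).IsReduced ω)
    (h : IsRep k γ ((cox k).wordProd ω) ω.length) : ω.foldr (AffineSV.addCorners k) ⊥ = γ := by
  induction ω generalizing γ with
  | nil =>
    rw [(cox k).wordProd_nil] at h
    exact h.core_eq_bot.symm
  | cons i ω ih =>
    have hω' : (cox k).IsReduced ω := by simpa using hω.drop 1
    have h1 : 0 < jump k γ i := by
      rw [← h.length_simple_mul_lt_iff hk hγ, hω.eq, (cox k).wordProd_cons,
        (cox k).simple_mul_simple_cancel_left, hω'.eq]
      simp
    obtain ⟨m', hm, h2⟩ := h.exists_of_jump_pos hk hγ h1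
    rw [(cox k).wordProd_cons, (cox k).simple_mul_simple_cancel_left] at h2
    obtain rfl : ω.length = m' := by simpa using hm
    rw [List.foldr_cons, ih (isCore_removeCorners hk hγ i) hω' h2,
      addCorners_removeCorners hk hγ h1.le]

theorem reducedWord_spec (w : AffinePerm k) :
    (cox k).IsReduced (reducedWord k w) ∧ w = (cox k).wordProd (reducedWord k w) :=
  ((cox k).exists_isReduced w).choose_spec

theorem IsRep.toCore_eq (hk : 0 < k) {γ : YoungDiagram} (hγ : IsCore (k + 1) γ)
    {w : AffinePerm k} {m : ℕ} (h : IsRep k γ w m) : toCore k w = γ := by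
  obtain ⟨h1, h2⟩ := reducedWord_spec w
  have h3 := h.length_eq hk hγ
  rw [h2, h1.eq] at h3
  refine IsRep.foldr_addCorners hk hγ h1 ?_
  rw [← h2]
  exact h3 ▸ h

theorem grassmannianOf_isRep (hk : 0 < k) {lam : YoungDiagram}
    (hγ : IsCore (k + 1) (coreOf k lam)) :
    ∃ m, IsRep k (coreOf k lam) (grassmannianOf k lam) m := by
  have hex : ∃ w ∈ {w | IsGrassmannian k w}, toCore k w = coreOf k lam := by
    obtain ⟨w, m, h⟩ := exists_isRep hk _ hγ
    exact ⟨w, h.isGrassmannian hk hγ, h.toCore_eq hk hγ⟩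
  have h1 : IsGrassmannian k (grassmannianOf k lam) := Function.invFunOn_mem hex
  have h2 : toCore k (grassmannianOf k lam) = coreOf k lam := Function.invFunOn_eq hex
  obtain ⟨γ', m, hγ', h⟩ := h1.exists_isRep hk
  rw [← h2, h.toCore_eq hk hγ']
  exact ⟨m, h⟩

theorem IsRep.core_unique (hk : 0 < k) {γ δ : YoungDiagram} (hγ : IsCore (k + 1) γ)
    (hδ : IsCore (k + 1) δ) {w : AffinePerm k} {m m' : ℕ} (h : IsRep k γ w m)
    (h' : IsRep k δ w m') : γ = δ := by
  rw [← h.toCore_eq hk hγ, h'.toCore_eq hk hδ]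

end

section
variable {k : ℕ}

/-! ### The 0-Hecke action on affine Grassmannian elements -/

theorem IsRep.heckeSimple (hk : 0 < k) {γ : YoungDiagram} (hγ : IsCore (k + 1) γ)
    {w : AffinePerm k} {m : ℕ} (h : IsRep k γ w m) {i : ZMod (k + 1)} (hi : jump k γ i ≠ 0) :
    ∃ m', IsRep k (AffineSV.addCorners k i γ) (heckeSimple k i w) m' := by
  rcases hi.lt_or_gt with h1 | h1
  · have h2 := h.addCorners hk hγ h1
    have h3 := h.length_eq hk hγ
    have h4 := h2.length_eq hk (isCore_addCorners hk hγ i)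
    rw [AffineSV.heckeSimple, if_pos (by omega)]
    exact ⟨_, h2⟩
  · have h2 := (h.length_simple_mul_lt_iff hk hγ i).2 h1
    rw [AffineSV.heckeSimple, if_neg (by omega), addCorners_eq_self hγ h1.le]
    exact ⟨m, h⟩

/-- Grassmannian elements are stable backwards: if `s_i * u` is one, then `u` is one and its jump at
`i` is nonzero. A product that has left the set therefore never re-enters it. -/
theorem exists_isRep_of_heckeSimple (hk : 0 < k) {γ : YoungDiagram} (hγ : IsCore (k + 1) γ)
    {u : AffinePerm k} {m : ℕ} {i : ZMod (k + 1)} (h : IsRep k γ (heckeSimple k i u) m) :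
    ∃ δ m', IsCore (k + 1) δ ∧ IsRep k δ u m' ∧ jump k δ i ≠ 0 := by
  rw [heckeSimple] at h
  split_ifs at h with h1
  · have h2 : 0 < jump k γ i := by
      rw [← h.length_simple_mul_lt_iff hk hγ, (cox k).simple_mul_simple_cancel_left]
      exact h1
    obtain ⟨m', -, h3⟩ := h.exists_of_jump_pos hk hγ h2
    rw [(cox k).simple_mul_simple_cancel_left] at h3
    refine ⟨_, _, isCore_removeCorners hk hγ i, h3, ?_⟩
    rw [jump_removeCorners_self hk hγ, neg_ne_zero, abs_ne_zero]
    exact h2.ne'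
  · refine ⟨γ, m, hγ, h, ne_of_gt ?_⟩
    rw [← h.length_simple_mul_lt_iff hk hγ]
    exact lt_of_le_of_ne (not_lt.1 h1) ((cox k).length_simple_mul_ne u i)

/-- Add corners of the residues in `L`, from left to right. -/
noncomputable def addPath (k : ℕ) (γ : YoungDiagram) (L : List (ZMod (k + 1))) : YoungDiagram :=
  L.foldl (fun γ i => addCorners k i γ) γ

/-- Act by the generators in `L`, from left to right. -/
noncomputable def heckePath (k : ℕ) (u : AffinePerm k) (L : List (ZMod (k + 1))) : AffinePerm k :=
  L.foldl (fun u i => heckeSimple k i u) u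

/-- Every step of `L` meets an addable or a removable corner. -/
def ValidPath (k : ℕ) : YoungDiagram → List (ZMod (k + 1)) → Prop
  | _, [] => True
  | γ, i :: L => jump k γ i ≠ 0 ∧ ValidPath k (addCorners k i γ) L

theorem addPath_cons (γ : YoungDiagram) (i : ZMod (k + 1)) (L : List (ZMod (k + 1))) :
    addPath k γ (i :: L) = addPath k (addCorners k i γ) L := rfl

theorem addPath_append (γ : YoungDiagram) (L L' : List (ZMod (k + 1))) :
    addPath k γ (L ++ L') = addPath k (addPath k γ L) L' := List.foldl_append

theorem heckePath_cons (u : AffinePerm k) (i : ZMod (k + 1)) (L : List (ZMod (k + 1))) :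
    heckePath k u (i :: L) = heckePath k (heckeSimple k i u) L := rfl

theorem isCore_addPath (hk : 0 < k) {γ : YoungDiagram} (hγ : IsCore (k + 1) γ)
    (L : List (ZMod (k + 1))) : IsCore (k + 1) (addPath k γ L) := by
  induction L generalizing γ with
  | nil => exact hγ
  | cons i L ih => exact ih (isCore_addCorners hk hγ i)

theorem validPath_append (γ : YoungDiagram) (L L' : List (ZMod (k + 1))) :
    ValidPath k γ (L ++ L') ↔ ValidPath k γ L ∧ ValidPath k (addPath k γ L) L' := by
  induction L generalizing γ with
  | nil => simp [ValidPath, addPath]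
  | cons i L ih =>
    rw [List.cons_append, ValidPath, ValidPath, ih, addPath_cons, and_assoc]

theorem exists_isRep_of_heckePath (hk : 0 < k) {γ : YoungDiagram} (hγ : IsCore (k + 1) γ)
    {u : AffinePerm k} {m : ℕ} {L : List (ZMod (k + 1))} (h : IsRep k γ (heckePath k u L) m) :
    ∃ δ m', IsCore (k + 1) δ ∧ IsRep k δ u m' := by
  induction L generalizing u with
  | nil => exact ⟨γ, m, hγ, h⟩
  | cons i L ih =>
    obtain ⟨δ, m', hδ, h1⟩ := ih h
    obtain ⟨δ', m'', hδ', h2, -⟩ := exists_isRep_of_heckeSimple hk hδ h1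
    exact ⟨δ', m'', hδ', h2⟩

theorem heckePath_eq_iff (hk : 0 < k) {γ δ : YoungDiagram} (hγ : IsCore (k + 1) γ)
    (hδ : IsCore (k + 1) δ) {u w : AffinePerm k} {m m' : ℕ} (hu : IsRep k γ u m)
    (hw : IsRep k δ w m') (L : List (ZMod (k + 1))) :
    heckePath k u L = w ↔ ValidPath k γ L ∧ addPath k γ L = δ := by
  induction L generalizing γ u m with
  | nil =>
    simp only [heckePath, ValidPath, addPath, List.foldl_nil, true_and]
    constructor
    · rintro rfl
      exact hu.core_unique hk hγ hδ hw
    · rintro rfl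
      exact (hu.unique hk hγ hw).1
  | cons i L ih =>
    rw [heckePath_cons, addPath_cons, ValidPath]
    by_cases hi : jump k γ i = 0
    · refine ⟨fun h => ?_, fun h => absurd hi h.1.1⟩
      exfalso
      rw [← h] at hw
      obtain ⟨γ1, m1, hγ1, h1⟩ := exists_isRep_of_heckePath hk hδ hw
      obtain ⟨γ2, m2, hγ2, h2, h3⟩ := exists_isRep_of_heckeSimple hk hγ1 h1
      rw [← hu.core_unique hk hγ hγ2 h2] at h3
      exact h3 hi
    · obtain ⟨m1, h1⟩ := hu.heckeSimple hk hγ hi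
      rw [ih (isCore_addCorners hk hγ i) h1]
      tauto

theorem heckeMul_eq_heckePath (v u : AffinePerm k) :
    heckeMul k v u = heckePath k u (reducedWord k v).reverse := by
  rw [heckeMul, heckePath, List.foldl_reverse]

/-! ### Cyclically decreasing words -/

/-- A word without repetitions in which `j - 1` precedes `j`: the reverse of a cyclically
decreasing word. -/
def CycInc (L : List (ZMod (k + 1))) : Prop := L.Pairwise fun a b => a ≠ b ∧ a ≠ b + 1

theorem CycInc.nodup {L : List (ZMod (k + 1))} (h : CycInc L) : L.Nodup := h.imp fun h => h.1

/-- The list is reversed because paths apply their letters from left to right, whereas the rightmost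
letter of a product acts first. -/
theorem isCyclicallyDecreasingWord_reverse_iff (hk : 0 < k) {L : List (ZMod (k + 1))} :
    IsCyclicallyDecreasingWord k L.reverse ↔ CycInc L := by
  rw [CycInc, ← List.pairwise_reverse (l := L), IsCyclicallyDecreasingWord]
  generalize L.reverse = ω
  constructor
  · rintro ⟨h1, h2⟩
    rw [List.pairwise_iff_getElem]
    intro p q hp hq hpq
    have hne : ω[q] ≠ ω[p] := fun h => by
      have := (h1.getElem_inj_iff).1 h
      omega
    refine ⟨hne, fun h => ?_⟩
    have h3 := h2 ω[q] (List.getElem_mem hq) (by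
      rw [h, add_sub_cancel_right]
      exact List.getElem_mem hp)
    have h4 : ω[q] - 1 = ω[p] := by rw [h, add_sub_cancel_right]
    rw [h4, h1.idxOf_getElem, h1.idxOf_getElem] at h3
    omega
  · intro h
    refine ⟨h.imp fun h => h.1.symm, fun j hj hj' => ?_⟩
    by_contra h1
    have h2 := List.idxOf_lt_length_of_mem hj
    have h3 := List.idxOf_lt_length_of_mem hj'
    rcases (not_lt.1 h1).lt_or_eq with h4 | h4
    · have := (List.pairwise_iff_getElem.1 h) _ _ h3 h2 h4
      simp only [List.getElem_idxOf] at this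
      exact this.2 (by ring)
    · have := List.getElem_idxOf h2
      simp only [← h4, List.getElem_idxOf] at this
      exact zmod_one_ne_zero hk (by linear_combination -this)

/-- Only the generator with the residue of `c` moves anything across the wall between `c - 1` and
`c`. Wall crossings thus detect which letters a repetition-free word uses, and in which order. -/
theorem refl_lt_iff {i : ZMod (k + 1)} {c : ℤ} (hc : (c : ZMod (k + 1)) ≠ i) (x : ℤ) :
    refl k i x < c ↔ x < c := by
  rw [refl]
  split_ifs with h1 h2
  · have : x ≠ c := by rintro rfl; exact hc h1
    omega
  · have : x + 1 ≠ c := by rintro rfl; exact hc (by push_cast; exact h2)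
    omega
  · rfl

theorem permRep_wordProd_lt_iff (hk : 0 < k) {ω : List (ZMod (k + 1))} {c : ℤ}
    (hc : (c : ZMod (k + 1)) ∉ ω) (x : ℤ) :
    permRep hk ((cox k).wordProd ω) x < c ↔ x < c := by
  induction ω with
  | nil => simp
  | cons i ω ih =>
    rw [List.mem_cons, not_or] at hc
    rw [(cox k).wordProd_cons, permRep_simple_mul, refl_lt_iff hc.1, ih hc.2]

theorem exists_permRep_crossing (hk : 0 < k) {ω : List (ZMod (k + 1))} (hω : ω.Nodup) {c : ℤ}
    (hc : (c : ZMod (k + 1)) ∈ ω) :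
    ∃ x < c, c ≤ permRep hk ((cox k).wordProd ω) x := by
  obtain ⟨l1, l2, rfl⟩ := List.append_of_mem hc
  have h1 : (c : ZMod (k + 1)) ∉ l1 := fun h =>
    (List.nodup_append.1 hω).2.2 _ h _ (by simp) rfl
  have h2 : (c : ZMod (k + 1)) ∉ l2 := (List.nodup_cons.1 (List.nodup_append.1 hω).2.1).1
  refine ⟨(permRep hk ((cox k).wordProd l2)).symm (c - 1), ?_, ?_⟩
  · rw [← permRep_wordProd_lt_iff hk h2, Equiv.apply_symm_apply]
    omega
  · rw [(cox k).wordProd_append, (cox k).wordProd_cons, permRep_mul, permRep_simple_mul,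
      Equiv.apply_symm_apply, refl_of_succ hk (by push_cast; ring), sub_add_cancel]
    exact not_lt.1 fun h => lt_irrefl c ((permRep_wordProd_lt_iff hk h1 c).1 h)

theorem subset_of_wordProd_eq (hk : 0 < k) {ω ρ : List (ZMod (k + 1))} (hω : ω.Nodup)
    (h : (cox k).wordProd ω = (cox k).wordProd ρ) : ω ⊆ ρ := by
  intro i hi
  by_contra hi'
  obtain ⟨c, rfl⟩ := exists_intCast i
  obtain ⟨x, hx, hx'⟩ := exists_permRep_crossing hk hω hi
  rw [h] at hx'
  exact absurd ((permRep_wordProd_lt_iff hk hi' x).2 hx) (not_lt.2 hx')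

/-- Every word of the same element must contain all the letters of `ω`, so none is shorter. -/
theorem isReduced_of_nodup (hk : 0 < k) {ω : List (ZMod (k + 1))} (hω : ω.Nodup) :
    (cox k).IsReduced ω := by
  obtain ⟨ρ, hρ, h⟩ := (cox k).exists_isReduced ((cox k).wordProd ω)
  refine le_antisymm ((cox k).length_wordProd_le ω) ?_
  rw [h, hρ.eq]
  exact (hω.subperm (subset_of_wordProd_eq hk hω h)).length_le

theorem perm_of_wordProd_eq (hk : 0 < k) {ω ρ : List (ZMod (k + 1))} (hω : ω.Nodup)
    (hρ : (cox k).IsReduced ρ) (h : (cox k).wordProd ω = (cox k).wordProd ρ) : ω.Perm ρ := by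
  refine (hω.subperm (subset_of_wordProd_eq hk hω h)).perm_of_length_le ?_
  rw [← hρ.eq, ← h]
  exact (cox k).length_wordProd_le ω

theorem permRep_wordProd_eq_self (hk : 0 < k) {ω : List (ZMod (k + 1))} {x : ℤ}
    (h1 : (x : ZMod (k + 1)) ∉ ω) (h2 : (x : ZMod (k + 1)) + 1 ∉ ω) :
    permRep hk ((cox k).wordProd ω) x = x := by
  have h3 := permRep_wordProd_lt_iff hk h1 x
  have h4 := permRep_wordProd_lt_iff hk (c := x + 1) (by push_cast; exact h2) x
  omega

/-- Follow the point `c - 1`. If the letter `c - 1` acts before `c`, the point goes to `c - 2` and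
never recrosses the wall at `c - 1`. Otherwise the letter `c` carries it to `c`, and no later letter
brings it back. -/
theorem permRep_wordProd_lt_iff_idxOf (hk : 0 < k) {ω : List (ZMod (k + 1))} (hω : ω.Nodup)
    {c : ℤ} (h1 : (c : ZMod (k + 1)) ∈ ω) (h2 : (c : ZMod (k + 1)) - 1 ∈ ω) :
    permRep hk ((cox k).wordProd ω) (c - 1) < c ↔
      ω.idxOf (c : ZMod (k + 1)) < ω.idxOf ((c : ZMod (k + 1)) - 1) := by
  have hne : (c : ZMod (k + 1)) - 1 ≠ c := fun h =>
    zmod_one_ne_zero hk (by linear_combination -h)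
  obtain ⟨l1, l2, rfl⟩ := List.append_of_mem h1
  obtain ⟨hn1, hn2, hd⟩ := List.nodup_append.1 hω
  have h3 : (c : ZMod (k + 1)) ∉ l1 := fun h => hd _ h _ (by simp) rfl
  have h4 : (c : ZMod (k + 1)) ∉ l2 := (List.nodup_cons.1 hn2).1
  rw [List.idxOf_append_of_notMem h3, List.idxOf_cons_self, add_zero]
  rw [List.mem_append, List.mem_cons] at h2
  by_cases h5 : (c : ZMod (k + 1)) - 1 ∈ l1
  · have h6 : (c : ZMod (k + 1)) - 1 ∉ l2 := fun h => hd _ h5 _ (List.mem_cons_of_mem _ h) rfl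
    rw [List.idxOf_append_of_mem h5]
    have := List.idxOf_lt_length_of_mem h5
    refine iff_of_false (not_lt.2 ?_) (by omega)
    rw [(cox k).wordProd_append, (cox k).wordProd_cons, permRep_mul, permRep_simple_mul,
      permRep_wordProd_eq_self hk (ω := l2) (x := c - 1) (by push_cast; exact h6)
        (by push_cast; simpa using h4),
      refl_of_succ hk (by push_cast; ring), sub_add_cancel]
    exact not_lt.1 fun h => lt_irrefl c ((permRep_wordProd_lt_iff hk h3 c).1 h)
  · have h6 : (c : ZMod (k + 1)) - 1 ∈ l2 := (h2.resolve_left h5).resolve_left hne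
    rw [List.idxOf_append_of_notMem h5, List.idxOf_cons_ne _ hne.symm]
    refine iff_of_true ?_ (by omega)
    obtain ⟨l3, l4, rfl⟩ := List.append_of_mem h6
    obtain ⟨hn3, hn4, hd'⟩ := List.nodup_append.1 (List.nodup_cons.1 hn2).2
    have h7 : (c : ZMod (k + 1)) - 1 ∉ l3 := fun h => hd' _ h _ (by simp) rfl
    have h8 : (c : ZMod (k + 1)) - 1 ∉ l4 := (List.nodup_cons.1 hn4).1
    have h9 : (c : ZMod (k + 1)) ∉ l4 := fun h => h4 (by simp [h])
    rw [show l1 ++ (c : ZMod (k + 1)) :: (l3 ++ ((c : ZMod (k + 1)) - 1) :: l4) =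
      (l1 ++ (c : ZMod (k + 1)) :: l3) ++ ((c : ZMod (k + 1)) - 1) :: l4 by simp]
    rw [(cox k).wordProd_append, (cox k).wordProd_cons _ l4, permRep_mul, permRep_simple_mul,
      permRep_wordProd_eq_self hk (ω := l4) (x := c - 1) (by push_cast; exact h8)
        (by push_cast; simpa using h9),
      refl_of_eq (by push_cast; rfl)]
    have := (permRep_wordProd_lt_iff hk (ω := l1 ++ (c : ZMod (k + 1)) :: l3) (c := c - 1) (by
      push_cast
      rw [List.mem_append, List.mem_cons]
      tauto) (c - 1 - 1)).2 (by omega)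
    omega

/-- Needed because `heckeMul` uses an unspecified reduced word of its left factor. -/
theorem cycInc_of_wordProd_eq (hk : 0 < k) {L R : List (ZMod (k + 1))} (hL : CycInc L)
    (hp : L.Perm R)
    (h : (cox k).wordProd L.reverse = (cox k).wordProd R.reverse) : CycInc R := by
  rw [← isCyclicallyDecreasingWord_reverse_iff hk] at hL ⊢
  refine ⟨List.nodup_reverse.2 (hp.nodup_iff.1 (List.nodup_reverse.1 hL.1)), fun j hj hj' => ?_⟩
  have hp' : ∀ i, i ∈ L.reverse ↔ i ∈ R.reverse := fun i => by
    rw [List.mem_reverse, List.mem_reverse, hp.mem_iff]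
  obtain ⟨c, rfl⟩ := exists_intCast j
  have h1 := hL.2 _ ((hp' _).2 hj) ((hp' _).2 hj')
  rw [← permRep_wordProd_lt_iff_idxOf hk hL.1 ((hp' _).2 hj) ((hp' _).2 hj'), h] at h1
  rwa [permRep_wordProd_lt_iff_idxOf hk
    (List.nodup_reverse.2 (hp.nodup_iff.1 (List.nodup_reverse.1 hL.1))) hj hj'] at h1

/-! ### Commutation -/

/-- Cyclic monotonicity fixes the order of adjacent letters, so two such words on the same letters
differ by commutations only. Let `a` be the head of `L`: a letter `b` before `a` in `L'` is neither
`a` nor `a + 1` by `L'`, nor `a - 1` by `L`, so `a` can be moved to the front. -/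
theorem foldl_eq_of_perm {X : Type*} (P : X → Prop) (f : X → ZMod (k + 1) → X)
    (hP : ∀ x i, P x → P (f x i))
    (hf : ∀ x i j, P x → i ≠ j → i ≠ j + 1 → j ≠ i + 1 → f (f x i) j = f (f x j) i)
    {L L' : List (ZMod (k + 1))} (hp : L.Perm L') (hL : CycInc L) (hL' : CycInc L') {x : X}
    (hx : P x) : L.foldl f x = L'.foldl f x := by
  have move : ∀ (a : ZMod (k + 1)) (l1 l2 : List (ZMod (k + 1))) (x : X), P x →
      (∀ b ∈ l1, b ≠ a ∧ b ≠ a + 1 ∧ a ≠ b + 1) →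
      (l1 ++ a :: l2).foldl f x = (l1 ++ l2).foldl f (f x a) := by
    intro a l1 l2
    induction l1 with
    | nil => intros; rfl
    | cons b l1 ih =>
      intro x hx hb
      obtain ⟨h1, h2, h3⟩ := hb b (by simp)
      rw [List.cons_append, List.cons_append, List.foldl_cons, List.foldl_cons,
        ih _ (hP _ _ hx) fun c hc => hb c (by simp [hc]), hf x b a hx h1 h2 h3]
  induction L generalizing L' x with
  | nil => rw [← hp.nil_eq]
  | cons a L ih =>
    obtain ⟨l1, l2, rfl⟩ := List.append_of_mem (hp.subset (List.mem_cons_self))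
    have hp' : L.Perm (l1 ++ l2) := (hp.trans List.perm_middle).cons_inv
    obtain ⟨h1, h2⟩ := List.pairwise_cons.1 hL
    obtain ⟨h3, h4, h5⟩ := List.pairwise_append.1 hL'
    rw [List.foldl_cons, move a l1 l2 x hx]
    · refine ih hp' h2 ?_ (hP _ _ hx)
      exact hL'.sublist (List.Sublist.append_left (List.sublist_cons_self a l2) l1)
    · intro b hb
      have h6 := h5 b hb a (by simp)
      exact ⟨h6.1, h6.2, (h1 b (hp'.symm.subset (by simp [hb]))).2⟩

theorem wordProd_reverse_eq_of_perm {L L' : List (ZMod (k + 1))} (hp : L.Perm L')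
    (hL : CycInc L) (hL' : CycInc L') :
    (cox k).wordProd L.reverse = (cox k).wordProd L'.reverse := by
  have key : ∀ L : List (ZMod (k + 1)), (cox k).wordProd L.reverse =
      L.foldl (fun w i => (cox k).simple i * w) 1 := by
    intro L
    rw [← List.foldr_reverse]
    generalize L.reverse = ω
    induction ω with
    | nil => simp
    | cons i ω ih => rw [(cox k).wordProd_cons, ih, List.foldr_cons]
  rw [key, key]
  refine foldl_eq_of_perm (fun _ => True) _ (fun _ _ _ => trivial) ?_ hp hL hL' trivial
  intro x i j _ h0 h1 h2
  rw [← mul_assoc, ← mul_assoc, simple_mul_comm h0 h1 h2]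

theorem raise_raise (hk : 0 < k) {i j : ZMod (k + 1)} (h0 : i ≠ j) (h1 : i ≠ j + 1)
    (h2 : j ≠ i + 1) (h : ℤ → ℤ) {x : ℤ}
    (hx : (x : ZMod (k + 1)) = i ∨ (x : ZMod (k + 1)) + 1 = i) :
    raise k i (raise k j h) x = raise k i h x := by
  rcases hx with hx | hx
  · rw [raise, if_pos hx, raise_of_ne (by rwa [hx]) (by rw [hx]; exact h2.symm), raise_of_ne,
      raise, if_pos hx]
    · push_cast
      rw [hx]
      intro h'
      exact h1 (by linear_combination h')
    · push_cast
      rw [hx]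
      simpa using h0
  · have hx' : (x : ZMod (k + 1)) ≠ i := by
      rw [← hx]
      exact (zmod_add_one_ne hk _).symm
    rw [raise, if_neg hx', if_pos hx, raise_of_ne, raise_of_ne, raise, if_neg hx', if_pos hx]
    · push_cast
      rwa [hx]
    · push_cast
      rw [hx]
      exact h2.symm
    · intro h'
      exact h1 (by rw [← hx, h'])
    · rwa [hx]

theorem raise_comm (hk : 0 < k) {i j : ZMod (k + 1)} (h0 : i ≠ j) (h1 : i ≠ j + 1)
    (h2 : j ≠ i + 1) (h : ℤ → ℤ) : raise k i (raise k j h) = raise k j (raise k i h) := by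
  have key : ∀ {i j : ZMod (k + 1)}, i ≠ j → i ≠ j + 1 → j ≠ i + 1 → ∀ x : ℤ,
      ((x : ZMod (k + 1)) = i ∨ (x : ZMod (k + 1)) + 1 = i) →
      raise k i (raise k j h) x = raise k j (raise k i h) x := by
    intro i j h0 h1 h2 x hx
    rw [raise_raise hk h0 h1 h2 h hx, raise_of_ne (i := j)]
    · rcases hx with hx | hx
      · rwa [hx]
      · intro h'
        exact h1 (by rw [← hx, h'])
    · rcases hx with hx | hx
      · rw [hx]
        exact h2.symm
      · rwa [hx]
  funext x
  by_cases hx : (x : ZMod (k + 1)) = i ∨ (x : ZMod (k + 1)) + 1 = i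
  · exact key h0 h1 h2 x hx
  · by_cases hx' : (x : ZMod (k + 1)) = j ∨ (x : ZMod (k + 1)) + 1 = j
    · exact (key h0.symm h2 h1 x hx').symm
    · push Not at hx hx'
      rw [raise_of_ne hx.1 hx.2, raise_of_ne hx'.1 hx'.2, raise_of_ne hx'.1 hx'.2,
        raise_of_ne hx.1 hx.2]

theorem addCorners_comm (hk : 0 < k) {γ : YoungDiagram} (hγ : IsCore (k + 1) γ)
    {i j : ZMod (k + 1)} (h0 : i ≠ j) (h1 : i ≠ j + 1) (h2 : j ≠ i + 1) :
    addCorners k i (addCorners k j γ) = addCorners k j (addCorners k i γ) := by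
  have ci := isCore_addCorners hk hγ i
  have cj := isCore_addCorners hk hγ j
  refine lev_injective (isCore_addCorners hk cj i) (isCore_addCorners hk ci j) ?_
  rw [lev_addCorners hk cj, lev_addCorners hk ci, lev_addCorners hk hγ, lev_addCorners hk hγ,
    raise_comm hk h0 h1 h2]

theorem key_addCorners_addCorners (hk : 0 < k) {γ : YoungDiagram} (hγ : IsCore (k + 1) γ)
    {i j : ZMod (k + 1)} (h0 : i ≠ j) (h1 : i ≠ j + 1) (h2 : j ≠ i + 1) :
    key k (addCorners k i (addCorners k j γ)) i = key k (addCorners k i γ) i := by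
  obtain ⟨c, hc⟩ := exists_intCast i
  have ci := isCore_addCorners hk hγ i
  have cj := isCore_addCorners hk hγ j
  rw [key_eq (isCore_addCorners hk cj i) hc, key_eq ci hc, lev_addCorners hk cj,
    lev_addCorners hk hγ, lev_addCorners hk hγ, raise_raise hk h0 h1 h2 _ (Or.inl hc)]

/-! ### Lowest cells along a path, and the sorted representative of a commutation class. -/

/-- One step of a path: the current diagram, the validity of the steps so far, and for each residue
the content of the lowest cell at its last occurrence. -/
noncomputable def recordStep (k : ℕ) (s : YoungDiagram × Prop × (ZMod (k + 1) → ℤ))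
    (i : ZMod (k + 1)) : YoungDiagram × Prop × (ZMod (k + 1) → ℤ) :=
  (addCorners k i s.1, s.2.1 ∧ jump k s.1 i ≠ 0,
    Function.update s.2.2 i (key k (addCorners k i s.1) i))

theorem recordStep_self (s : YoungDiagram × Prop × (ZMod (k + 1) → ℤ)) (i : ZMod (k + 1)) :
    (recordStep k s i).2.2 i = key k (addCorners k i s.1) i := Function.update_self ..

theorem recordStep_of_ne (s : YoungDiagram × Prop × (ZMod (k + 1) → ℤ)) {i j : ZMod (k + 1)}
    (h : i ≠ j) : (recordStep k s j).2.2 i = s.2.2 i := Function.update_of_ne h ..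

theorem recordStep_comm (hk : 0 < k) (s : YoungDiagram × Prop × (ZMod (k + 1) → ℤ))
    (i j : ZMod (k + 1)) (hs : IsCore (k + 1) s.1) (h0 : i ≠ j) (h1 : i ≠ j + 1)
    (h2 : j ≠ i + 1) : recordStep k (recordStep k s i) j = recordStep k (recordStep k s j) i := by
  simp only [recordStep, Prod.mk.injEq]
  refine ⟨addCorners_comm hk hs h0.symm h2 h1, ?_, ?_⟩
  · rw [jump_addCorners_of_ne hk hs h0 h1 h2, jump_addCorners_of_ne hk hs h0.symm h2 h1,
      and_assoc, and_assoc, and_comm (a := jump k s.1 i ≠ 0)]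
  · rw [key_addCorners_addCorners hk hs h0 h1 h2, key_addCorners_addCorners hk hs h0.symm h2 h1,
      Function.update_comm h0]

/-- The contents of the lowest cells along a path. -/
noncomputable def keyList (k : ℕ) : YoungDiagram → List (ZMod (k + 1)) → List ℤ
  | _, [] => []
  | γ, i :: L => key k (addCorners k i γ) i :: keyList k (addCorners k i γ) L

/-- For each residue the content of the lowest cell at its last occurrence along the path. -/
noncomputable def record (k : ℕ) (γ : YoungDiagram) (L : List (ZMod (k + 1))) :
    ZMod (k + 1) → ℤ :=
  (L.foldl (recordStep k) (γ, True, 0)).2.2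

theorem foldl_recordStep (s : YoungDiagram × Prop × (ZMod (k + 1) → ℤ))
    (L : List (ZMod (k + 1))) :
    (L.foldl (recordStep k) s).1 = addPath k s.1 L ∧
      ((L.foldl (recordStep k) s).2.1 ↔ s.2.1 ∧ ValidPath k s.1 L) := by
  induction L generalizing s with
  | nil => simp [addPath, ValidPath]
  | cons i L ih =>
    rw [List.foldl_cons, (ih _).1, (ih _).2, ValidPath, addPath_cons, recordStep]
    exact ⟨rfl, and_assoc⟩

theorem foldl_recordStep_of_notMem (s : YoungDiagram × Prop × (ZMod (k + 1) → ℤ))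
    {L : List (ZMod (k + 1))} {i : ZMod (k + 1)} (h : i ∉ L) :
    (L.foldl (recordStep k) s).2.2 i = s.2.2 i := by
  induction L generalizing s with
  | nil => rfl
  | cons j L ih =>
    rw [List.mem_cons, not_or] at h
    rw [List.foldl_cons, ih _ h.2, recordStep_of_ne _ h.1]

theorem map_foldl_recordStep (s : YoungDiagram × Prop × (ZMod (k + 1) → ℤ))
    {L : List (ZMod (k + 1))} (h : L.Nodup) :
    L.map (L.foldl (recordStep k) s).2.2 = keyList k s.1 L := by
  induction L generalizing s with
  | nil => rfl
  | cons i L ih =>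
    obtain ⟨h1, h2⟩ := List.nodup_cons.1 h
    rw [List.map_cons, keyList, List.foldl_cons, foldl_recordStep_of_notMem _ h1, ih _ h2]
    simp [recordStep]

theorem map_record (γ : YoungDiagram) {L : List (ZMod (k + 1))} (h : L.Nodup) :
    L.map (record k γ L) = keyList k γ L := map_foldl_recordStep _ h

theorem foldl_recordStep_eq_of_perm (hk : 0 < k) {γ : YoungDiagram} (hγ : IsCore (k + 1) γ)
    {L L' : List (ZMod (k + 1))} (hp : L.Perm L') (hL : CycInc L) (hL' : CycInc L') :
    L.foldl (recordStep k) (γ, True, 0) = L'.foldl (recordStep k) (γ, True, 0) :=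
  foldl_eq_of_perm (fun s => IsCore (k + 1) s.1) (recordStep k)
    (fun _ i hs => isCore_addCorners hk hs i)
    (fun s i j hs h0 h1 h2 => recordStep_comm hk s i j hs h0 h1 h2) hp hL hL' hγ

/-- Since diagram, validity and contents form one state, a single commutation argument yields the
three invariances. -/
theorem path_eq_of_perm (hk : 0 < k) {γ : YoungDiagram} (hγ : IsCore (k + 1) γ)
    {L L' : List (ZMod (k + 1))} (hp : L.Perm L') (hL : CycInc L) (hL' : CycInc L') :
    addPath k γ L = addPath k γ L' ∧ (ValidPath k γ L ↔ ValidPath k γ L') ∧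
      record k γ L = record k γ L' := by
  have h := foldl_recordStep_eq_of_perm hk hγ hp hL hL'
  have h1 := foldl_recordStep (γ, True, 0) L
  have h2 := foldl_recordStep (γ, True, 0) L'
  refine ⟨?_, ?_, ?_⟩
  · rw [← h1.1, h, h2.1]
  · have := h1.2.symm.trans (h ▸ h2.2)
    simpa using this
  · rw [record, h, record]

theorem record_intCast {γ : YoungDiagram} {L : List (ZMod (k + 1))} (hL : L.Nodup)
    {i : ZMod (k + 1)} (hi : i ∈ L) : (record k γ L i : ZMod (k + 1)) = i := by
  obtain ⟨l1, l2, rfl⟩ := List.append_of_mem hi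
  have h2 : i ∉ l2 := (List.nodup_cons.1 (List.nodup_append.1 hL).2.1).1
  rw [record, List.foldl_append, List.foldl_cons, foldl_recordStep_of_notMem _ h2,
    recordStep_self, intCast_key]

theorem lev_addPath_of_notMem (hk : 0 < k) {γ : YoungDiagram} (hγ : IsCore (k + 1) γ)
    {L : List (ZMod (k + 1))} {x : ℤ} (h1 : (x : ZMod (k + 1)) ∉ L)
    (h2 : (x : ZMod (k + 1)) + 1 ∉ L) : lev k (addPath k γ L) x = lev k γ x := by
  induction L generalizing γ with
  | nil => rfl
  | cons i L ih =>
    rw [List.mem_cons, not_or] at h1 h2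
    rw [addPath_cons, ih (isCore_addCorners hk hγ i) h1.2 h2.2, lev_addCorners hk hγ,
      raise_of_ne h1.1 h2.1]

/-- The letter `j` comes first. Its lowest content has level `1`, which the letters in between do
not touch. Adding the corners of residue `j + 1` raises the level at the next content to at least
`1`, so the new lowest content is at least one more. -/
theorem record_lt_record (hk : 0 < k) {γ : YoungDiagram} (hγ : IsCore (k + 1) γ)
    {L : List (ZMod (k + 1))} (hL : CycInc L) {j : ZMod (k + 1)} (hj : j ∈ L)
    (hj' : j + 1 ∈ L) : record k γ L j < record k γ L (j + 1) := by
  have hne := zmod_add_one_ne hk j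
  obtain ⟨l1, l2, rfl⟩ := List.append_of_mem hj
  obtain ⟨h1, h2, h3⟩ := List.pairwise_append.1 hL
  have h4 : j + 1 ∈ l2 := by
    rw [List.mem_append, List.mem_cons] at hj'
    rcases hj' with h | h | h
    · exact absurd rfl (h3 _ h j (by simp)).2
    · exact absurd h hne
    · exact h
  obtain ⟨l3, l4, rfl⟩ := List.append_of_mem h4
  obtain ⟨h5, h6⟩ := List.pairwise_cons.1 h2
  obtain ⟨h7, h8, h9⟩ := List.pairwise_append.1 h6
  have n1 : j ∉ l3 := fun h => (h5 j (by simp [h])).1 rfl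
  have n2 : j ∉ l4 := fun h => (h5 j (by simp [h])).1 rfl
  have n3 : j + 1 ∉ l3 := fun h => (h9 _ h (j + 1) (by simp)).1 rfl
  have n4 : j + 1 ∉ l4 := fun h => ((List.pairwise_cons.1 h8).1 _ h).1 rfl
  have n5 : j ∉ l3 ++ (j + 1) :: l4 := by
    rw [List.mem_append, List.mem_cons]
    rintro (h | h | h)
    exacts [n1 h, hne h.symm, n2 h]
  have e1 : record k γ (l1 ++ j :: (l3 ++ (j + 1) :: l4)) j =
      key k (addCorners k j (addPath k γ l1)) j := by
    rw [record, List.foldl_append, List.foldl_cons, foldl_recordStep_of_notMem _ n5,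
      recordStep_self, (foldl_recordStep _ _).1]
  have e2 : record k γ (l1 ++ j :: (l3 ++ (j + 1) :: l4)) (j + 1) =
      key k (addCorners k (j + 1) (addPath k (addCorners k j (addPath k γ l1)) l3)) (j + 1) := by
    rw [record, List.foldl_append, List.foldl_cons, List.foldl_append, List.foldl_cons,
      foldl_recordStep_of_notMem _ n4, recordStep_self, (foldl_recordStep _ _).1,
      recordStep, (foldl_recordStep _ _).1]
  rw [e1, e2]
  have c1 := isCore_addCorners hk (isCore_addPath hk hγ l1) j
  have c2 := isCore_addPath hk c1 l3
  set γ1 := addCorners k j (addPath k γ l1)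
  have h10 := lev_key c1 j
  have h11 : (key k γ1 j : ZMod (k + 1)) = j := intCast_key j
  have h12 : ((key k γ1 j + 1 : ℤ) : ZMod (k + 1)) = j + 1 := by push_cast; rw [h11]
  have h13 := lev_addPath_of_notMem hk c1 (L := l3) (x := key k γ1 j) (by rwa [h11])
    (by rwa [h11])
  rw [key_eq (isCore_addCorners hk c2 _) h12, lev_addCorners hk c2, raise, if_pos h12,
    add_sub_cancel_right, h13, h10]
  have : 0 ≤ (max (lev k (addPath k γ1 l3) (key k γ1 j + 1)) 1 - 1) * ((k : ℤ) + 1) :=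
    mul_nonneg (by simp) (by omega)
  omega

/-- The lowest cells along the path have increasing contents. -/
def SortedPath (k : ℕ) (γ : YoungDiagram) (L : List (ZMod (k + 1))) : Prop :=
  (keyList k γ L).Pairwise (· < ·)

/-- Sort the letters by their recorded contents. These are distinct because they have distinct
residues, and `record_lt_record` keeps adjacent letters in the required order, so the records
survive the sorting. -/
theorem exists_sortedPath (hk : 0 < k) {γ : YoungDiagram} (hγ : IsCore (k + 1) γ)
    {L : List (ZMod (k + 1))} (hL : CycInc L) :
    ∃ L', L.Perm L' ∧ CycInc L' ∧ SortedPath k γ L' := by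
  classical
  let r : ZMod (k + 1) → ZMod (k + 1) → Prop := fun a b => record k γ L a ≤ record k γ L b
  have : Std.Total r := ⟨fun a b => le_total _ _⟩
  have : IsTrans _ r := ⟨fun a b c => le_trans⟩
  have hp := List.perm_insertionSort r L
  have hs := List.pairwise_insertionSort r L
  have hn := hp.nodup_iff.2 hL.nodup
  have hlt : (L.insertionSort r).Pairwise fun a b => a ≠ b ∧ record k γ L a < record k γ L b := by
    refine List.Pairwise.imp_of_mem ?_ (hs.and hn)
    rintro a b ha hb ⟨h1, h2⟩
    refine ⟨h2, lt_of_le_of_ne h1 fun h3 => h2 ?_⟩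
    rw [← record_intCast (γ := γ) hL.nodup (hp.subset ha), h3,
      record_intCast hL.nodup (hp.subset hb)]
  have hc : CycInc (L.insertionSort r) := by
    refine List.Pairwise.imp_of_mem ?_ hlt
    rintro a b ha hb ⟨h1, h2⟩
    refine ⟨h1, ?_⟩
    rintro rfl
    exact lt_asymm h2 (record_lt_record hk hγ hL (hp.subset hb) (hp.subset ha))
  refine ⟨L.insertionSort r, hp.symm, hc, ?_⟩
  rw [SortedPath, ← map_record γ hn, ← (path_eq_of_perm hk hγ hp.symm hL hc).2.2,
    List.pairwise_map]
  exact hlt.imp fun h => h.2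

theorem eq_of_sortedPath (hk : 0 < k) {γ : YoungDiagram} (hγ : IsCore (k + 1) γ)
    {L L' : List (ZMod (k + 1))} (hp : L.Perm L') (hL : CycInc L) (hL' : CycInc L')
    (hs : SortedPath k γ L) (hs' : SortedPath k γ L') : L = L' := by
  rw [SortedPath, ← map_record γ hL.nodup, List.pairwise_map] at hs
  rw [SortedPath, ← map_record γ hL'.nodup, List.pairwise_map,
    ← (path_eq_of_perm hk hγ hp hL hL').2.2] at hs'
  exact hp.eq_of_pairwise (fun a b _ _ h1 h2 => absurd h2 (lt_asymm h1)) hs hs'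

theorem heckeMul_eq_iff (hk : 0 < k) {γ δ : YoungDiagram} (hγ : IsCore (k + 1) γ)
    (hδ : IsCore (k + 1) δ) {u w : AffinePerm k} {m m' : ℕ} (hu : IsRep k γ u m)
    (hw : IsRep k δ w m') {L : List (ZMod (k + 1))} (hL : CycInc L) :
    heckeMul k ((cox k).wordProd L.reverse) u = w ↔ ValidPath k γ L ∧ addPath k γ L = δ := by
  obtain ⟨h1, h2⟩ := reducedWord_spec ((cox k).wordProd L.reverse)
  rw [heckeMul_eq_heckePath, heckePath_eq_iff hk hγ hδ hu hw]
  have hp := perm_of_wordProd_eq hk (List.nodup_reverse.2 hL.nodup) h1 h2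
  have hp' : L.Perm (reducedWord k ((cox k).wordProd L.reverse)).reverse :=
    (List.reverse_perm L).symm.trans (hp.trans (List.reverse_perm _).symm)
  have hc := cycInc_of_wordProd_eq hk hL hp' (by rw [List.reverse_reverse, ← h2])
  obtain ⟨h3, h4, -⟩ := path_eq_of_perm hk hγ hp' hL hc
  rw [h3, h4]

theorem exists_isRep_of_heckeMul (hk : 0 < k) {γ : YoungDiagram} (hγ : IsCore (k + 1) γ)
    {u v : AffinePerm k} {m : ℕ} (h : IsRep k γ (heckeMul k v u) m) :
    ∃ δ m', IsCore (k + 1) δ ∧ IsRep k δ u m' := by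
  rw [heckeMul_eq_heckePath] at h
  exact exists_isRep_of_heckePath hk hγ h

end

section
variable {k : ℕ}

/-! ### Corners and letters -/

theorem residue_right (c : ℕ × ℕ) : residue k (c.1, c.2 + 1) = residue k c + 1 := by
  simp only [residue]
  push_cast
  ring

theorem residue_up (c : ℕ × ℕ) : residue k (c.1 + 1, c.2) = residue k c - 1 := by
  simp only [residue]
  push_cast
  ring

theorem residue_eq_intCast (c : ℕ × ℕ) :
    residue k c = (((c.2 : ℤ) - c.1 : ℤ) : ZMod (k + 1)) := residue_eq k c.1 c.2

theorem IsAddable.isRemovable (hk : 0 < k) {γ : YoungDiagram} {c : ℕ × ℕ} (h : IsAddable γ c) :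
    IsRemovable (addCorners k (residue k c) γ) c := by
  have h1 := zmod_one_ne_zero hk
  simp only [IsRemovable, mem_addCorners]
  refine ⟨Or.inr ⟨h, trivial⟩, ?_, ?_⟩
  · rintro (h' | ⟨-, h'⟩)
    · exact h.1 (γ.up_left_mem le_rfl (Nat.le_succ _) h')
    · rw [residue_right] at h'
      exact h1 (by linear_combination h')
  · rintro (h' | ⟨-, h'⟩)
    · exact h.1 (γ.up_left_mem (Nat.le_succ _) le_rfl h')
    · rw [residue_up] at h'
      exact h1 (by linear_combination -h')

theorem le_addCorners (i : ZMod (k + 1)) (γ : YoungDiagram) : γ ≤ addCorners k i γ :=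
  fun _ hc => (mem_addCorners ..).2 (Or.inl hc)

theorem le_addPath (γ : YoungDiagram) (L : List (ZMod (k + 1))) : γ ≤ addPath k γ L := by
  induction L generalizing γ with
  | nil => exact le_rfl
  | cons i L ih => exact (le_addCorners i γ).trans (ih _)

theorem addPath_take_mono (γ : YoungDiagram) (L : List (ZMod (k + 1))) {p q : ℕ} (h : p ≤ q) :
    addPath k γ (L.take p) ≤ addPath k γ (L.take q) := by
  obtain ⟨d, rfl⟩ := Nat.exists_eq_add_of_le h
  rw [List.take_add, addPath_append]
  exact le_addPath _ _

theorem addPath_take_succ (γ : YoungDiagram) {L : List (ZMod (k + 1))} {p : ℕ}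
    (hp : p < L.length) :
    addPath k γ (L.take (p + 1)) = addCorners k L[p] (addPath k γ (L.take p)) := by
  rw [List.take_succ_eq_append_getElem hp, addPath_append]
  rfl

theorem ValidPath.jump_ne_zero {γ : YoungDiagram} {L : List (ZMod (k + 1))} (h : ValidPath k γ L)
    {p : ℕ} (hp : p < L.length) : jump k (addPath k γ (L.take p)) L[p] ≠ 0 := by
  rw [← List.take_append_drop p L, validPath_append, List.drop_eq_getElem_cons hp] at h
  exact h.2.1

theorem ValidPath.jump_pos (hk : 0 < k) {γ : YoungDiagram} (hγ : IsCore (k + 1) γ)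
    {L : List (ZMod (k + 1))} (h : ValidPath k γ L) {p : ℕ} (hp : p < L.length) :
    0 < jump k (addPath k γ (L.take (p + 1))) L[p] := by
  rw [addPath_take_succ γ hp, jump_addCorners_self hk (isCore_addPath hk hγ _), abs_pos]
  exact h.jump_ne_zero hp

/-- The cells that contain the letter of step `p` of the path `L` from `γ`. -/
def StepCell (k : ℕ) (γ : YoungDiagram) (L : List (ZMod (k + 1))) (p : ℕ) (c : ℕ × ℕ) : Prop :=
  IsRemovable (addPath k γ (L.take (p + 1))) c ∧ L[p]? = some (residue k c)

theorem StepCell.lt_length {γ : YoungDiagram} {L : List (ZMod (k + 1))} {p : ℕ} {c : ℕ × ℕ}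
    (h : StepCell k γ L p c) : p < L.length := (List.getElem?_eq_some_iff.1 h.2).1

theorem StepCell.residue_eq {γ : YoungDiagram} {L : List (ZMod (k + 1))} {p : ℕ} {c : ℕ × ℕ}
    (h : StepCell k γ L p c) : residue k c = L[p]'h.lt_length :=
  (List.getElem?_eq_some_iff.1 h.2).2.symm

theorem stepCell_iff {γ : YoungDiagram} {L : List (ZMod (k + 1))} {p : ℕ} (hp : p < L.length)
    {c : ℕ × ℕ} : StepCell k γ L p c ↔
      IsRemovable (addPath k γ (L.take (p + 1))) c ∧ residue k c = L[p] := by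
  rw [StepCell, List.getElem?_eq_getElem hp, Option.some_inj, eq_comm (a := L[p])]

theorem stepCell_append (γ : YoungDiagram) (A L B : List (ZMod (k + 1))) {p : ℕ}
    (hp : p < L.length) (c : ℕ × ℕ) :
    StepCell k γ (A ++ L ++ B) (A.length + p) c ↔ StepCell k (addPath k γ A) L p c := by
  have h1 : (A ++ L ++ B).take (A.length + p + 1) = A ++ L.take (p + 1) := by
    rw [List.append_assoc, add_assoc, List.take_length_add_append,
      List.take_append_of_le_length (by omega)]
  rw [StepCell, StepCell, h1, addPath_append, List.append_assoc,
    List.getElem?_append_right (by omega), Nat.add_sub_cancel_left, List.getElem?_append_left hp]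

/-- A cell carries the letter of the step at which it appears, since a freshly added corner is
removable. -/
theorem exists_stepCell_of_mem (hk : 0 < k) {γ : YoungDiagram} {L : List (ZMod (k + 1))}
    {p q : ℕ} (hq : q ≤ L.length) {c : ℕ × ℕ} (h : c ∈ addPath k γ (L.take q))
    (h' : c ∉ addPath k γ (L.take p)) : ∃ t, p ≤ t ∧ t < q ∧ StepCell k γ L t c := by
  induction q with
  | zero => exact absurd (addPath_take_mono γ L (Nat.zero_le p) h) h'
  | succ q ih =>
    by_cases h1 : c ∈ addPath k γ (L.take q)
    · obtain ⟨t, h2, h3, h4⟩ := ih (by omega) h1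
      exact ⟨t, h2, by omega, h4⟩
    · have hpq : p ≤ q := by
        by_contra h2
        exact h' (addPath_take_mono γ L (by omega) h)
      refine ⟨q, hpq, by omega, (stepCell_iff hq).2 ?_⟩
      rw [addPath_take_succ γ hq, mem_addCorners] at h
      obtain ⟨h2, h3⟩ := h.resolve_left h1
      rw [addPath_take_succ γ hq, ← h3]
      exact ⟨h2.isRemovable hk, rfl⟩

theorem StepCell.mem {γ : YoungDiagram} {L : List (ZMod (k + 1))} {p q : ℕ} {c : ℕ × ℕ}
    (h : StepCell k γ L p c) (hpq : p < q) : c ∈ addPath k γ (L.take q) :=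
  addPath_take_mono γ L hpq h.1.1

/-! ### The standard tableau of a word -/

open Classical in
/-- The standard filling whose letter `p + 1` occupies the removable corners of residue `R[p]`
after step `p`. -/
noncomputable def tabOf (k : ℕ) (R : List (ZMod (k + 1))) (c : ℕ × ℕ) : Finset ℕ :=
  ((Finset.range R.length).filter fun p => StepCell k ⊥ R p c).image (· + 1)

theorem succ_mem_tabOf {R : List (ZMod (k + 1))} {c : ℕ × ℕ} {p : ℕ} :
    p + 1 ∈ tabOf k R c ↔ StepCell k ⊥ R p c := by
  simp only [tabOf, Finset.mem_image, Finset.mem_filter, Finset.mem_range, add_left_inj,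
    exists_eq_right, and_iff_right_iff_imp]
  exact StepCell.lt_length

theorem mem_tabOf {R : List (ZMod (k + 1))} {c : ℕ × ℕ} {a : ℕ} :
    a ∈ tabOf k R c ↔ ∃ p, a = p + 1 ∧ StepCell k ⊥ R p c := by
  rcases a with _ | p
  · simp [tabOf]
  · rw [succ_mem_tabOf]
    simp

theorem exists_stepCell (hk : 0 < k) {γ : YoungDiagram} (hγ : IsCore (k + 1) γ)
    {L : List (ZMod (k + 1))} (h : ValidPath k γ L) {p : ℕ} (hp : p < L.length) :
    ∃ c, StepCell k γ L p c := by
  obtain ⟨c, h1, h2⟩ := (exists_isRemovable_iff (isCore_addPath hk hγ _) _).2 (h.jump_pos hk hγ hp)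
  exact ⟨c, (stepCell_iff hp).2 ⟨h1, h2⟩⟩

theorem mem_addPath_take_iff (hk : 0 < k) {R : List (ZMod (k + 1))} {x : ℕ} (hx : x ≤ R.length)
    (c : ℕ × ℕ) : c ∈ addPath k ⊥ (R.take x) ↔ ∃ a ∈ tabOf k R c, a ≤ x := by
  constructor
  · intro h
    obtain ⟨t, -, h1, h2⟩ := exists_stepCell_of_mem hk (p := 0) hx h (YoungDiagram.notMem_bot c)
    exact ⟨t + 1, succ_mem_tabOf.2 h2, h1⟩
  · rintro ⟨a, ha, hax⟩
    obtain ⟨p, rfl, h⟩ := mem_tabOf.1 ha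
    exact h.mem (by omega)

theorem isStandard_tabOf (hk : 0 < k) {R : List (ZMod (k + 1))} (hR : ValidPath k ⊥ R) :
    IsStandard k (addPath k ⊥ R) R.length (tabOf k R) := by
  refine ⟨fun c => ?_, fun c a ha => ?_, fun x hx hx' => ?_⟩
  · have := mem_addPath_take_iff hk (le_refl R.length) c
    rw [List.take_length] at this
    rw [this]
    constructor
    · rintro ⟨a, ha⟩
      obtain ⟨p, rfl, h⟩ := mem_tabOf.1 ha
      exact ⟨_, ha, h.lt_length⟩
    · rintro ⟨a, ha, -⟩
      exact ⟨a, ha⟩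
  · obtain ⟨p, rfl, h⟩ := mem_tabOf.1 ha
    have := h.lt_length
    omega
  · obtain ⟨p, rfl⟩ : ∃ p, x = p + 1 := ⟨x - 1, by omega⟩
    refine ⟨addPath k ⊥ (R.take (p + 1)), mem_addPath_take_iff hk hx',
      isCore_addPath hk (isCore_bot _) _, R[p], ?_, fun c => ?_⟩
    · obtain ⟨c, hc⟩ := exists_stepCell hk (isCore_bot _) hR (p := p) hx'
      exact ⟨c, succ_mem_tabOf.2 hc⟩
    · rw [succ_mem_tabOf, stepCell_iff]

/-- The new cells are removable in `μ`, hence addable in `ν`. No addable corner of residue `i` is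
missed: it would still be addable in `μ`, where the jump at `i` is already positive. -/
theorem eq_addCorners (hk : 0 < k) {μ ν : YoungDiagram} (hμ : IsCore (k + 1) μ)
    (hν : IsCore (k + 1) ν) (hle : ν ≤ μ) {i : ZMod (k + 1)}
    (hne : ∃ c, IsRemovable μ c ∧ residue k c = i)
    (hnew : ∀ c ∈ μ, c ∉ ν → IsRemovable μ c ∧ residue k c = i) :
    μ = addCorners k i ν ∧ jump k ν i ≠ 0 := by
  have hpos := (exists_isRemovable_iff hμ i).1 hne
  have heq : μ = addCorners k i ν := by
    ext c
    rw [YoungDiagram.mem_cells, YoungDiagram.mem_cells, mem_addCorners]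
    constructor
    · intro hc
      by_cases hc' : c ∈ ν
      · exact Or.inl hc'
      · have h1 := hnew c hc hc'
        refine Or.inr ⟨⟨hc', fun r hr => ?_, fun j hj => ?_⟩, h1.2⟩
        · by_contra h2
          have h3 : (r, c.2) ∈ μ := μ.up_left_mem (by omega) le_rfl hc
          refine (hnew _ h3 h2).1.2.2 ?_
          simp only
          rwa [← hr]
        · by_contra h2
          have h3 : (c.1, j) ∈ μ := μ.up_left_mem le_rfl (by omega) hc
          refine (hnew _ h3 h2).1.2.1 ?_
          simp only
          rwa [← hj]
    · rintro (hc | ⟨hc, hr⟩)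
      · exact hle hc
      · by_contra hc'
        have h1 : IsAddable μ c :=
          ⟨hc', fun r h => hle (hc.2.1 r h), fun j h => hle (hc.2.2 j h)⟩
        have h2 := h1.jump_neg hμ
        rw [hr] at h2
        omega
  refine ⟨heq, fun h => ?_⟩
  rw [heq, jump_addCorners_self hk hν, h] at hpos
  simp at hpos

theorem exists_word_of_isStandard (hk : 0 < k) {γ : YoungDiagram} {n : ℕ} {T : ℕ × ℕ → Finset ℕ}
    (hT : IsStandard k γ n T) :
    ∃ R : List (ZMod (k + 1)), R.length = n ∧ ValidPath k ⊥ R ∧ addPath k ⊥ R = γ ∧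
      tabOf k R = T := by
  obtain ⟨h1, h2, h3⟩ := hT
  have key : ∀ x ≤ n, ∃ R : List (ZMod (k + 1)), R.length = x ∧ ValidPath k ⊥ R ∧
      (∀ c, c ∈ addPath k ⊥ R ↔ ∃ a ∈ T c, a ≤ x) ∧
      ∀ c, ∀ p < x, p + 1 ∈ T c ↔ StepCell k ⊥ R p c := by
    intro x
    induction x with
    | zero =>
      refine fun _ => ⟨[], rfl, trivial, fun c => ?_, fun c p hp => by omega⟩
      refine iff_of_false (YoungDiagram.notMem_bot c) ?_
      rintro ⟨a, ha, ha'⟩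
      have := h2 c a ha
      omega
    | succ x ih =>
      intro hx
      obtain ⟨R, hl, hv, hc, hs⟩ := ih (by omega)
      obtain ⟨μ, hμ, hcore, i, hne, hi⟩ := h3 (x + 1) (by omega) hx
      obtain ⟨heq, hj⟩ := eq_addCorners hk (ν := addPath k ⊥ R) (i := i) hcore
        (isCore_addPath hk (isCore_bot _) R)
        (fun c h => (hμ c).2 (by
          obtain ⟨a, ha, ha'⟩ := (hc c).1 h
          exact ⟨a, ha, by omega⟩))
        (by
          obtain ⟨c, h⟩ := hne
          exact ⟨c, (hi c).1 h⟩)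
        (fun c h h' => by
          obtain ⟨a, ha, ha'⟩ := (hμ c).1 h
          rcases ha'.lt_or_eq with h4 | h4
          · exact absurd ((hc c).2 ⟨a, ha, by omega⟩) h'
          · rw [h4] at ha
            exact (hi c).1 ha)
      have hadd : addPath k ⊥ (R ++ [i]) = μ := by
        rw [addPath_append, heq]
        rfl
      refine ⟨R ++ [i], by simp [hl], ?_, fun c => by rw [hadd, hμ], fun c p hp => ?_⟩
      · rw [validPath_append]
        exact ⟨hv, hj, trivial⟩
      · rcases (Nat.lt_succ_iff.1 hp).lt_or_eq with h4 | rfl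
        · rw [hs c p h4]
          have := stepCell_append ⊥ [] R [i] (hl ▸ h4 : p < R.length) c
          simp only [List.nil_append, List.length_nil, zero_add] at this
          rw [this]
          rfl
        · rw [hi, stepCell_iff (by simp [hl])]
          rw [List.take_of_length_le (by simp [hl]), hadd]
          simp [← hl]
  obtain ⟨R, hl, hv, hc, hs⟩ := key n le_rfl
  refine ⟨R, hl, hv, ?_, ?_⟩
  · ext c
    rw [YoungDiagram.mem_cells, YoungDiagram.mem_cells, hc, ← h1]
    exact ⟨fun ⟨a, ha, _⟩ => ⟨a, ha⟩, fun ⟨a, ha⟩ => ⟨a, ha, (h2 c a ha).2⟩⟩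
  · funext c
    ext a
    rw [mem_tabOf]
    constructor
    · rintro ⟨p, rfl, hp⟩
      exact (hs c p (hl ▸ hp.lt_length)).2 hp
    · intro ha
      have := h2 c a ha
      exact ⟨a - 1, by omega, (hs c (a - 1) (by omega)).1 (by rwa [Nat.sub_add_cancel this.1])⟩

/-- Validity makes every letter occur somewhere, and the residue of any of its cells is the
corresponding entry of the word. -/
theorem tabOf_injOn (hk : 0 < k) {R R' : List (ZMod (k + 1))} (hR : ValidPath k ⊥ R)
    (hl : R.length = R'.length) (h : tabOf k R = tabOf k R') : R = R' := by
  refine List.ext_getElem hl fun p hp hp' => ?_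
  obtain ⟨c, hc⟩ := exists_stepCell hk (isCore_bot _) hR hp
  have h1 := succ_mem_tabOf.2 hc
  rw [h, succ_mem_tabOf] at h1
  rw [← hc.residue_eq, h1.residue_eq]

/-! ### The conditions on a block of letters -/

theorem IsRemovable.rowPos_eq {γ : YoungDiagram} {c : ℕ × ℕ} (h : IsRemovable γ c) :
    rowPos γ c.1 = (c.2 : ℤ) - c.1 := by
  have := (isRemovable_iff.1 h).1
  simp only [rowPos]
  omega

/-- Among removable corners lower means larger content, so the lowest occurrence of a letter is the
corner whose content is `key`. -/
theorem IsRemovable.row_le_iff {γ : YoungDiagram} {c d : ℕ × ℕ} (hc : IsRemovable γ c)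
    (hd : IsRemovable γ d) : c.1 ≤ d.1 ↔ (d.2 : ℤ) - d.1 ≤ (c.2 : ℤ) - c.1 := by
  rw [← hc.rowPos_eq, ← hd.rowPos_eq, (rowPos_strictAnti γ).le_iff_ge]

theorem length_keyList (γ : YoungDiagram) (L : List (ZMod (k + 1))) :
    (keyList k γ L).length = L.length := by
  induction L generalizing γ with
  | nil => rfl
  | cons i L ih => rw [keyList, List.length_cons, List.length_cons, ih]

theorem getElem_keyList (γ : YoungDiagram) (L : List (ZMod (k + 1))) {p : ℕ} (hp : p < L.length) :
    (keyList k γ L)[p]'(by rwa [length_keyList]) =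
      key k (addPath k γ (L.take (p + 1))) L[p] := by
  induction L generalizing γ p with
  | nil => exact absurd hp (by simp)
  | cons i L ih =>
    rcases p with _ | p
    · simp [keyList, addPath]
    · simp only [keyList, List.getElem_cons_succ, List.take_succ_cons, addPath_cons]
      exact ih _ (by simpa using hp)

theorem sortedPath_iff {γ : YoungDiagram} {L : List (ZMod (k + 1))} :
    SortedPath k γ L ↔ ∀ p q (hp : p < L.length) (hq : q < L.length), p < q →
      key k (addPath k γ (L.take (p + 1))) L[p] < key k (addPath k γ (L.take (q + 1))) L[q] := by
  rw [SortedPath, List.pairwise_iff_getElem]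
  constructor
  · intro h p q hp hq hpq
    have := h p q (by rwa [length_keyList]) (by rwa [length_keyList]) hpq
    rwa [getElem_keyList _ _ hp, getElem_keyList _ _ hq] at this
  · intro h p q hp hq hpq
    rw [length_keyList] at hp hq
    rw [getElem_keyList _ _ hp, getElem_keyList _ _ hq]
    exact h p q hp hq hpq

theorem StepCell.content_le_key (hk : 0 < k) {γ : YoungDiagram} (hγ : IsCore (k + 1) γ)
    {L : List (ZMod (k + 1))} {p : ℕ} {c : ℕ × ℕ} (h : StepCell k γ L p c) :
    (c.2 : ℤ) - c.1 ≤ key k (addPath k γ (L.take (p + 1))) (L[p]'h.lt_length) := by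
  have hcore := isCore_addPath hk hγ (L.take (p + 1))
  have h1 := h.residue_eq
  rw [residue_eq_intCast] at h1
  have h2 := (mem_maya_iff hcore _).1 h.1.mem_maya.1
  rw [key_eq hcore h1]
  have := mul_nonneg (by omega : 0 ≤ lev k (addPath k γ (L.take (p + 1))) ((c.2 : ℤ) - c.1) - 1)
    (by omega : 0 ≤ (k : ℤ) + 1)
  omega

theorem exists_stepCell_key (hk : 0 < k) {γ : YoungDiagram} (hγ : IsCore (k + 1) γ)
    {L : List (ZMod (k + 1))} (h : ValidPath k γ L) {p : ℕ} (hp : p < L.length) :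
    ∃ c, StepCell k γ L p c ∧ (c.2 : ℤ) - c.1 = key k (addPath k γ (L.take (p + 1))) L[p] := by
  have hcore := isCore_addPath hk hγ (L.take (p + 1))
  have h1 := h.jump_pos hk hγ hp
  have h2 := lev_key hcore L[p]
  rw [jump_eq hcore (intCast_key (γ := addPath k γ (L.take (p + 1))) L[p])] at h1
  obtain ⟨c, h3, h4⟩ := exists_isRemovable_of_mem_maya
    ((mem_maya_iff hcore (key k (addPath k γ (L.take (p + 1))) L[p])).2 (by omega))
    (fun h' => by
      have := (mem_maya_iff hcore _).1 h'
      omega)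
  refine ⟨c, (stepCell_iff hp).2 ⟨h3, ?_⟩, h4⟩
  rw [residue_eq_intCast, h4, intCast_key]

theorem isLowestOccurrence_iff (hk : 0 < k) {γ : YoungDiagram} (hγ : IsCore (k + 1) γ)
    {L : List (ZMod (k + 1))} (h : ValidPath k γ L) {p : ℕ} (hp : p < L.length)
    {T : ℕ × ℕ → Finset ℕ} {a : ℕ} (hT : ∀ c, a ∈ T c ↔ StepCell k γ L p c) (c : ℕ × ℕ) :
    IsLowestOccurrence T a c ↔ StepCell k γ L p c ∧
      (c.2 : ℤ) - c.1 = key k (addPath k γ (L.take (p + 1))) L[p] := by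
  simp only [IsLowestOccurrence, hT]
  refine and_congr_right fun hc => ⟨fun h1 => ?_, fun h1 d hd => ?_⟩
  · obtain ⟨d, hd, hd'⟩ := exists_stepCell_key hk hγ h hp
    refine le_antisymm (hc.content_le_key hk hγ) ?_
    rw [← hd', ← hc.1.row_le_iff hd.1]
    exact h1 d hd
  · rw [hc.1.row_le_iff hd.1, h1]
    exact hd.content_le_key hk hγ

/-- The three conditions on the cells that contain the letters of `A`, with `n` residues. -/
def BlockCondition (k : ℕ) (T : ℕ × ℕ → Finset ℕ) (A : Finset ℕ) (n : ℕ) : Prop :=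
  LowestReadingWordIncreasing T A ∧ (residue k '' occupied T A).ncard = n ∧
    IsHorizontalStrip (occupied T A)

section
variable {γ : YoungDiagram} {L : List (ZMod (k + 1))} {T : ℕ × ℕ → Finset ℕ} {o : ℕ}

/-- Here `o` counts the letters used before the block; steps are numbered from `0` and letters from
`1`. -/
theorem mem_occupied_iff (hT : ∀ p < L.length, ∀ c, o + p + 1 ∈ T c ↔ StepCell k γ L p c)
    (c : ℕ × ℕ) : c ∈ occupied T (Finset.Icc (1 + o) (o + L.length)) ↔
      ∃ p, StepCell k γ L p c := by
  simp only [occupied, Set.mem_ofPred_eq, Finset.mem_Icc]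
  constructor
  · rintro ⟨a, ⟨h1, h2⟩, h3⟩
    refine ⟨a - o - 1, (hT _ (by omega) c).1 ?_⟩
    rwa [show o + (a - o - 1) + 1 = a by omega]
  · rintro ⟨p, hp⟩
    have := hp.lt_length
    exact ⟨o + p + 1, by omega, (hT p this c).2 hp⟩

theorem ncard_residue_eq_iff (hk : 0 < k) (hγ : IsCore (k + 1) γ) (hv : ValidPath k γ L)
    (hT : ∀ p < L.length, ∀ c, o + p + 1 ∈ T c ↔ StepCell k γ L p c) :
    (residue k '' occupied T (Finset.Icc (1 + o) (o + L.length))).ncard = L.length ↔ L.Nodup := by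
  classical
  have : residue k '' occupied T (Finset.Icc (1 + o) (o + L.length)) = (L.toFinset : Set _) := by
    ext i
    simp only [Set.mem_image, mem_occupied_iff hT, List.coe_toFinset, Set.mem_ofPred_eq]
    constructor
    · rintro ⟨c, ⟨p, hp⟩, rfl⟩
      rw [hp.residue_eq]
      exact List.getElem_mem _
    · intro hi
      obtain ⟨p, hp, rfl⟩ := List.getElem_of_mem hi
      obtain ⟨c, hc⟩ := exists_stepCell hk hγ hv hp
      exact ⟨c, ⟨p, hc⟩, hc.residue_eq⟩
  rw [this, Set.ncard_coe_finset, List.card_toFinset]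
  constructor
  · intro h
    rw [← List.Sublist.eq_of_length (List.dedup_sublist L) h]
    exact List.nodup_dedup L
  · intro h
    rw [h.dedup]

/-- If `c` were higher than `d` without being strictly to its left, the cell in the row of `c` and
the column of `d` would belong to the strip too, giving that column two cells. -/
theorem IsHorizontalStrip.content_lt {S : Set (ℕ × ℕ)} (hS : IsHorizontalStrip S) {c d : ℕ × ℕ}
    (hc : c ∈ S) (hd : d ∈ S) (h : d.1 < c.1 ∨ c.1 = d.1 ∧ c.2 < d.2) :
    (c.2 : ℤ) - c.1 < (d.2 : ℤ) - d.1 := by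
  obtain ⟨⟨γ, ρ, hle, h1⟩, h2⟩ := hS
  rcases h with h | h
  · have : c.2 < d.2 := by
      by_contra h3
      have h4 : (c.1, d.2) ∈ S := by
        rw [h1] at hc hd ⊢
        refine ⟨γ.up_left_mem le_rfl (not_lt.1 h3) hc.1, fun h5 => hd.2 ?_⟩
        exact ρ.up_left_mem h.le le_rfl h5
      have h5 := congrArg Prod.fst (h2 _ hd _ h4 rfl)
      simp only at h5
      omega
    omega
  · omega

theorem sortedPath_of_blockCondition (hk : 0 < k) (hγ : IsCore (k + 1) γ) (hv : ValidPath k γ L)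
    (hT : ∀ p < L.length, ∀ c, o + p + 1 ∈ T c ↔ StepCell k γ L p c)
    (h : BlockCondition k T (Finset.Icc (1 + o) (o + L.length)) L.length) :
    SortedPath k γ L := by
  obtain ⟨h1, h2, h3⟩ := h
  rw [ncard_residue_eq_iff hk hγ hv hT] at h2
  rw [sortedPath_iff]
  intro p q hp hq hpq
  obtain ⟨c, hc, hc'⟩ := exists_stepCell_key hk hγ hv hp
  obtain ⟨d, hd, hd'⟩ := exists_stepCell_key hk hγ hv hq
  have h4 := h1 (o + p + 1) (Finset.mem_Icc.2 (by omega)) (o + q + 1) (Finset.mem_Icc.2 (by omega))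
    (by omega) c d ((isLowestOccurrence_iff hk hγ hv hp (hT p hp) c).2 ⟨hc, hc'⟩)
    ((isLowestOccurrence_iff hk hγ hv hq (hT q hq) d).2 ⟨hd, hd'⟩)
  rw [← hc', ← hd']
  refine h3.content_lt ((mem_occupied_iff hT c).2 ⟨p, hc⟩) ((mem_occupied_iff hT d).2 ⟨q, hd⟩) ?_
  rcases h4 with h4 | ⟨h4, h5 | ⟨h5, -⟩⟩
  · exact Or.inl h4
  · exact Or.inr ⟨h4, h5⟩
  · have h6 : c = d := Prod.ext h4 h5
    subst h6
    have := h2.getElem_inj_iff.1 (hc.residue_eq.symm.trans hd.residue_eq)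
    omega

/-- Suppose the letter of step `q` is one less than that of an earlier step `p`. The lowest corner
`c` of step `p` has content `t`, and the lowest content at step `q` is larger than `t`. Then step
`q` also has a corner of content `t - 1`; it lies above `c`, and forces the cell over `c` into the
block, against the strip condition. -/
theorem cycInc_of_blockCondition (hk : 0 < k) (hγ : IsCore (k + 1) γ) (hv : ValidPath k γ L)
    (hT : ∀ p < L.length, ∀ c, o + p + 1 ∈ T c ↔ StepCell k γ L p c)
    (h : BlockCondition k T (Finset.Icc (1 + o) (o + L.length)) L.length) :
    CycInc L := by
  have hs := sortedPath_iff.1 (sortedPath_of_blockCondition hk hγ hv hT h)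
  obtain ⟨-, h2, -, h3⟩ := h
  rw [ncard_residue_eq_iff hk hγ hv hT] at h2
  rw [CycInc, List.pairwise_iff_getElem]
  intro p q hp hq hpq
  have hne : L[p] ≠ L[q] := fun h => by
    have := h2.getElem_inj_iff.1 h
    omega
  refine ⟨hne, fun hadj => ?_⟩
  have hlt := hs p q hp hq hpq
  obtain ⟨c, hc, hc'⟩ := exists_stepCell_key hk hγ hv hp
  set t := key k (addPath k γ (L.take (p + 1))) L[p] with ht
  set t' := key k (addPath k γ (L.take (q + 1))) L[q] with ht'
  have cp := isCore_addPath hk hγ (L.take (p + 1))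
  have cq := isCore_addPath hk hγ (L.take q)
  have cq' := isCore_addPath hk hγ (L.take (q + 1))
  have rt : ((t : ℤ) : ZMod (k + 1)) = L[p] := intCast_key _
  have rt' : ((t' : ℤ) : ZMod (k + 1)) = L[q] := intCast_key _
  have rt1 : ((t - 1 : ℤ) : ZMod (k + 1)) = L[q] := by
    push_cast
    rw [rt, hadj]
    ring
  have l1 : lev k (addPath k γ (L.take (p + 1))) (t - 1) ≤ 0 := by
    by_contra h'
    refine hc.1.mem_maya.2 ((mem_maya_iff cp _).2 ?_)
    rw [hc']
    omega
  -- The steps strictly between `p` and `q` use neither of the two letters, so this level is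
  -- unchanged.
  have l2 : lev k (addPath k γ (L.take q)) (t - 1) ≤ 0 := by
    obtain ⟨d, hd⟩ := Nat.exists_eq_add_of_le (Nat.succ_le_of_lt hpq)
    have h4 : ∀ r (hr : r < L.length), L[r] ∈ (L.drop (p + 1)).take d → p < r ∧ r < q := by
      intro r hr h
      obtain ⟨s, hs, hs'⟩ := List.getElem_of_mem h
      rw [List.getElem_take, List.getElem_drop] at hs'
      have h5 := h2.getElem_inj_iff.1 hs'
      rw [List.length_take] at hs
      omega
    rw [hd, List.take_add, addPath_append, lev_addPath_of_notMem hk cp]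
    · exact l1
    · rw [rt1]
      exact fun h => by
        have := h4 q hq h
        omega
    · rw [rt1, ← hadj]
      exact fun h => by
        have := h4 p hp h
        omega
  -- `t - 1` lies on the runner of `t'`, strictly below it, and the level at `t'` is `1`.
  have l3 : 0 < lev k (addPath k γ (L.take (q + 1))) (t - 1) := by
    obtain ⟨m, hm⟩ := exists_mul_of_intCast_eq (rt1.trans rt'.symm)
    have h4 := lev_add_mul cq' (t - 1) m
    rw [← hm, ht', lev_key cq'] at h4
    have : 0 < m := by
      by_contra h'
      have := mul_nonneg (by omega : 0 ≤ -m) (by omega : 0 ≤ (k : ℤ) + 1)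
      rw [neg_mul] at this
      omega
    omega
  have l4 : lev k (addPath k γ (L.take (q + 1))) (t - 1 - 1) ≤ 0 := by
    have r1 : ((t - 1 - 1 : ℤ) : ZMod (k + 1)) + 1 = L[q] := by
      push_cast
      push_cast at rt1
      rw [rt1]
      ring
    rw [addPath_take_succ γ hq, lev_addCorners hk cq, raise, if_neg, if_pos r1, sub_add_cancel]
    · exact (min_le_right _ _).trans l2
    · rw [← r1]
      exact (zmod_add_one_ne hk _).symm
  obtain ⟨e, he, he'⟩ := exists_isRemovable_of_mem_maya ((mem_maya_iff cq' _).2 l3)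
    (fun h' => by
      have := (mem_maya_iff cq' _).1 h'
      omega)
  -- Otherwise the right neighbour of `e`, on the diagonal of `c` and weakly below it, would lie in
  -- the diagram, and `e` would not be removable.
  have h5 : c.1 + 1 ≤ e.1 := by
    by_contra h6
    refine he.2.1 ((addPath k γ (L.take (q + 1))).up_left_mem ?_ ?_ (hc.mem (by omega : p < q + 1)))
    · omega
    · omega
  have h6 : (c.1 + 1, c.2) ∈ addPath k γ (L.take (q + 1)) :=
    (addPath k γ (L.take (q + 1))).up_left_mem h5 (by omega) he.1
  obtain ⟨s, -, -, h7⟩ := exists_stepCell_of_mem hk hq h6 hc.1.2.2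
  have h8 := congrArg Prod.fst (h3 c ((mem_occupied_iff hT c).2 ⟨p, hc⟩) _
    ((mem_occupied_iff hT _).2 ⟨s, h7⟩) rfl)
  simp at h8

/-- The cell above `c` would need a later letter one smaller than the letter of `c`, which `CycInc`
forbids. -/
theorem StepCell.up_notMem (hk : 0 < k) (hL : CycInc L) {p : ℕ} {c : ℕ × ℕ}
    (hc : StepCell k γ L p c) : (c.1 + 1, c.2) ∉ addPath k γ L := by
  intro h
  rw [← List.take_length (l := L)] at h
  obtain ⟨t, h1, h2, h3⟩ := exists_stepCell_of_mem hk le_rfl h hc.1.2.2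
  have h4 := (List.pairwise_iff_getElem.1 hL) p t hc.lt_length h2 h1
  rw [← hc.residue_eq, ← h3.residue_eq, residue_up] at h4
  exact h4.2 (by ring)

theorem blockCondition_of (hk : 0 < k) (hγ : IsCore (k + 1) γ) (hv : ValidPath k γ L)
    (hT : ∀ p < L.length, ∀ c, o + p + 1 ∈ T c ↔ StepCell k γ L p c)
    (hL : CycInc L) (hs : SortedPath k γ L) :
    BlockCondition k T (Finset.Icc (1 + o) (o + L.length)) L.length := by
  have hmem : ∀ {p c}, StepCell k γ L p c → c ∈ addPath k γ L := fun hc => by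
    have := hc.mem hc.lt_length
    rwa [List.take_length] at this
  refine ⟨?_, (ncard_residue_eq_iff hk hγ hv hT).2 hL.nodup, ?_, ?_⟩
  · intro a ha b hb hab c d hc hd
    rw [Finset.mem_Icc] at ha hb
    obtain ⟨p, rfl⟩ : ∃ p, a = o + p + 1 := ⟨a - o - 1, by omega⟩
    obtain ⟨q, rfl⟩ : ∃ q, b = o + q + 1 := ⟨b - o - 1, by omega⟩
    have hp : p < L.length := by omega
    have hq : q < L.length := by omega
    obtain ⟨hc1, hc2⟩ := (isLowestOccurrence_iff hk hγ hv hp (hT p hp) c).1 hc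
    obtain ⟨hd1, hd2⟩ := (isLowestOccurrence_iff hk hγ hv hq (hT q hq) d).1 hd
    have h1 := sortedPath_iff.1 hs p q hp hq (by omega)
    rw [← hc2, ← hd2] at h1
    -- If `c` were below `d`, its smaller content would put it strictly to the left, so the cell
    -- above `c` would be in the diagram.
    rcases lt_trichotomy c.1 d.1 with h2 | h2 | h2
    · exact absurd ((addPath k γ L).up_left_mem h2 (by omega) (hmem hd1)) (hc1.up_notMem hk hL)
    · exact Or.inr ⟨h2, Or.inl (by omega)⟩
    · exact Or.inl h2
  · classical
    -- The occupied cells are closed upwards in the final diagram, so removing them leaves a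
    -- partition: nothing lies above such a cell, and cells to its right were added after it was
    -- removable.
    have hup : ∀ c ∈ occupied T (Finset.Icc (1 + o) (o + L.length)), ∀ d ∈ addPath k γ L,
        c.1 ≤ d.1 → c.2 ≤ d.2 → d ∈ occupied T (Finset.Icc (1 + o) (o + L.length)) := by
      intro c hc d hd h1 h2
      rw [mem_occupied_iff hT] at hc ⊢
      obtain ⟨p, hc⟩ := hc
      have h3 : c.1 = d.1 := by
        by_contra h3
        exact hc.up_notMem hk hL ((addPath k γ L).up_left_mem (by omega) h2 hd)
      rcases h2.eq_or_lt with h4 | h4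
      · rw [← Prod.ext h3 h4]
        exact ⟨p, hc⟩
      · rw [← List.take_length (l := L)] at hd
        obtain ⟨t, -, -, h5⟩ := exists_stepCell_of_mem hk le_rfl hd (p := p + 1) fun h6 =>
          hc.1.2.1 ((addPath k γ (L.take (p + 1))).up_left_mem h3.le h4 h6)
        exact ⟨t, h5⟩
    obtain ⟨ρ, hρ⟩ : ∃ ρ : YoungDiagram, ∀ c, c ∈ ρ ↔ c ∈ addPath k γ L ∧
        c ∉ occupied T (Finset.Icc (1 + o) (o + L.length)) := by
      refine ⟨⟨(addPath k γ L).cells.filter fun c =>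
        c ∉ occupied T (Finset.Icc (1 + o) (o + L.length)), fun d c hcd hd => ?_⟩, fun c => ?_⟩
      · rw [Finset.mem_coe, Finset.mem_filter, YoungDiagram.mem_cells] at hd ⊢
        exact ⟨(addPath k γ L).up_left_mem hcd.1 hcd.2 hd.1,
          fun hc => hd.2 (hup c hc d hd.1 hcd.1 hcd.2)⟩
      · exact Finset.mem_filter
    refine ⟨addPath k γ L, ρ, fun c hc => ((hρ c).1 hc).1, fun c => ?_⟩
    rw [hρ]
    constructor
    · intro hc
      obtain ⟨p, hc'⟩ := (mem_occupied_iff hT c).1 hc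
      exact ⟨hmem hc', fun h => h.2 hc⟩
    · rintro ⟨h1, h2⟩
      by_contra h3
      exact h2 ⟨h1, h3⟩
  · have key : ∀ {p q : ℕ} {c d : ℕ × ℕ}, StepCell k γ L p c → StepCell k γ L q d → c.2 = d.2 →
        ¬ c.1 < d.1 := fun hc hd h h' =>
      hc.up_notMem hk hL ((addPath k γ L).up_left_mem h' h.le (hmem hd))
    intro c hc d hd h
    obtain ⟨p, hc⟩ := (mem_occupied_iff hT c).1 hc
    obtain ⟨q, hd⟩ := (mem_occupied_iff hT d).1 hd
    exact Prod.ext (le_antisymm (not_lt.1 (key hd hc h.symm)) (not_lt.1 (key hc hd h))) h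

theorem blockCondition_iff (hk : 0 < k) (hγ : IsCore (k + 1) γ) (hv : ValidPath k γ L)
    (hT : ∀ p < L.length, ∀ c, o + p + 1 ∈ T c ↔ StepCell k γ L p c) :
    BlockCondition k T (Finset.Icc (1 + o) (o + L.length)) L.length ↔
      CycInc L ∧ SortedPath k γ L :=
  ⟨fun h => ⟨cycInc_of_blockCondition hk hγ hv hT h, sortedPath_of_blockCondition hk hγ hv hT h⟩,
    fun h => blockCondition_of hk hγ hv hT h.1 h.2⟩

end
end

section
variable {k : ℕ}

/-! ### Existence of the core of a bounded partition -/

open Classical in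
/-- The number of horizontal steps of `γ` among the `k` positions before `t`. -/
noncomputable def gaps (k : ℕ) (γ : YoungDiagram) (t : ℤ) : ℕ :=
  ((Finset.Ico (t - k) t).filter fun e => e ∉ maya γ).card

/-- Cells of row `r` with hook length at most `k` are the horizontal steps at distance at most `k`
before the end of the row. -/
theorem boundedRowLen_eq_gaps (γ : YoungDiagram) (r : ℕ) :
    boundedRowLen k γ r = gaps k γ (rowPos γ r) := by
  classical
  rw [boundedRowLen, gaps]
  refine Finset.card_bij (fun j _ => (j : ℤ) - γ.colLen j) ?_ ?_ ?_
  · intro j hj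
    rw [Finset.mem_filter, Finset.mem_range, ← YoungDiagram.mem_iff_lt_rowLen] at hj
    have h1 := hookLength_eq hj.1
    have h2 := mem_iff_col_lt_rowPos.1 hj.1
    rw [Finset.mem_filter, Finset.mem_Ico]
    exact ⟨by omega, col_notMem_maya γ j⟩
  · intro j _ j' _ h
    rcases lt_trichotomy j j' with h1 | h1 | h1
    · have := γ.colLen_anti j j' h1.le
      omega
    · exact h1
    · have := γ.colLen_anti j' j h1.le
      omega
  · intro e he
    rw [Finset.mem_filter, Finset.mem_Ico] at he
    obtain ⟨j, rfl⟩ := exists_col_of_notMem_maya he.2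
    have h1 : (r, j) ∈ γ := mem_iff_col_lt_rowPos.2 he.1.2
    have h2 := hookLength_eq h1
    refine ⟨j, ?_, rfl⟩
    rw [Finset.mem_filter, Finset.mem_range]
    exact ⟨YoungDiagram.mem_iff_lt_rowLen.1 h1, by omega⟩

open Classical in
theorem gaps_succ (γ : YoungDiagram) (t : ℤ) :
    gaps k γ (t + 1) + (if t - k ∈ maya γ then 0 else 1) =
      gaps k γ t + (if t ∈ maya γ then 0 else 1) := by
  have h1 : ((Finset.Ico (t - k) (t + 1)).filter fun e => e ∉ maya γ).card =
      gaps k γ t + (if t ∈ maya γ then 0 else 1) := by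
    rw [gaps, ← Finset.insert_Ico_right_eq_Ico_add_one (by omega), Finset.filter_insert]
    split_ifs
    · rfl
    · rw [Finset.card_insert_of_notMem (by simp)]
  have h2 : ((Finset.Ico (t - k) (t + 1)).filter fun e => e ∉ maya γ).card =
      gaps k γ (t + 1) + (if t - k ∈ maya γ then 0 else 1) := by
    have : Finset.Ico (t - k) (t + 1) = insert (t - k) (Finset.Ico (t + 1 - k) (t + 1)) := by
      ext x
      simp only [Finset.mem_Ico, Finset.mem_insert]
      omega
    rw [gaps, this, Finset.filter_insert]
    split_ifs
    · rfl
    · rw [Finset.card_insert_of_notMem]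
      simp only [Finset.mem_filter, Finset.mem_Ico]
      omega
  rw [← h1, h2]

theorem gaps_top (γ : YoungDiagram) : gaps k γ (rowPos γ 0 + 1 + k) = k := by
  classical
  rw [gaps, Finset.filter_true_of_mem, Int.card_Ico]
  · omega
  · intro e he he'
    rw [Finset.mem_Ico] at he
    have := le_rowPos_zero he'
    omega

/-- Discrete intermediate values: as the window slides past the bottom row, its count changes by at
most one per step until it reaches `k`. At the first `t` with count at least `n`, the position `t -
(k + 1)` that has just left the window is a vertical step, as the core condition requires. -/
theorem exists_gaps_eq (γ : YoungDiagram) {n : ℕ} (h : gaps k γ (rowPos γ 0) ≤ n) (hn : n ≤ k) :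
    ∃ t, rowPos γ 0 < t ∧ t - (k + 1) ∈ maya γ ∧ gaps k γ t = n := by
  classical
  have hex : ∃ s : ℕ, n ≤ gaps k γ (rowPos γ 0 + 1 + s) := ⟨k, by rwa [gaps_top]⟩
  have h1 := Nat.find_spec hex
  have h2 : ∀ s < Nat.find hex, gaps k γ (rowPos γ 0 + 1 + s) < n := fun s hs =>
    not_le.1 (Nat.find_min hex hs)
  rcases hs : Nat.find hex with _ | s
  -- No slide beyond the first: the entering position is vertical, so the count cannot grow, and
  -- both inequalities become equalities.
  · rw [hs] at h1
    have h3 := gaps_succ (k := k) γ (rowPos γ 0)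
    rw [if_pos (rowPos_mem_maya γ 0)] at h3
    simp only [Nat.cast_zero, add_zero] at h1 h3
    refine ⟨rowPos γ 0 + 1, by omega, ?_, ?_⟩
    · by_contra h4
      rw [show rowPos γ 0 + 1 - ((k : ℤ) + 1) = rowPos γ 0 - k by ring] at h4
      rw [if_neg h4] at h3
      omega
    · split_ifs at h3 <;> omega
  · rw [hs] at h1 h2
    have h3 := gaps_succ (k := k) γ (rowPos γ 0 + 1 + s)
    have h4 := h2 s (by omega)
    have h5 : rowPos γ 0 + 1 + s ∉ maya γ := fun h => by
      have := le_rowPos_zero h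
      omega
    rw [if_neg h5] at h3
    rw [show rowPos γ 0 + 1 + ((s + 1 : ℕ) : ℤ) = rowPos γ 0 + 1 + s + 1 by push_cast; ring] at h1
    refine ⟨rowPos γ 0 + 1 + s + 1, by omega, ?_, ?_⟩
    · by_contra h6
      rw [show rowPos γ 0 + 1 + s + 1 - ((k : ℤ) + 1) = rowPos γ 0 + 1 + s - k by ring] at h6
      rw [if_neg h6] at h3
      omega
    · split_ifs at h3 <;> omega

theorem exists_prepend_row (γ : YoungDiagram) {n : ℕ} (h : γ.rowLen 0 ≤ n) :
    ∃ δ : YoungDiagram, δ.rowLen 0 = n ∧ ∀ r, δ.rowLen (r + 1) = γ.rowLen r := by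
  classical
  obtain ⟨δ, hδ⟩ : ∃ δ : YoungDiagram, ∀ c, c ∈ δ ↔
      (c.1 = 0 ∧ c.2 < n) ∨ ∃ r, c.1 = r + 1 ∧ (r, c.2) ∈ γ := by
    obtain ⟨S, hS⟩ : ∃ S : Finset (ℕ × ℕ), ∀ c, c ∈ S ↔
        (c.1 = 0 ∧ c.2 < n) ∨ ∃ r, c.1 = r + 1 ∧ (r, c.2) ∈ γ := by
      refine ⟨(Finset.range n).image (fun j => (0, j)) ∪
        γ.cells.image (fun c => (c.1 + 1, c.2)), fun c => ?_⟩
      obtain ⟨a, b⟩ := c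
      simp only [Finset.mem_union, Finset.mem_image, Finset.mem_range, Prod.mk.injEq,
        YoungDiagram.mem_cells, Prod.exists]
      constructor
      · rintro (⟨j, hj, h3, h4⟩ | ⟨r, j, hj, h3, h4⟩)
        · exact Or.inl ⟨h3.symm, by omega⟩
        · exact Or.inr ⟨r, h3.symm, by rwa [← h4]⟩
      · rintro (⟨h3, h4⟩ | ⟨r, h3, h4⟩)
        · exact Or.inl ⟨b, h4, h3.symm, rfl⟩
        · exact Or.inr ⟨r, b, h4, h3.symm, rfl⟩
    have hlow : IsLowerSet (S : Set (ℕ × ℕ)) := by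
      rintro ⟨a, b⟩ ⟨a', b'⟩ hle hab
      have h1 : a' ≤ a := hle.1
      have h2 : b' ≤ b := hle.2
      rw [Finset.mem_coe, hS] at hab ⊢
      rcases hab with ⟨h3, h4⟩ | ⟨r, h3, hj⟩
      · exact Or.inl ⟨by simp only at *; omega, by simp only at *; omega⟩
      · simp only at h3 hj
        rcases a' with _ | a'
        · refine Or.inl ⟨rfl, ?_⟩
          have h5 : (0, b) ∈ γ := γ.up_left_mem (Nat.zero_le r) le_rfl hj
          rw [YoungDiagram.mem_iff_lt_rowLen] at h5
          simp only
          omega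
        · exact Or.inr ⟨a', rfl, γ.up_left_mem (by omega) h2 hj⟩
    exact ⟨⟨S, hlow⟩, fun c => hS c⟩
  refine ⟨δ, ?_, fun r => ?_⟩
  · refine eq_of_forall_lt_iff fun j => ?_
    rw [← YoungDiagram.mem_iff_lt_rowLen, hδ]
    simp
  · refine eq_of_forall_lt_iff fun j => ?_
    rw [← YoungDiagram.mem_iff_lt_rowLen, hδ, ← YoungDiagram.mem_iff_lt_rowLen]
    simp

/-- The core is built from the top row downwards: a new bottom row is inserted, its end placed so as
to have the right number of short hooks and to keep the core condition. -/
theorem exists_isCore_boundedRowLen_eq (L : ℕ) (p : ℕ → ℕ) (hp : Antitone p) (h0 : p 0 ≤ k)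
    (hL : ∀ r, L ≤ r → p r = 0) : ∃ γ, IsCore (k + 1) γ ∧ boundedRowLen k γ = p := by
  classical
  induction L generalizing p with
  | zero =>
    refine ⟨⊥, isCore_bot _, funext fun r => ?_⟩
    rw [hL r (Nat.zero_le r), boundedRowLen, rowLen_bot]
    rfl
  | succ L ih =>
    obtain ⟨γ, hγ, hb⟩ := ih (fun r => p (r + 1)) (fun a b hab => hp (by omega))
      ((hp (Nat.zero_le 1)).trans h0) (fun r hr => hL (r + 1) (by omega))
    have hb' : ∀ r, gaps k γ (rowPos γ r) = p (r + 1) := fun r => by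
      rw [← boundedRowLen_eq_gaps, hb]
    obtain ⟨t, ht, hmem, hgap⟩ := exists_gaps_eq (k := k) γ (n := p 0)
      (by rw [hb']; exact hp (Nat.zero_le 1)) h0
    have ht' : (γ.rowLen 0 : ℤ) ≤ t := by
      simp only [rowPos] at ht
      push_cast at ht
      omega
    obtain ⟨n, rfl⟩ : ∃ n : ℕ, t = n := ⟨t.toNat, by omega⟩
    obtain ⟨δ, hδ0, hδ⟩ := exists_prepend_row γ (n := n) (by omega)
    -- Inserting a bottom row shifts the old positions down by one, so the old position `t` is `n -
    -- 1` in the new diagram, the end of a row of length `n = t`.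
    have r0 : rowPos δ 0 + 1 = n := by simp [rowPos, hδ0]
    have r1 : ∀ r, rowPos δ (r + 1) + 1 = rowPos γ r := fun r => by
      simp only [rowPos, hδ]
      push_cast
      ring
    have hmaya : ∀ x, x ∈ maya δ ↔ x + 1 = n ∨ x + 1 ∈ maya γ := by
      intro x
      constructor
      · rintro ⟨_ | r, rfl⟩
        · exact Or.inl r0
        · rw [r1]
          exact Or.inr ⟨r, rfl⟩
      · rintro (h | ⟨r, hr⟩)
        · exact ⟨0, by omega⟩
        · exact ⟨r + 1, by have := r1 r; omega⟩
    have hgaps : ∀ x : ℤ, x + 1 ≤ n → gaps k δ x = gaps k γ (x + 1) := by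
      intro x hx
      rw [gaps, gaps]
      refine Finset.card_bij (fun e _ => e + 1) ?_ ?_ ?_
      · intro e he
        rw [Finset.mem_filter, Finset.mem_Ico, hmaya, not_or] at he
        rw [Finset.mem_filter, Finset.mem_Ico]
        exact ⟨by omega, he.2.2⟩
      · intro e _ e' _ h
        omega
      · intro e he
        rw [Finset.mem_filter, Finset.mem_Ico] at he
        refine ⟨e - 1, ?_, by ring⟩
        rw [Finset.mem_filter, Finset.mem_Ico, hmaya, not_or, sub_add_cancel]
        exact ⟨by omega, by omega, he.2⟩
    refine ⟨δ, ?_, funext fun r => ?_⟩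
    · rw [isCore_iff] at hγ ⊢
      intro x hx
      rw [hmaya] at hx ⊢
      refine Or.inr ?_
      rw [show x - ((k : ℤ) + 1) + 1 = x + 1 - (k + 1) by ring]
      rcases hx with hx | hx
      · rwa [hx]
      · exact hγ _ hx
    · rw [boundedRowLen_eq_gaps, hgaps]
      · rcases r with _ | r
        · rw [r0, hgap]
        · rw [r1, hb']
      · rcases r with _ | r
        · exact r0.le
        · rw [r1]
          exact ((rowPos_strictAnti γ).antitone (Nat.zero_le r)).trans ht.le

theorem isCore_coreOf {lam : YoungDiagram} (hlam : lam.rowLen 0 ≤ k) :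
    IsCore (k + 1) (coreOf k lam) := by
  obtain ⟨L, hL⟩ := exists_rowLen_eq_zero lam
  obtain ⟨γ, hγ, h⟩ := exists_isCore_boundedRowLen_eq L lam.rowLen
    (fun a b hab => lam.rowLen_anti a b hab) hlam hL
  exact Function.invFunOn_mem (s := {γ | IsCore (k + 1) γ}) ⟨γ, hγ, h⟩

end

section
variable {k m : ℕ}

/-! ### Products of cyclically decreasing elements -/

theorem exists_isRep_of_foldl_heckeMul (hk : 0 < k) {γ : YoungDiagram} (hγ : IsCore (k + 1) γ)
    (f : Fin m → AffinePerm k) (xs : List (Fin m)) {u : AffinePerm k} {n : ℕ}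
    (h : IsRep k γ (xs.foldl (fun u x => heckeMul k (f x) u) u) n) :
    ∃ δ n', IsCore (k + 1) δ ∧ IsRep k δ u n' := by
  induction xs generalizing u with
  | nil => exact ⟨γ, n, hγ, h⟩
  | cons x xs ih =>
    obtain ⟨δ, n', hδ, h1⟩ := ih h
    exact exists_isRep_of_heckeMul hk hδ h1

/-- By backward stability every partial product of a factorization is again Grassmannian, so the
blocks can be treated one at a time. -/
theorem foldl_heckeMul_eq_iff (hk : 0 < k) {Ls : Fin m → List (ZMod (k + 1))}
    (hLs : ∀ x, CycInc (Ls x)) (xs : List (Fin m)) {γ δ : YoungDiagram}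
    (hγ : IsCore (k + 1) γ) (hδ : IsCore (k + 1) δ) {u w : AffinePerm k} {n n' : ℕ}
    (hu : IsRep k γ u n) (hw : IsRep k δ w n') :
    xs.foldl (fun u x => heckeMul k ((cox k).wordProd (Ls x).reverse) u) u = w ↔
      ValidPath k γ (xs.flatMap Ls) ∧ addPath k γ (xs.flatMap Ls) = δ := by
  induction xs generalizing γ u n with
  | nil =>
    simp only [List.foldl_nil, List.flatMap_nil, ValidPath, addPath, true_and]
    constructor
    · rintro rfl
      exact hu.core_unique hk hγ hδ hw
    · rintro rfl
      exact (hu.unique hk hγ hw).1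
  | cons x xs ih =>
    rw [List.foldl_cons, List.flatMap_cons, validPath_append, addPath_append]
    have hγ1 := isCore_addPath hk hγ (Ls x)
    constructor
    · intro h
      obtain ⟨δ1, n1, hδ1, h1⟩ := exists_isRep_of_foldl_heckeMul hk hδ
        (fun x => (cox k).wordProd (Ls x).reverse) xs (h.symm ▸ hw)
      obtain ⟨h2, rfl⟩ := (heckeMul_eq_iff hk hγ hδ1 hu h1 (hLs x)).1 rfl
      obtain ⟨h3, h4⟩ := (ih hγ1 h1).1 h
      exact ⟨⟨h2, h3⟩, h4⟩
    · rintro ⟨⟨h2, h3⟩, h4⟩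
      obtain ⟨w1, n1, h1⟩ := exists_isRep hk _ hγ1
      rw [(heckeMul_eq_iff hk hγ hγ1 hu h1 (hLs x)).2 ⟨h2, rfl⟩]
      exact (ih hγ1 h1).2 ⟨h3, h4⟩

theorem flatMap_path_eq_of_perm (hk : 0 < k) {Ls Ls' : Fin m → List (ZMod (k + 1))}
    (hp : ∀ x, (Ls x).Perm (Ls' x)) (h : ∀ x, CycInc (Ls x)) (h' : ∀ x, CycInc (Ls' x))
    (xs : List (Fin m)) {γ : YoungDiagram} (hγ : IsCore (k + 1) γ) :
    addPath k γ (xs.flatMap Ls) = addPath k γ (xs.flatMap Ls') ∧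
      (ValidPath k γ (xs.flatMap Ls) ↔ ValidPath k γ (xs.flatMap Ls')) := by
  induction xs generalizing γ with
  | nil => exact ⟨rfl, Iff.rfl⟩
  | cons x xs ih =>
    obtain ⟨h1, h2, -⟩ := path_eq_of_perm hk hγ (hp x) (h x) (h' x)
    simp only [List.flatMap_cons, addPath_append, validPath_append]
    rw [h1, h2, (ih (isCore_addPath hk hγ _)).1, (ih (isCore_addPath hk hγ _)).2]
    exact ⟨rfl, Iff.rfl⟩

/-! ### Block decompositions of words -/

/-- The concatenation of the blocks that precede the block `x`. -/
def blockPrefix (Ls : Fin m → List (ZMod (k + 1))) (x : Fin m) : List (ZMod (k + 1)) :=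
  ((List.finRange m).take x).flatMap Ls

theorem flatMap_finRange_eq (Ls : Fin m → List (ZMod (k + 1))) (x : Fin m) :
    ∃ B, (List.finRange m).flatMap Ls = blockPrefix Ls x ++ Ls x ++ B := by
  refine ⟨((List.finRange m).drop (x + 1)).flatMap Ls, ?_⟩
  conv_lhs => rw [← List.take_append_drop x (List.finRange m)]
  rw [List.drop_eq_getElem_cons (by simp), List.flatMap_append, List.flatMap_cons, blockPrefix,
    List.append_assoc]
  simp

theorem length_blockPrefix {Ls : Fin m → List (ZMod (k + 1))} {α : Fin m → ℕ}
    (h : ∀ x, (Ls x).length = α x) (x : Fin m) :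
    (blockPrefix Ls x).length = ∑ y ∈ Finset.Iio x, α y := by
  rw [blockPrefix, List.length_flatMap, List.map_take, ← List.ofFn_eq_map, List.sum_take_ofFn]
  simp only [h]
  congr 1
  ext y
  simp

theorem length_flatMap_finRange {Ls : Fin m → List (ZMod (k + 1))} {α : Fin m → ℕ}
    (h : ∀ x, (Ls x).length = α x) : ((List.finRange m).flatMap Ls).length = ∑ x, α x := by
  rw [List.length_flatMap, ← List.ofFn_eq_map, List.sum_ofFn]
  simp only [h]

theorem alphabet_eq (α : Fin m → ℕ) (x : Fin m) :
    alphabet α x = Finset.Icc (1 + ∑ y ∈ Finset.Iio x, α y) (∑ y ∈ Finset.Iio x, α y + α x) := by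
  rw [alphabet, ← Finset.Iio_insert, Finset.sum_insert (by simp), add_comm (α x)]

theorem exists_blocks (α : Fin m → ℕ) {R : List (ZMod (k + 1))} (h : R.length = ∑ x, α x) :
    ∃ Ls : Fin m → List (ZMod (k + 1)), (∀ x, (Ls x).length = α x) ∧
      (List.finRange m).flatMap Ls = R := by
  induction m generalizing R with
  | zero =>
    refine ⟨fun _ => [], fun x => x.elim0, ?_⟩
    have : R = [] := List.eq_nil_of_length_eq_zero (by simpa using h)
    simp [this]
  | succ m ih =>
    rw [Fin.sum_univ_succ] at h
    obtain ⟨Ls, h1, h2⟩ := ih (fun x => α x.succ) (R := R.drop (α 0)) (by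
      rw [List.length_drop]
      omega)
    refine ⟨Fin.cons (R.take (α 0)) Ls, fun x => ?_, ?_⟩
    · refine Fin.cases ?_ (fun x => ?_) x
      · rw [Fin.cons_zero, List.length_take]
        omega
      · rw [Fin.cons_succ, h1]
    · rw [List.finRange_succ, List.flatMap_cons, Fin.cons_zero, List.flatMap_map]
      simp only [Fin.cons_succ]
      rw [h2, List.take_append_drop]

theorem blocks_injective {Ls Ls' : Fin m → List (ZMod (k + 1))} {α : Fin m → ℕ}
    (h : ∀ x, (Ls x).length = α x) (h' : ∀ x, (Ls' x).length = α x)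
    (heq : (List.finRange m).flatMap Ls = (List.finRange m).flatMap Ls') : Ls = Ls' := by
  funext x
  obtain ⟨B, hB⟩ := flatMap_finRange_eq Ls x
  obtain ⟨B', hB'⟩ := flatMap_finRange_eq Ls' x
  rw [hB, hB'] at heq
  have h1 : (blockPrefix Ls x).length = (blockPrefix Ls' x).length := by
    rw [length_blockPrefix h, length_blockPrefix h']
  obtain ⟨h2, -⟩ := List.append_inj heq (by simp [h1, h, h'])
  exact (List.append_inj h2 h1).2

/-! ### The bijection -/

/-- The words of residues, one for each block, that encode the affine set-valued tableaux of shape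
`γ` and weight `α`. -/
def codes (k : ℕ) (γ : YoungDiagram) (α : Fin m → ℕ) : Set (Fin m → List (ZMod (k + 1))) :=
  {Ls | (∀ x, (Ls x).length = α x) ∧ ValidPath k ⊥ ((List.finRange m).flatMap Ls) ∧
    addPath k ⊥ ((List.finRange m).flatMap Ls) = γ ∧
    ∀ x, CycInc (Ls x) ∧ SortedPath k (addPath k ⊥ (blockPrefix Ls x)) (Ls x)}

theorem blockCondition_tabOf_iff (hk : 0 < k) {Ls : Fin m → List (ZMod (k + 1))} {α : Fin m → ℕ}
    (h : ∀ x, (Ls x).length = α x) (hv : ValidPath k ⊥ ((List.finRange m).flatMap Ls))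
    (x : Fin m) :
    BlockCondition k (tabOf k ((List.finRange m).flatMap Ls)) (alphabet α x) (α x) ↔
      CycInc (Ls x) ∧ SortedPath k (addPath k ⊥ (blockPrefix Ls x)) (Ls x) := by
  obtain ⟨B, hB⟩ := flatMap_finRange_eq Ls x
  rw [hB] at hv ⊢
  rw [alphabet_eq, ← h x, ← length_blockPrefix h]
  refine blockCondition_iff hk (isCore_addPath hk (isCore_bot _) _) ?_ fun p hp c => ?_
  · rw [validPath_append, validPath_append] at hv
    exact hv.1.2
  · rw [succ_mem_tabOf, stepCell_append _ _ _ _ hp]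

theorem tabOf_mem_affineSVTableaux_iff (hk : 0 < k) {γ : YoungDiagram}
    {Ls : Fin m → List (ZMod (k + 1))} {α : Fin m → ℕ} (h : ∀ x, (Ls x).length = α x)
    (hv : ValidPath k ⊥ ((List.finRange m).flatMap Ls))
    (hγ : addPath k ⊥ ((List.finRange m).flatMap Ls) = γ) :
    tabOf k ((List.finRange m).flatMap Ls) ∈ affineSVTableaux k γ α ↔ Ls ∈ codes k γ α := by
  have h1 : IsStandard k γ (∑ x, α x) (tabOf k ((List.finRange m).flatMap Ls)) := by
    rw [← hγ, ← length_flatMap_finRange h]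
    exact isStandard_tabOf hk hv
  constructor
  · rintro ⟨-, h2⟩
    exact ⟨h, hv, hγ, fun x => (blockCondition_tabOf_iff hk h hv x).1 (h2 x)⟩
  · rintro ⟨-, -, -, h2⟩
    exact ⟨h1, fun x => (blockCondition_tabOf_iff hk h hv x).2 (h2 x)⟩

theorem nonempty_codes_equiv_tableaux (hk : 0 < k) (γ : YoungDiagram) (α : Fin m → ℕ) :
    Nonempty (codes k γ α ≃ affineSVTableaux k γ α) := by
  refine ⟨Equiv.ofBijective (fun Ls => ⟨tabOf k ((List.finRange m).flatMap Ls.1),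
    (tabOf_mem_affineSVTableaux_iff hk Ls.2.1 Ls.2.2.1 Ls.2.2.2.1).2 Ls.2⟩) ⟨?_, ?_⟩⟩
  · rintro ⟨Ls, h⟩ ⟨Ls', h'⟩ heq
    have h1 := tabOf_injOn hk h.2.1
      (by rw [length_flatMap_finRange h.1, length_flatMap_finRange h'.1])
      (congrArg Subtype.val heq)
    exact Subtype.ext (blocks_injective h.1 h'.1 h1)
  · rintro ⟨T, hT⟩
    obtain ⟨R, hl, hv, hγ, rfl⟩ := exists_word_of_isStandard hk hT.1
    obtain ⟨Ls, h, rfl⟩ := exists_blocks α hl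
    exact ⟨⟨Ls, (tabOf_mem_affineSVTableaux_iff hk h hv hγ).1 hT⟩, rfl⟩

theorem wordProd_mem_alphaFactorizations_iff (hk : 0 < k) {γ : YoungDiagram}
    (hγ : IsCore (k + 1) γ) {w : AffinePerm k} {n : ℕ} (hw : IsRep k γ w n) {α : Fin m → ℕ}
    {Ls : Fin m → List (ZMod (k + 1))} (hc : ∀ x, CycInc (Ls x)) :
    (fun x => (cox k).wordProd (Ls x).reverse) ∈ alphaFactorizations k α w ↔
      (∀ x, (Ls x).length = α x) ∧ ValidPath k ⊥ ((List.finRange m).flatMap Ls) ∧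
        addPath k ⊥ ((List.finRange m).flatMap Ls) = γ := by
  have h1 : ∀ x, IsCyclicallyDecreasing k ((cox k).wordProd (Ls x).reverse) := fun x =>
    ⟨_, (isCyclicallyDecreasingWord_reverse_iff hk).2 (hc x), rfl⟩
  have h2 : ∀ x, (cox k).length ((cox k).wordProd (Ls x).reverse) = (Ls x).length := fun x => by
    rw [(isReduced_of_nodup hk (List.nodup_reverse.2 (hc x).nodup)).eq, List.length_reverse]
  rw [alphaFactorizations, Set.mem_ofPred_eq, List.ofFn_eq_map, List.foldl_map,
    foldl_heckeMul_eq_iff hk hc _ (isCore_bot _) hγ .bot hw]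
  simp only [h1, h2, true_and]

theorem nonempty_codes_equiv_alphaFactorizations (hk : 0 < k) {γ : YoungDiagram}
    (hγ : IsCore (k + 1) γ) {w : AffinePerm k} {n : ℕ} (hw : IsRep k γ w n) (α : Fin m → ℕ) :
    Nonempty (codes k γ α ≃ alphaFactorizations k α w) := by
  refine ⟨Equiv.ofBijective (fun Ls => ⟨fun x => (cox k).wordProd (Ls.1 x).reverse,
    (wordProd_mem_alphaFactorizations_iff hk hγ hw fun x => (Ls.2.2.2.2 x).1).2
      ⟨Ls.2.1, Ls.2.2.1, Ls.2.2.2.1⟩⟩) ⟨?_, ?_⟩⟩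
  · rintro ⟨Ls, h⟩ ⟨Ls', h'⟩ heq
    have hc : ∀ x, CycInc (Ls x) := fun x => (h.2.2.2 x).1
    have hc' : ∀ x, CycInc (Ls' x) := fun x => (h'.2.2.2 x).1
    have hp : ∀ x, (Ls x).Perm (Ls' x) := fun x => by
      have h1 := perm_of_wordProd_eq hk (List.nodup_reverse.2 (hc x).nodup)
        (isReduced_of_nodup hk (List.nodup_reverse.2 (hc' x).nodup))
        (congrFun (congrArg Subtype.val heq) x)
      exact (List.reverse_perm _).symm.trans (h1.trans (List.reverse_perm _))
    refine Subtype.ext (funext fun x => ?_)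
    have h1 := (h'.2.2.2 x).2
    -- Sortedness depends on the core where the block starts; permuting earlier blocks does not
    -- change it, so both words are sorted from the same core.
    rw [blockPrefix, ← (flatMap_path_eq_of_perm hk hp hc hc' _ (isCore_bot _)).1] at h1
    exact eq_of_sortedPath hk (isCore_addPath hk (isCore_bot _) _) (hp x) (hc x) (hc' x)
      (h.2.2.2 x).2 h1
  · rintro ⟨f, hf⟩
    choose ω hω hprod using fun x => (hf.1 x).1
    have hc : ∀ x, CycInc (ω x).reverse := fun x => by
      rw [← isCyclicallyDecreasingWord_reverse_iff hk, List.reverse_reverse]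
      exact hω x
    -- All blocks are sorted at once, from the cores reached by the unsorted prefixes; sorting the
    -- prefixes does not move these cores.
    choose Ls hp hc' hs using fun x => exists_sortedPath hk
      (isCore_addPath hk (isCore_bot (k + 1)) (blockPrefix (fun x => (ω x).reverse) x)) (hc x)
    have hf' : (fun x => (cox k).wordProd (Ls x).reverse) = f := funext fun x => by
      rw [← wordProd_reverse_eq_of_perm (hp x) (hc x) (hc' x), List.reverse_reverse, hprod]
    subst hf'
    obtain ⟨h1, h2, h3⟩ := (wordProd_mem_alphaFactorizations_iff hk hγ hw hc').1 hf
    refine ⟨⟨Ls, h1, h2, h3, fun x => ⟨hc' x, ?_⟩⟩, rfl⟩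
    rw [blockPrefix, ← (flatMap_path_eq_of_perm hk hp hc hc' _ (isCore_bot _)).1]
    exact hs x

end
end AffineSV

theorem mainTheorem2 (k : ℕ) (hk : 0 < k) (lam : YoungDiagram) (hlam : lam.rowLen 0 ≤ k)
    (m : ℕ) (α : Fin m → ℕ) (hα : ∀ x, α x ≤ k) :
    Nonempty (AffineSV.affineSVTableaux k (AffineSV.coreOf k lam) α ≃
      AffineSV.alphaFactorizations k α (AffineSV.grassmannianOf k lam)) := by
  have hγ := AffineSV.isCore_coreOf hlam
  obtain ⟨n, hw⟩ := AffineSV.grassmannianOf_isRep hk hγ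
  obtain ⟨e⟩ := AffineSV.nonempty_codes_equiv_tableaux hk (AffineSV.coreOf k lam) α
  obtain ⟨e'⟩ := AffineSV.nonempty_codes_equiv_alphaFactorizations hk hγ hw α
  exact ⟨e.symm.trans e'⟩
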